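/- All manifolds are smooth and finite-dimensional, all bundles are smooth. For a $T$-valued alternating $(k+1)$-form $\hat\omega$ on a vector space $V$ let $\hat\omega^\flat(v)=\mathrm{i}_v\hat\omega$. For a subspace $L$ let $L^\perp$ denote its annihilator in the dual space. **Polylagrangian bundles.** A non-zero form $\hat\omega\in\bigwedge^{k+1}V^*\otimes T$ is *polylagrangian of rank $N$* if $V$ has a subspace $L$ of codimension $N$ which is *polylagrangian*, i.e. $\hat\omega^\flat(L)=\bigwedge^k L^\perp\otimes T$. Let $\pi:P\to M$ be a fiber bundle with vertical bundle $VP=\ker T\pi$, and let $\hat T$ be an $\hat n$-dimensional vector bundle over $M$. A *polylagrangian form of rank $N$* on $P$ is a vertical $(k+1)$-form $\hat\omega\in\Gamma(\bigwedge^{k+1}V^*P\otimes\pi^*\hat T)$ of constant rank that is vertically closed, $d_V\hat\omega=0$ (where $d_V$ is given by Cartan's formula on vertical fields, which act on sections of $\pi^*\hat T$ by directional derivatives along the fibers), and such that each $\hat\omega_p$ is polylagrangian of rank $N$ on $V_pP$. **Multilagrangian bundles.** Let $W$ be a vector space with a subspace $V$. An $r$-form on $W$ is *$(r-s)$-horizontal*,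 written $\alpha\in\bigwedge^r_s W^*$, if its contraction with more than $s$ vectors of $V$ vanishes. For $1\le r\le k+1$, a non-zero $\omega\in\bigwedge^{k+1}_r W^*$ is *multilagrangian of rank $N$ and horizontality degree $k+1-r$* if $V$ has a subspace $L$ of codimension $N$ in $V$ which is *multilagrangian*, i.e. $\omega^\flat(L)=\bigwedge^kL^\perp\cap\bigwedge^k_{r-1}W^*$. A *multilagrangian form* of rank $N$ and horizontality degree $k+1-r$ on the total space of a fiber bundle $P\to M$, $n=\dim M$, $k+1-r\le n$, is a closed $(k+1)$-form $\omega$ on $P$ of constant rank such that each $\omega_p$ is multilagrangian of rank $N$ and horizontality degree $k+1-r$ on $W=T_pP$ with respect to $V=V_pP$. **Theorem (Integrability Theorem).** Let $P$ be a fiber bundle over an $n$-dimensional manifold $M$. (a) Let $\hat\omega$ be a polylagrangian $(k+1)$-form of rank $N$ on $P$ with values in an $\hat n$-dimensional vector bundle $\hat T$ over $M$, where $k\ge1$ (or $k=0$ and $N=0$). For each $p\in P$ let $L_p\subset V_pP$ be a polylagrangian subspace of codimension $N$ for $\hat\omega_p$. If $\hat n\ge3$, then $L=(L_p)_p$ is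 a smooth distribution on $P$ and it is integrable: it is involutive, and through every point of $P$ passes an integral manifold of $L$. (b) Let $\omega$ be a multilagrangian $(k+1)$-form of rank $N$ and horizontality degree $k+1-r$ on $P$, where $1\le r\le k+1$, $k+1-r\le n$, and where $N\ge r-1$, and $N=0$ if $r=1$. For each $p\in P$ let $L_p\subset V_pP$ be a multilagrangian subspace of codimension $N$ in $V_pP$ for $\omega_p$. If $\binom{n}{k+1-r}\ge3$, then $L=(L_p)_p$ is a smooth distribution on $P$ and it is integrable: it is involutive, and through every point of $P$ passes an integral manifold of $L$. -/

import Mathlib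

open scoped Manifold ContDiff Topology
open Bundle Module VectorField Topology

noncomputable section

/-! ### Alternating forms on vector spaces -/

section LinearAlgebra

variable {V : Type*} [AddCommGroup V] [Module ℝ V] {T : Type*} [AddCommGroup T] [Module ℝ T]
  {W : Type*} [AddCommGroup W] [Module ℝ W]

/-- `⋀ᵏ L^⊥ ⊗ T`, as a space of `T`-valued `k`-forms on `V`: the forms that vanish as soon as one
of their arguments lies in `L` (these are the pull-backs of `T`-valued `k`-forms on `V ⧸ L`,
and `L^⊥` is the dual of `V ⧸ L`). For `k = 0` this is all of `T`. -/
def annihilatorForms (T : Type*) [AddCommGroup T] [Module ℝ T] (k : ℕ) (L : Submodule ℝ V) :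
    Submodule ℝ (V [⋀^Fin k]→ₗ[ℝ] T) where
  carrier := {α | ∀ v : Fin k → V, (∃ i, v i ∈ L) → α v = 0}
  add_mem' := fun {a b} ha hb v hv => by simp [ha v hv, hb v hv]
  zero_mem' := fun v _ => by simp
  smul_mem' := fun c a ha v hv => by simp [ha v hv]

/-- `⋀^r_s W^*`: the `(r - s)`-horizontal `r`-forms on a total space `W` with vertical subspace `V`,
i.e. the `r`-forms that vanish as soon as more than `s` of their arguments are vertical. -/
def horizontalForms (V : Submodule ℝ W) (r s : ℕ) : Submodule ℝ (W [⋀^Fin r]→ₗ[ℝ] ℝ) where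
  carrier := {α | ∀ (J : Finset (Fin r)) (w : Fin r → W), s < J.card → (∀ i ∈ J, w i ∈ V) → α w = 0}
  add_mem' := fun {a b} ha hb J w hJ hw => by simp [ha J w hJ hw, hb J w hJ hw]
  zero_mem' := fun J w _ _ => by simp
  smul_mem' := fun c a ha J w hJ hw => by simp [ha J w hJ hw]

/-- The codimension in `V` of (the part in `V` of) a subspace `L`. -/
def codimIn (V L : Submodule ℝ W) : ℕ := finrank ℝ (V ⧸ L.submoduleOf V)

/-- `L` is a polylagrangian subspace of `V` for the `T`-valued `(k+1)`-form `Ω`: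
the contraction map `v ↦ i_v Ω` takes `L` onto `⋀ᵏ L^⊥ ⊗ T`. -/
def IsPolylagrangianSubspace {k : ℕ} (Ω : V [⋀^Fin (k + 1)]→ₗ[ℝ] T) (L : Submodule ℝ V) : Prop :=
  L.map Ω.curryLeft = annihilatorForms T k L

/-- `Ω` is a polylagrangian form of rank `N`: it does not vanish and `V` has a polylagrangian
subspace of codimension `N`. -/
def IsPolylagrangianForm {k : ℕ} (N : ℕ) (Ω : V [⋀^Fin (k + 1)]→ₗ[ℝ] T) : Prop :=
  Ω ≠ 0 ∧ ∃ L : Submodule ℝ V, finrank ℝ (V ⧸ L) = N ∧ IsPolylagrangianSubspace Ω L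

/-- `L` is a multilagrangian subspace for the `(k+1-r)`-horizontal `(k+1)`-form `Ω` on a total
space with vertical subspace `V`: it is contained in `V`, and the contraction map takes `L` onto
`⋀ᵏ_{r-1} L^⊥ = ⋀ᵏ L^⊥ ∩ ⋀ᵏ_{r-1} W^*`. -/
def IsMultilagrangianSubspace {k : ℕ} (V : Submodule ℝ W) (r : ℕ) (Ω : W [⋀^Fin (k + 1)]→ₗ[ℝ] ℝ)
    (L : Submodule ℝ W) : Prop :=
  L ≤ V ∧ L.map Ω.curryLeft = annihilatorForms ℝ k L ⊓ horizontalForms V k (r - 1)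

/-- `Ω` is a multilagrangian `(k+1)`-form of rank `N` and horizontality degree `k+1-r` on a total
space with vertical subspace `V`. -/
def IsMultilagrangianForm {k : ℕ} (V : Submodule ℝ W) (r N : ℕ) (Ω : W [⋀^Fin (k + 1)]→ₗ[ℝ] ℝ) :
    Prop :=
  Ω ≠ 0 ∧ Ω ∈ horizontalForms V (k + 1) r ∧
    ∃ L : Submodule ℝ W, codimIn V L = N ∧ IsMultilagrangianSubspace V r Ω L

end LinearAlgebra

section Manifolds

variable {EP : Type*} [NormedAddCommGroup EP] [NormedSpace ℝ EP]
  {EM : Type*} [NormedAddCommGroup EM] [NormedSpace ℝ EM]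
  {P : Type*} [TopologicalSpace P] [ChartedSpace EP P] [IsManifold 𝓘(ℝ, EP) ∞ P]
  {M : Type*} [TopologicalSpace M] [ChartedSpace EM M]

/-! ### Vector fields and distributions on a manifold `P` modelled on `EP` -/

/-- The vector field `X` is smooth on the set `U`. -/
def SmoothFieldOn (X : ∀ p : P, TangentSpace 𝓘(ℝ, EP) p) (U : Set P) : Prop :=
  ContMDiffOn 𝓘(ℝ, EP) 𝓘(ℝ, EP).tangent ∞ (fun p => (⟨p, X p⟩ : TangentBundle 𝓘(ℝ, EP) P)) U

/-- `L` is a smooth distribution (a smooth subbundle of the tangent bundle): it has a smooth frame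
in a neighborhood of every point. -/
def IsSmoothDistribution (L : ∀ p : P, Submodule ℝ (TangentSpace 𝓘(ℝ, EP) p)) : Prop :=
  ∀ p : P, ∃ U : Set P, IsOpen U ∧ p ∈ U ∧
    ∃ (d : ℕ) (X : Fin d → ∀ q : P, TangentSpace 𝓘(ℝ, EP) q), (∀ i, SmoothFieldOn (X i) U) ∧
      ∀ q ∈ U, LinearIndependent ℝ (fun i => X i q) ∧
        Submodule.span ℝ (Set.range fun i => X i q) = L q

/-- `L` is involutive: the Lie bracket of (local) smooth sections of `L` is a section of `L`. -/
def IsInvolutiveDistribution (L : ∀ p : P, Submodule ℝ (TangentSpace 𝓘(ℝ, EP) p)) : Prop :=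
  ∀ (U : Set P) (X Y : ∀ p : P, TangentSpace 𝓘(ℝ, EP) p), IsOpen U →
    SmoothFieldOn X U → SmoothFieldOn Y U → (∀ p ∈ U, X p ∈ L p) → (∀ p ∈ U, Y p ∈ L p) →
    ∀ p ∈ U, mlieBracket 𝓘(ℝ, EP) X Y p ∈ L p

/-- `L` is integrable: through every point passes an integral manifold of `L`, i.e. a submanifold
(given as the image of a smooth embedding of an open set of some `ℝ^d`) whose
tangent space at each of its points `q` is exactly `L q`. -/
def IsIntegrableDistribution (L : ∀ p : P, Submodule ℝ (TangentSpace 𝓘(ℝ, EP) p)) : Prop :=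
  ∀ p : P, ∃ (d : ℕ) (U : Set (EuclideanSpace ℝ (Fin d))) (f : EuclideanSpace ℝ (Fin d) → P),
    IsOpen U ∧ (∃ u ∈ U, f u = p) ∧
    ContMDiffOn 𝓘(ℝ, EuclideanSpace ℝ (Fin d)) 𝓘(ℝ, EP) ∞ f U ∧
    IsEmbedding (U.domRestrict f) ∧
    ∀ u ∈ U,
      Function.Injective (mfderiv 𝓘(ℝ, EuclideanSpace ℝ (Fin d)) 𝓘(ℝ, EP) f u) ∧
      (mfderiv 𝓘(ℝ, EuclideanSpace ℝ (Fin d)) 𝓘(ℝ, EP) f u).toLinearMap.range = L (f u)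

/-! ### Fiber bundles -/

/-- `pr : P → M` is a smooth fiber bundle with typical fiber `F` (a manifold modelled on `EF`):
there are local trivializations around every point of `M` that are diffeomorphisms. -/
def IsSmoothFiberBundle (EP EM EF : Type*) [NormedAddCommGroup EP] [NormedSpace ℝ EP]
    [NormedAddCommGroup EM] [NormedSpace ℝ EM] [NormedAddCommGroup EF] [NormedSpace ℝ EF]
    {P : Type*} [TopologicalSpace P] [ChartedSpace EP P]
    {M : Type*} [TopologicalSpace M] [ChartedSpace EM M]
    (F : Type*) [TopologicalSpace F] [ChartedSpace EF F] (pr : P → M) : Prop :=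
  ∀ m : M, ∃ e : Trivialization F pr, m ∈ e.baseSet ∧
    ContMDiffOn 𝓘(ℝ, EP) (𝓘(ℝ, EM).prod 𝓘(ℝ, EF)) ∞ e e.source ∧
    ContMDiffOn (𝓘(ℝ, EM).prod 𝓘(ℝ, EF)) 𝓘(ℝ, EP) ∞ e.toOpenPartialHomeomorph.symm e.target

/-- The vertical space `V_p P`, the kernel of the derivative of the projection. -/
def verticalSpace (EP EM : Type*) [NormedAddCommGroup EP] [NormedSpace ℝ EP]
    [NormedAddCommGroup EM] [NormedSpace ℝ EM]
    {P : Type*} [TopologicalSpace P] [ChartedSpace EP P]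
    {M : Type*} [TopologicalSpace M] [ChartedSpace EM M] (pr : P → M) (p : P) :
    Submodule ℝ (TangentSpace 𝓘(ℝ, EP) p) :=
  (mfderiv 𝓘(ℝ, EP) 𝓘(ℝ, EM) pr p).toLinearMap.ker

/-- `X` is, over the open set `U`, a smooth vertical vector field. -/
def SmoothVerticalFieldOn (EM : Type*) [NormedAddCommGroup EM] [NormedSpace ℝ EM]
    [ChartedSpace EM M] (pr : P → M) (X : ∀ p : P, TangentSpace 𝓘(ℝ, EP) p) (U : Set P) : Prop :=
  SmoothFieldOn X U ∧ ∀ p ∈ U, X p ∈ verticalSpace EP EM pr p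

/-! ### Vertical forms with values in (the pull-back of) a vector bundle `T` over `M` -/

/-- A field of vertical `j`-forms on `P` with values in `pr^* T`. -/
abbrev VerticalForm (EP EM : Type*) [NormedAddCommGroup EP] [NormedSpace ℝ EP]
    [NormedAddCommGroup EM] [NormedSpace ℝ EM]
    {P : Type*} [TopologicalSpace P] [ChartedSpace EP P]
    {M : Type*} [TopologicalSpace M] [ChartedSpace EM M] (pr : P → M)
    (T : M → Type*) [∀ m, AddCommGroup (T m)] [∀ m, Module ℝ (T m)] (j : ℕ) : Type _ :=
  ∀ p : P, verticalSpace EP EM pr p [⋀^Fin j]→ₗ[ℝ] T (pr p)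

variable {FT : Type*} [NormedAddCommGroup FT] [NormedSpace ℝ FT]
  {T : M → Type*} [∀ m, AddCommGroup (T m)] [∀ m, Module ℝ (T m)]

open Classical in
/-- The value of a vertical form on tangent vectors at `p`; only meaningful (and only used) when
all the vectors are vertical. -/
def VerticalForm.eval {pr : P → M} {j : ℕ} (Ω : VerticalForm EP EM pr T j) (p : P)
    (v : Fin j → TangentSpace 𝓘(ℝ, EP) p) : T (pr p) :=
  if h : ∀ i, v i ∈ verticalSpace EP EM pr p then Ω p (fun i => ⟨v i, h i⟩) else 0

variable [TopologicalSpace (TotalSpace FT T)] [∀ m, TopologicalSpace (T m)] [FiberBundle FT T]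

/-- A vertical form is smooth if its values on local smooth vertical vector fields are smooth
sections of `pr^* T`. -/
def VerticalForm.IsSmooth (FT : Type*) [NormedAddCommGroup FT] [NormedSpace ℝ FT]
    [TopologicalSpace (TotalSpace FT T)] [FiberBundle FT T]
    {pr : P → M} {j : ℕ} (Ω : VerticalForm EP EM pr T j) : Prop :=
  ∀ (U : Set P) (X : Fin j → ∀ p : P, TangentSpace 𝓘(ℝ, EP) p), IsOpen U →
    (∀ i, SmoothVerticalFieldOn EM pr (X i) U) →
    ContMDiffOn 𝓘(ℝ, EP) (𝓘(ℝ, EM).prod 𝓘(ℝ, FT)) ∞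
      (fun p => TotalSpace.mk' FT (pr p) (Ω.eval p fun i => X i p)) U

/-- The vertical directional derivative `(X · φ)(p)` of a section `φ` of `pr^* T` in the direction of
the vertical vector `v = X p`: along the fiber through `p`, where `φ` is a function with values in
the fixed vector space `T (pr p)`, this is the directional derivative. It is computed here in a
local trivialization of `T` around `pr p`; as `v` is vertical, the choice does not matter. -/
def verticalDeriv (FT : Type*) [NormedAddCommGroup FT] [NormedSpace ℝ FT]
    [TopologicalSpace (TotalSpace FT T)] [FiberBundle FT T]
    (pr : P → M) (φ : ∀ p : P, T (pr p)) (p : P) (v : TangentSpace 𝓘(ℝ, EP) p) : T (pr p) :=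
  (trivializationAt FT T (pr p)).symm (pr p)
    (mfderiv 𝓘(ℝ, EP) 𝓘(ℝ, FT)
      (fun q => (trivializationAt FT T (pr p) ⟨pr q, φ q⟩).2) p v : FT)

/-- The value at `p` of the vertical exterior derivative `d_V Ω` of a vertical `(k+1)`-form `Ω`
on the vertical vector fields `X 0, …, X (k+1)`, by Cartan's formula
`∑ᵢ (-1)^i X_i · Ω(.., X̂_i, ..) + ∑_{i<j} (-1)^(i+j) Ω([X_i, X_j], .., X̂_i, .., X̂_j, ..)`.
The pair `i ≤ j` in the second sum of the code stands for the pair `i < j + 1` of the formula. -/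
def VerticalForm.extDerivEval (FT : Type*) [NormedAddCommGroup FT] [NormedSpace ℝ FT]
    [TopologicalSpace (TotalSpace FT T)] [FiberBundle FT T]
    {pr : P → M} {k : ℕ} (Ω : VerticalForm EP EM pr T (k + 1))
    (X : Fin (k + 2) → ∀ p : P, TangentSpace 𝓘(ℝ, EP) p) (p : P) : T (pr p) :=
  (∑ i : Fin (k + 2), (-1 : ℝ) ^ (i : ℕ) •
      verticalDeriv FT pr (fun q => Ω.eval q (i.removeNth fun l => X l q)) p (X i p)) -
    ∑ i : Fin (k + 1), ∑ j ∈ Finset.Ici i, (-1 : ℝ) ^ (i + j : ℕ) •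
      Ω.eval p (Matrix.vecCons (mlieBracket 𝓘(ℝ, EP) (X i.castSucc) (X j.succ) p)
        (j.removeNth (i.castSucc.removeNth fun l => X l p)))

/-- `d_V Ω = 0`. -/
def VerticalForm.IsVerticallyClosed (FT : Type*) [NormedAddCommGroup FT] [NormedSpace ℝ FT]
    [TopologicalSpace (TotalSpace FT T)] [FiberBundle FT T]
    {pr : P → M} {k : ℕ} (Ω : VerticalForm EP EM pr T (k + 1)) : Prop :=
  ∀ (U : Set P) (X : Fin (k + 2) → ∀ p : P, TangentSpace 𝓘(ℝ, EP) p), IsOpen U →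
    (∀ i, SmoothVerticalFieldOn EM pr (X i) U) → ∀ p ∈ U, Ω.extDerivEval FT X p = 0

/-- `Ω` is a polylagrangian `(k+1)`-form of rank `N` along the fibers of the bundle `pr : P → M`,
with coefficients in the vector bundle `T` over `M` (with typical fiber `FT`). -/
structure IsPolylagrangianBundleForm (FT : Type*) [NormedAddCommGroup FT] [NormedSpace ℝ FT]
    [TopologicalSpace (TotalSpace FT T)] [FiberBundle FT T]
    {pr : P → M} {k : ℕ} (N : ℕ) (Ω : VerticalForm EP EM pr T (k + 1)) : Prop where
  smooth : Ω.IsSmooth FT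
  constant_rank : ∃ c : ℕ, ∀ p : P, finrank ℝ (LinearMap.range (Ω p).curryLeft) = c
  closed : Ω.IsVerticallyClosed FT
  polylagrangian : ∀ p : P, IsPolylagrangianForm N (Ω p)

/-! ### Differential forms on `P` -/

/-- A field of alternating `j`-forms on the tangent spaces of `P`. -/
abbrev FormField (EP : Type*) [NormedAddCommGroup EP] [NormedSpace ℝ EP]
    (P : Type*) [TopologicalSpace P] [ChartedSpace EP P] (j : ℕ) : Type _ :=
  ∀ p : P, TangentSpace 𝓘(ℝ, EP) p [⋀^Fin j]→ₗ[ℝ] ℝ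

/-- A form is smooth if its values on local smooth vector fields are smooth. -/
def FormField.IsSmooth {j : ℕ} (Ω : FormField EP P j) : Prop :=
  ∀ (U : Set P) (X : Fin j → ∀ p : P, TangentSpace 𝓘(ℝ, EP) p), IsOpen U →
    (∀ i, SmoothFieldOn (X i) U) →
    ContMDiffOn 𝓘(ℝ, EP) 𝓘(ℝ, ℝ) ∞ (fun p => Ω p fun i => X i p) U

/-- The directional derivative of the function `f` at `p` along the tangent vector `v`. -/
def functionDeriv (f : P → ℝ) (p : P) (v : TangentSpace 𝓘(ℝ, EP) p) : ℝ :=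
  mfderiv 𝓘(ℝ, EP) 𝓘(ℝ, ℝ) f p v

/-- The value at `p` of the exterior derivative `dΩ` of a `(k+1)`-form `Ω` on the vector fields
`X 0, …, X (k+1)`, by Cartan's formula. -/
def FormField.extDerivEval {k : ℕ} (Ω : FormField EP P (k + 1))
    (X : Fin (k + 2) → ∀ p : P, TangentSpace 𝓘(ℝ, EP) p) (p : P) : ℝ :=
  (∑ i : Fin (k + 2), (-1 : ℝ) ^ (i : ℕ) *
      functionDeriv (fun q => Ω q (i.removeNth fun l => X l q)) p (X i p)) -
    ∑ i : Fin (k + 1), ∑ j ∈ Finset.Ici i, (-1 : ℝ) ^ (i + j : ℕ) *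
      Ω p (Matrix.vecCons (mlieBracket 𝓘(ℝ, EP) (X i.castSucc) (X j.succ) p)
        (j.removeNth (i.castSucc.removeNth fun l => X l p)))

/-- `dΩ = 0`. -/
def FormField.IsClosedForm {k : ℕ} (Ω : FormField EP P (k + 1)) : Prop :=
  ∀ (U : Set P) (X : Fin (k + 2) → ∀ p : P, TangentSpace 𝓘(ℝ, EP) p), IsOpen U →
    (∀ i, SmoothFieldOn (X i) U) → ∀ p ∈ U, Ω.extDerivEval X p = 0

/-- `Ω` is a multilagrangian `(k+1)`-form of rank `N` and horizontality degree `k+1-r` on the total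
space of the bundle `pr : P → M`. -/
structure IsMultilagrangianBundleForm {k : ℕ} (pr : P → M) (EM : Type*) [NormedAddCommGroup EM]
    [NormedSpace ℝ EM] [ChartedSpace EM M] (r N : ℕ) (Ω : FormField EP P (k + 1)) : Prop where
  smooth : Ω.IsSmooth
  constant_rank : ∃ c : ℕ, ∀ p : P, finrank ℝ (LinearMap.range (Ω p).curryLeft) = c
  closed : Ω.IsClosedForm
  multilagrangian : ∀ p : P, IsMultilagrangianForm (verticalSpace EP EM pr p) r N (Ω p)

end Manifolds

end

open scoped Manifold ContDiff Topology
open Bundle Module VectorField Topology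
set_option linter.unusedSectionVars false

noncomputable section

/-! Both cases follow one pattern. The contraction map `v ↦ i_v Ω` is split into scalar components:
the coordinates of `Ω` in a basis of the coefficient bundle in the polylagrangian case, and the
contractions of `Ω` with the `l`-element subfamilies of a horizontal frame in the multilagrangian
case, where `l` is the horizontality degree. The hypothesis on `n̂` or on the binomial coefficient
says that there are at least three components. Let `K c` be the space of vertical vectors whose
contraction has vanishing `c`-th component.

Three facts carry the proof. (1) `K c ≤ L`: for vertical `v ∉ L` some form in the image of `L` has
non-zero `c`-th component on arguments containing `v`; it is a contraction `i_x Ω` with `x ∈ L`, and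
antisymmetry turns it into minus a contraction with `v`, which therefore cannot have vanishing
`c`-th component. (2) `L` is the sum over `a` of the intersections of all `K b` with `b ≠ a`,
because the image of `L` contains, for each of its elements, a form with the same `a`-th component
and no other. (3) The bracket of two smooth sections of `K c` lies in `K c`: in Cartan's formula
every term vanishes except the one containing that bracket. The algebraic facts are
`IsPolylagrangianSubspace.isComponentSystem` and `isComponentSystem_of_map_curryLeft_eq`; the
analytic one is `mlieBracket_mem_kernelIn`, for vertical forms and for forms on the total space.

Given sections of the summands with indices `a` and `b`, choose `c` different from both: the two
sections lie in `K c`, hence so does their bracket, and `K c ≤ L`. The failure of involutivity is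
tensorial, so testing it on spanning sections is enough. The summands have locally constant
dimension and are cut out by smooth linear equations, so they have smooth local sections through
each of their vectors, and `L` is smooth. See `integrable_of_kernels` and
`integrable_of_componentSystems`.

Integral manifolds come from the Frobenius theorem, reduced to total differential equations. These
are solved by applying the implicit function theorem in the Banach space of continuous paths on the
unit interval to the equation of the solution along rays (`exists_hasFDerivAt_of_integrable`). -/

/-! ### Superposition operators and total differential equations -/

section Superposition

variable {K : Type*} [TopologicalSpace K] [CompactSpace K]
  {E : Type*} [NormedAddCommGroup E] [NormedSpace ℝ E]
  {F : Type*} [NormedAddCommGroup F] [NormedSpace ℝ F]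
  {G : Type*} [NormedAddCommGroup G] [NormedSpace ℝ G]

/-- A continuous bilinear map, applied pointwise to two continuous families of vectors. -/
def ContinuousMap.bilinₗ (K : Type*) [TopologicalSpace K] (B : G →L[ℝ] E →L[ℝ] F) :
    C(K, G) →ₗ[ℝ] C(K, E) →ₗ[ℝ] C(K, F) :=
  LinearMap.mk₂ ℝ (fun (A : C(K, G)) (γ : C(K, E)) =>
        (⟨fun t => B (A t) (γ t), (B.continuous.comp A.continuous).clm_apply γ.continuous⟩ :
          C(K, F)))
      (fun A B γ => by ext; simp) (fun c A γ => by ext; simp)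
      (fun A γ δ => by ext; simp) (fun c A γ => by ext; simp)

theorem ContinuousMap.norm_bilinₗ_le (B : G →L[ℝ] E →L[ℝ] F) (A : C(K, G)) (γ : C(K, E)) :
    ‖ContinuousMap.bilinₗ K B A γ‖ ≤ ‖B‖ * ‖A‖ * ‖γ‖ := by
  rw [ContinuousMap.norm_le _ (by positivity)]
  intro t
  refine (B.le_opNorm₂ (A t) (γ t)).trans ?_
  gcongr
  exacts [A.norm_coe_le_norm t, γ.norm_coe_le_norm t]

/-- A continuous bilinear map, applied pointwise to two continuous families of vectors. -/
def ContinuousMap.bilin (K : Type*) [TopologicalSpace K] [CompactSpace K]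
    (B : G →L[ℝ] E →L[ℝ] F) : C(K, G) →L[ℝ] C(K, E) →L[ℝ] C(K, F) :=
  LinearMap.mkContinuous₂ (ContinuousMap.bilinₗ K B) ‖B‖ (ContinuousMap.norm_bilinₗ_le B)

@[simp]
theorem ContinuousMap.bilin_apply (B : G →L[ℝ] E →L[ℝ] F) (A : C(K, G)) (γ : C(K, E)) (t : K) :
    ContinuousMap.bilin K B A γ t = B (A t) (γ t) := rfl

set_option synthInstance.maxHeartbeats 200000 in
/-- Pointwise evaluation of a continuous family of operators on a continuous family of vectors. -/
abbrev ContinuousMap.applyL (K E F : Type*) [TopologicalSpace K] [CompactSpace K]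
    [NormedAddCommGroup E] [NormedSpace ℝ E] [NormedAddCommGroup F] [NormedSpace ℝ F] :
    C(K, E →L[ℝ] F) →L[ℝ] C(K, E) →L[ℝ] C(K, F) :=
  ContinuousMap.bilin K (ContinuousLinearMap.id ℝ (E →L[ℝ] F))

/-- The mean value inequality on the segment from `γ t` to `γ t + h t` bounds the error by the
oscillation of `fderiv ℝ g`. This is small uniformly in `t`, since superposition with the continuous
map `fderiv ℝ g` is continuous for the sup distance. -/
theorem ContinuousMap.hasFDerivAt_postcomp {g : E → F} (hg : ContDiff ℝ 1 g) (γ : C(K, E)) :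
    HasFDerivAt (fun η : C(K, E) => (ContinuousMap.mk g hg.continuous).comp η)
      (ContinuousMap.applyL K E F
        ((ContinuousMap.mk (fderiv ℝ g) (hg.continuous_fderiv one_ne_zero)).comp γ)) γ := by
  rw [hasFDerivAt_iff_isLittleO_nhds_zero, Asymptotics.isLittleO_iff]
  intro ε hε
  have hcont := ContinuousMap.continuous_postcomp (X := K)
    (ContinuousMap.mk (fderiv ℝ g) (hg.continuous_fderiv one_ne_zero))
  obtain ⟨δ, hδ, hball⟩ := (Metric.continuous_iff (α := C(K, E)) (β := C(K, E →L[ℝ] F))).1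
    hcont γ ε hε
  filter_upwards [Metric.ball_mem_nhds (0 : C(K, E)) hδ] with h hh
  rw [ContinuousMap.norm_le _ (by positivity)]
  intro t
  have hseg : ∀ y ∈ segment ℝ (γ t) (γ t + h t), ‖fderiv ℝ g y - fderiv ℝ g (γ t)‖ ≤ ε := by
    intro y hy
    rw [segment_eq_image'] at hy
    obtain ⟨s, hs, rfl⟩ := hy
    have h1 : dist (γ + s • h) γ < δ := by
      rw [dist_eq_norm, add_sub_cancel_left, norm_smul, Real.norm_of_nonneg hs.1]
      have : ‖h‖ < δ := by simpa using hh
      nlinarith [hs.2, norm_nonneg h]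
    have h2 := (ContinuousMap.dist_apply_le_dist t).trans (hball _ h1).le
    simpa [dist_eq_norm] using h2
  have := (convex_segment (γ t) (γ t + h t)).norm_image_sub_le_of_norm_hasFDerivWithin_le'
    (f := g) (f' := fderiv ℝ g) (φ := fderiv ℝ g (γ t))
    (fun y _ => ((hg.differentiable one_ne_zero) y).hasFDerivAt.hasFDerivWithinAt) hseg
    (left_mem_segment ℝ _ _) (right_mem_segment ℝ _ _)
  simp only [add_sub_cancel_left] at this
  refine le_trans ?_ (this.trans (mul_le_mul_of_nonneg_left (h.norm_coe_le_norm t) hε.le))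
  simp

theorem ContinuousMap.contDiff_one_postcomp {g : E → F} (hg : ContDiff ℝ 1 g) :
    ContDiff ℝ 1 (fun η : C(K, E) => (ContinuousMap.mk g hg.continuous).comp η) := by
  rw [contDiff_one_iff_fderiv]
  refine ⟨fun γ => (ContinuousMap.hasFDerivAt_postcomp hg γ).differentiableAt, ?_⟩
  have : fderiv ℝ (fun η : C(K, E) => (ContinuousMap.mk g hg.continuous).comp η) = fun γ =>
      ContinuousMap.applyL K E F
        ((ContinuousMap.mk (fderiv ℝ g) (hg.continuous_fderiv one_ne_zero)).comp γ) :=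
    funext fun γ => (ContinuousMap.hasFDerivAt_postcomp hg γ).fderiv
  rw [this]
  exact (ContinuousMap.applyL K E F).continuous.comp (ContinuousMap.continuous_postcomp _)

/-- The primitive `t ↦ ∫₀ᵗ γ` of a continuous path on the unit interval. -/
def ContinuousMap.primitive (E : Type*) [NormedAddCommGroup E] [NormedSpace ℝ E] :
    C(unitInterval, E) →L[ℝ] C(unitInterval, E) :=
  LinearMap.mkContinuous
    { toFun := fun γ => ⟨fun t => ∫ s in (0 : ℝ)..t, Set.IccExtend zero_le_one γ s,
        (intervalIntegral.continuous_primitive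
          (fun a b => (γ.continuous.Icc_extend').intervalIntegrable a b) 0).comp
          continuous_subtype_val⟩
      map_add' := fun γ δ => by
        ext t
        exact intervalIntegral.integral_add (γ.continuous.Icc_extend'.intervalIntegrable _ _)
          (δ.continuous.Icc_extend'.intervalIntegrable _ _)
      map_smul' := fun c γ => by
        ext t
        exact intervalIntegral.integral_smul c _ } 1
    (fun γ => by
      rw [one_mul, ContinuousMap.norm_le _ (norm_nonneg _)]
      intro t
      refine (intervalIntegral.norm_integral_le_of_norm_le_const (C := ‖γ‖)
        (fun s _ => γ.norm_coe_le_norm _)).trans ?_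
      have h1 : |(t : ℝ) - 0| ≤ 1 := by
        rw [sub_zero, abs_of_nonneg t.2.1]; exact t.2.2
      nlinarith [norm_nonneg γ])

theorem ContinuousMap.primitive_apply (γ : C(unitInterval, E)) (t : unitInterval) :
    ContinuousMap.primitive E γ t = ∫ s in (0 : ℝ)..t, Set.IccExtend zero_le_one γ s := rfl

theorem ContinuousMap.hasDerivAt_primitive [CompleteSpace E] (γ : C(unitInterval, E)) (t : ℝ) :
    HasDerivAt (fun t : ℝ => ∫ s in (0 : ℝ)..t, Set.IccExtend zero_le_one γ s)
      (Set.IccExtend zero_le_one γ t) t :=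
  intervalIntegral.integral_hasDerivAt_right (γ.continuous.Icc_extend'.intervalIntegrable _ _)
    (γ.continuous.Icc_extend'.stronglyMeasurableAtFilter _ _) γ.continuous.Icc_extend'.continuousAt

end Superposition

/-! ### Total differential equations solved along rays. -/

section TotalDifferential

variable {E : Type*} [NormedAddCommGroup E] [NormedSpace ℝ E]
  {E₁ : Type*} [NormedAddCommGroup E₁] [NormedSpace ℝ E₁]
  {G : Type*} [NormedAddCommGroup G] [NormedSpace ℝ G]

/-- Constant families of vectors. -/
def ContinuousMap.constCLM (K E : Type*) [TopologicalSpace K] [CompactSpace K]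
    [NormedAddCommGroup E] [NormedSpace ℝ E] : E →L[ℝ] C(K, E) :=
  LinearMap.mkContinuous
    { toFun := fun v => ContinuousMap.const K v
      map_add' := fun _ _ => rfl
      map_smul' := fun _ _ => rfl } 1
    (fun v => by
      rw [one_mul, ContinuousMap.norm_le _ (norm_nonneg _)]
      exact fun _ => le_rfl)

@[simp]
theorem ContinuousMap.constCLM_apply {K : Type*} [TopologicalSpace K] [CompactSpace K] (v : E)
    (t : K) : ContinuousMap.constCLM K E v t = v := rfl

/-- The map whose zeros `(u, γ)` are the solutions of `γ' = g(γ) u`, `γ 0 = x₀`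
on the unit interval. -/
def rayMap (B : G →L[ℝ] E₁ →L[ℝ] E) (g : C(E, G)) (x₀ : E) (p : E₁ × C(unitInterval, E)) :
    C(unitInterval, E) :=
  p.2 - ContinuousMap.constCLM unitInterval E x₀ - ContinuousMap.primitive E
    (ContinuousMap.bilin unitInterval B (g.comp p.2) (ContinuousMap.constCLM unitInterval E₁ p.1))

theorem contDiff_rayMap (B : G →L[ℝ] E₁ →L[ℝ] E) {g : E → G} (hg : ContDiff ℝ 1 g) (x₀ : E) :
    ContDiff ℝ 1 (rayMap B ⟨g, hg.continuous⟩ x₀) := by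
  have h1 : ContDiff ℝ 1 fun p : E₁ × C(unitInterval, E) =>
      (ContinuousMap.mk g hg.continuous).comp p.2 :=
    (ContinuousMap.contDiff_one_postcomp (K := unitInterval) hg).comp contDiff_snd
  have h2 : ContDiff ℝ 1 fun p : E₁ × C(unitInterval, E) =>
      ContinuousMap.constCLM unitInterval E₁ p.1 :=
    (ContinuousMap.constCLM unitInterval E₁).contDiff.comp contDiff_fst
  have h3 := (ContinuousMap.bilin unitInterval B).isBoundedBilinearMap.contDiff.comp (h1.prodMk h2)
  exact (contDiff_snd.sub contDiff_const).sub ((ContinuousMap.primitive E).contDiff.comp h3)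

theorem fderiv_rayMap_apply (B : G →L[ℝ] E₁ →L[ℝ] E) {g : E → G} (hg : ContDiff ℝ 1 g) (x₀ : E)
    (p q : E₁ × C(unitInterval, E)) :
    fderiv ℝ (rayMap B ⟨g, hg.continuous⟩ x₀) p q = q.2 - ContinuousMap.primitive E
      (ContinuousMap.bilin unitInterval B
          ((ContinuousMap.mk g hg.continuous).comp p.2)
          (ContinuousMap.constCLM unitInterval E₁ q.1) +
        ContinuousMap.bilin unitInterval B
          (ContinuousMap.applyL unitInterval E G
            ((ContinuousMap.mk (fderiv ℝ g) (hg.continuous_fderiv one_ne_zero)).comp p.2) q.2)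
          (ContinuousMap.constCLM unitInterval E₁ p.1)) := by
  have h1 : HasFDerivAt (fun p : E₁ × C(unitInterval, E) =>
      (ContinuousMap.mk g hg.continuous).comp p.2) _ p :=
    (ContinuousMap.hasFDerivAt_postcomp (K := unitInterval) hg p.2).comp p hasFDerivAt_snd
  have h2 : HasFDerivAt (fun p : E₁ × C(unitInterval, E) =>
      ContinuousMap.constCLM unitInterval E₁ p.1) _ p :=
    (ContinuousMap.constCLM unitInterval E₁).hasFDerivAt.comp p hasFDerivAt_fst
  have h3 := (ContinuousMap.bilin unitInterval B).hasFDerivAt_of_bilinear h1 h2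
  have h4 := (hasFDerivAt_snd.sub (hasFDerivAt_const
    (ContinuousMap.constCLM unitInterval E x₀) p)).sub
    ((ContinuousMap.primitive E).hasFDerivAt.comp p h3)
  have h5 : HasFDerivAt (rayMap B ⟨g, hg.continuous⟩ x₀) _ p := h4
  rw [h5.fderiv]
  simp

/-- If the total differential equation `D F u h = B (g (F u)) h` satisfies its integrability
condition at the points of the ray `γ`, then `t ↦ t • B (g (γ t)) h` solves the linearized ray
equation in the direction `h`. -/
theorem fderiv_rayMap_eq_zero [CompleteSpace E] (B : G →L[ℝ] E₁ →L[ℝ] E) {g : E → G}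
    (hg : ContDiff ℝ 1 g) (x₀ : E) {u : E₁} {γ : C(unitInterval, E)}
    (hγ : rayMap B ⟨g, hg.continuous⟩ x₀ (u, γ) = 0)
    (hsym : ∀ t, ∀ v w, B (fderiv ℝ g (γ t) (B (g (γ t)) v)) w =
      B (fderiv ℝ g (γ t) (B (g (γ t)) w)) v) (h : E₁) (ζ : C(unitInterval, E))
    (hζ : ∀ t : unitInterval, ζ t = (t : ℝ) • B (g (γ t)) h) :
    fderiv ℝ (rayMap B ⟨g, hg.continuous⟩ x₀) (u, γ) (h, ζ) = 0 := by
  rw [fderiv_rayMap_apply B hg, sub_eq_zero]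
  ext t
  rw [ContinuousMap.primitive_apply]
  set a : C(unitInterval, E) := ContinuousMap.bilin unitInterval B
    ((ContinuousMap.mk g hg.continuous).comp γ) (ContinuousMap.constCLM unitInterval E₁ u) with ha
  -- The path is rewritten as a primitive defined on all of `ℝ`, so that two-sided derivatives exist
  -- at the endpoints as well.
  set c : ℝ → E := fun s => x₀ + ∫ r in (0 : ℝ)..s, Set.IccExtend zero_le_one a r with hc
  have hcγ : ∀ s : unitInterval, c s = γ s := by
    intro s
    have := congrArg (fun f : C(unitInterval, E) => f s) hγ
    simp only [rayMap, ContinuousMap.sub_apply, ContinuousMap.primitive_apply,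
      ContinuousMap.constCLM_apply, ContinuousMap.zero_apply] at this
    rw [hc]
    simp only
    rw [sub_sub, sub_eq_zero] at this
    exact this.symm
  have hcd : ∀ s, HasDerivAt c (Set.IccExtend zero_le_one a s) s := fun s =>
    (ContinuousMap.hasDerivAt_primitive a s).const_add x₀
  have hz : ∀ s ∈ Set.uIcc (0 : ℝ) t, HasDerivAt (fun s : ℝ => s • B (g (c s)) h)
      (Set.IccExtend zero_le_one
        (ContinuousMap.bilin unitInterval B ((ContinuousMap.mk g hg.continuous).comp γ)
          (ContinuousMap.constCLM unitInterval E₁ h) + ContinuousMap.bilin unitInterval B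
          (ContinuousMap.applyL unitInterval E G
            ((ContinuousMap.mk (fderiv ℝ g) (hg.continuous_fderiv one_ne_zero)).comp γ) ζ)
          (ContinuousMap.constCLM unitInterval E₁ u)) s) s := by
    intro s hs
    rw [Set.uIcc_of_le t.2.1] at hs
    have hs' : s ∈ Set.Icc (0 : ℝ) 1 := ⟨hs.1, hs.2.trans t.2.2⟩
    have h1 : HasDerivAt (fun s => g (c s)) (fderiv ℝ g (c s) (Set.IccExtend zero_le_one a s)) s :=
      ((hg.differentiable one_ne_zero) (c s)).hasFDerivAt.comp_hasDerivAt s (hcd s)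
    have h2 : HasDerivAt (fun s => B (g (c s)) h)
        (B (fderiv ℝ g (c s) (Set.IccExtend zero_le_one a s)) h) s :=
      ((B.flip h).hasFDerivAt.comp_hasDerivAt s h1)
    have h3 : HasDerivAt (fun s : ℝ => s • B (g (c s)) h) _ s := (hasDerivAt_id s).smul h2
    convert h3 using 1
    -- The product rule produces `s • B (Dg (B (g γ) u)) h`; the integrability condition exchanges
    -- `u` and `h`, which gives the missing term of the linearized equation.
    rw [Set.IccExtend_of_mem _ _ hs', Set.IccExtend_of_mem _ _ hs', hcγ ⟨s, hs'⟩]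
    simp only [ContinuousMap.add_apply, ContinuousMap.bilin_apply, ContinuousMap.comp_apply,
      ContinuousMap.coe_mk, ContinuousMap.constCLM_apply, ContinuousLinearMap.id_apply, hζ, ha,
      map_smul, smul_apply, id, one_smul, hsym ⟨s, hs'⟩ h u]
    exact add_comm _ _
  have hint := intervalIntegral.integral_eq_sub_of_hasDerivAt hz
    ((ContinuousMap.continuous _).Icc_extend'.intervalIntegrable _ _)
  simp only at hint ⊢
  rw [hint, hcγ t, hζ]
  simp

/-- **Frobenius theorem**, in the form of total differential equations. -/
theorem exists_hasFDerivAt_of_integrable [CompleteSpace E] [CompleteSpace E₁]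
    (B : G →L[ℝ] E₁ →L[ℝ] E) {g : E → G} (hg : ContDiff ℝ 1 g) (x₀ : E)
    (hsym : ∀ᶠ x in 𝓝 x₀, ∀ v w, B (fderiv ℝ g x (B (g x) v)) w =
      B (fderiv ℝ g x (B (g x) w)) v) :
    ∃ F : E₁ → E, F 0 = x₀ ∧ ∀ᶠ u in 𝓝 0, HasFDerivAt F (B (g (F u))) u := by
  -- The solution at `u` is the endpoint of the path `γ` with `γ' = B (g γ) u` starting at `x₀`;
  -- this path is found as an implicit function of `u` near the constant path.
  set R := rayMap B ⟨g, hg.continuous⟩ x₀ with hR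
  have hRc : ContDiff ℝ 1 R := contDiff_rayMap B hg x₀
  set γ₀ := ContinuousMap.constCLM unitInterval E x₀ with hγ₀
  have hR0 : R (0, γ₀) = 0 := by simp [hR, rayMap, hγ₀]
  -- At `u = 0` the integral term vanishes for every path, so the derivative in the path variable is
  -- the identity.
  have hinr : fderiv ℝ R (0, γ₀) ∘L .inr ℝ E₁ C(unitInterval, E) =
      ContinuousLinearMap.id ℝ C(unitInterval, E) := by
    ext1 η
    rw [ContinuousLinearMap.comp_apply, hR, fderiv_rayMap_apply B hg]
    simp
  have hinv : (fderiv ℝ R (0, γ₀) ∘L .inr ℝ E₁ C(unitInterval, E)).IsInvertible := by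
    rw [hinr]
    exact ⟨ContinuousLinearEquiv.refl ℝ _, rfl⟩
  have hcd : ContDiffAt ℝ 1 R (0, γ₀) := hRc.contDiffAt
  set ψ := hcd.implicitFunction one_ne_zero hinv with hψ
  have hψ0 : ψ 0 = γ₀ := hcd.implicitFunction_apply_self one_ne_zero hinv
  have hψc : ContDiffAt ℝ 1 ψ 0 := hcd.contDiffAt_implicitFunction one_ne_zero hinv
  have hψR : ∀ᶠ u in 𝓝 (0 : E₁), R (u, ψ u) = 0 := by
    have := hcd.eventually_apply_implicitFunction one_ne_zero hinv
    rwa [hR0] at this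
  have hψd : ∀ᶠ u in 𝓝 (0 : E₁), DifferentiableAt ℝ ψ u := by
    filter_upwards [hψc.eventually (by simp)] with u hu using hu.differentiableAt one_ne_zero
  -- Invertible operators form a neighborhood of the identity, so the path derivative stays
  -- injective; this is the uniqueness statement for the linearized ray equation.
  have hinj : ∀ᶠ u in 𝓝 (0 : E₁),
      Function.Injective (fderiv ℝ R (u, ψ u) ∘L .inr ℝ E₁ C(unitInterval, E)) := by
    have hc : ContinuousAt (fun u => fderiv ℝ R (u, ψ u) ∘L .inr ℝ E₁ C(unitInterval, E)) 0 := by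
      have h1 : ContinuousAt (fun u => (u, ψ u)) 0 := continuousAt_id.prodMk hψc.continuousAt
      have h2 : ContinuousAt (fderiv ℝ R) (0, ψ 0) :=
        (hRc.continuous_fderiv one_ne_zero).continuousAt
      exact (h2.comp (f := fun u => (u, ψ u)) h1).clm_comp continuousAt_const
    have hn := ContinuousLinearEquiv.nhds (ContinuousLinearEquiv.refl ℝ C(unitInterval, E))
    rw [ContinuousAt, hψ0, hinr] at hc
    filter_upwards [hc hn] with u hu
    obtain ⟨e, he⟩ := hu
    exact (congrArg DFunLike.coe he : _) ▸ e.injective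
  have hsymu : ∀ᶠ u in 𝓝 (0 : E₁), ∀ t, ∀ v w, B (fderiv ℝ g (ψ u t) (B (g (ψ u t)) v)) w =
      B (fderiv ℝ g (ψ u t) (B (g (ψ u t)) w)) v := by
    obtain ⟨δ, hδ, hball⟩ := Metric.eventually_nhds_iff.1 hsym
    filter_upwards [Metric.continuousAt_iff'.1 hψc.continuousAt δ hδ] with u hu t
    rw [hψ0] at hu
    exact hball ((ContinuousMap.dist_apply_le_dist (f := ψ u) (g := γ₀) t).trans_lt hu)
  refine ⟨fun u => ψ u 1, by simp [hψ0, hγ₀], ?_⟩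
  filter_upwards [hψR.eventually_nhds, hψd, hinj, hsymu] with u h1 h2 h3 h4
  have hev : HasFDerivAt (fun u => ψ u 1)
      (ContinuousMap.evalCLM ℝ (1 : unitInterval) ∘L fderiv ℝ ψ u) u :=
    (ContinuousMap.evalCLM ℝ (M := E) (1 : unitInterval)).hasFDerivAt.comp u h2.hasFDerivAt
  convert hev using 1
  ext h
  have hlin : fderiv ℝ R (u, ψ u) (h, fderiv ℝ ψ u h) = 0 := by
    have h5 : HasFDerivAt (fun u => R (u, ψ u)) _ u :=
      ((hRc.differentiable one_ne_zero) (u, ψ u)).hasFDerivAt.comp (f := fun u => (u, ψ u)) u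
        ((hasFDerivAt_id u).prodMk h2.hasFDerivAt)
    have h6 : HasFDerivAt (fun u => R (u, ψ u)) (0 : E₁ →L[ℝ] C(unitInterval, E)) u :=
      (hasFDerivAt_const (0 : C(unitInterval, E)) u).congr_of_eventuallyEq h1
    simpa using congrArg (fun A => A h) (h5.unique h6)
  let ζ : C(unitInterval, E) := ⟨fun t => (t : ℝ) • B (g (ψ u t)) h, by
    have := hg.continuous
    fun_prop⟩
  have hζ := fderiv_rayMap_eq_zero B hg x₀ h1.self_of_nhds h4 h ζ fun _ => rfl
  -- Both paths solve the linearized ray equation in the direction `h`, hence coincide. At time `1`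
  -- the explicit path `ζ` has the value `B (g (ψ u 1)) h`, the required derivative.
  have heq : fderiv ℝ ψ u h = ζ := by
    apply h3
    have : (h, fderiv ℝ ψ u h) - (0, fderiv ℝ ψ u h) = (h, ζ) - (0, ζ) := by simp
    have h7 := congrArg (fderiv ℝ R (u, ψ u)) this
    rw [map_sub, map_sub, hlin, hR, hζ, zero_sub, zero_sub, neg_inj] at h7
    simpa using h7
  rw [ContinuousLinearMap.comp_apply, heq]
  simp [ζ]

/-- Solutions of a smooth total differential equation are smooth. -/
theorem contDiffOn_of_hasFDerivAt {B : G →L[ℝ] E₁ →L[ℝ] E} {g : E → G} (hg : ContDiff ℝ ∞ g)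
    {F : E₁ → E} {U : Set E₁} (hU : IsOpen U) (hF : ∀ u ∈ U, HasFDerivAt F (B (g (F u))) u) :
    ContDiffOn ℝ ∞ F U := by
  rw [contDiffOn_infty]
  intro n
  induction n with
  | zero =>
    exact contDiffOn_zero.2 fun u hu => (hF u hu).continuousAt.continuousWithinAt
  | succ n ih =>
    rw [Nat.cast_add, Nat.cast_one, contDiffOn_succ_iff_fderiv_of_isOpen hU]
    refine ⟨fun u hu => (hF u hu).differentiableAt.differentiableWithinAt, by simp, ?_⟩
    -- Bootstrapping: by the equation, the derivative is as regular as `F` itself, so each order of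
    -- differentiability yields the next.
    refine ContDiffOn.congr (f := fun u => B (g (F u))) ?_ fun u hu => (hF u hu).fderiv
    exact B.contDiff.comp_contDiffOn ((hg.of_le (by exact_mod_cast le_top)).comp_contDiffOn ih)

end TotalDifferential

/-! ### The Frobenius theorem in a vector space. -/

section FrobeniusVectorSpace

variable {E : Type*} [NormedAddCommGroup E] [NormedSpace ℝ E]
  {E₁ : Type*} [NormedAddCommGroup E₁] [NormedSpace ℝ E₁]
  {G : Type*} [NormedAddCommGroup G] [NormedSpace ℝ G]

/-- A smooth map on an open set of a finite-dimensional space agrees near any given point of it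
with a globally smooth map. -/
theorem ContDiffOn.exists_contDiff_eventuallyEq [FiniteDimensional ℝ E] {g : E → G} {O : Set E}
    (hg : ContDiffOn ℝ ∞ g O) (hO : IsOpen O) {x₀ : E} (hx₀ : x₀ ∈ O) :
    ∃ h : E → G, ContDiff ℝ ∞ h ∧ h =ᶠ[𝓝 x₀] g := by
  obtain ⟨ε, hε, hball⟩ := Metric.isOpen_iff.1 hO x₀ hx₀
  -- Support in the closed ball of radius `ε / 2` keeps the cut-off strictly inside the ball of
  -- radius `ε` contained in `O`.
  let χ : ContDiffBump x₀ := ⟨ε / 4, ε / 2, by positivity, by linarith⟩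
  refine ⟨fun x => χ x • g x, ?_, ?_⟩
  · rw [contDiff_iff_contDiffAt]
    intro x
    by_cases hx : x ∈ O
    · exact χ.contDiff.contDiffAt.smul (hg.contDiffAt (hO.mem_nhds hx))
    · have hx' : x ∉ tsupport χ := by
        rw [χ.tsupport_eq]
        refine fun h => hx (hball ?_)
        exact Metric.closedBall_subset_ball (by change ε / 2 < ε; linarith) h
      have : (fun x => χ x • g x) =ᶠ[𝓝 x] fun _ => 0 := by
        filter_upwards [notMem_tsupport_iff_eventuallyEq.1 hx'] with y hy
        simp [hy]
      exact contDiffAt_const.congr_of_eventuallyEq this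
  · filter_upwards [χ.eventuallyEq_one] with x hx
    simp [hx]

/-- A smooth family of injective operators, normalized by a left inverse of one of them: near `x₀`
the family `A x` can be replaced by a smooth family `g x` with the same ranges and with a common
left inverse `q`. -/
theorem exists_normalized_family [FiniteDimensional ℝ E] [FiniteDimensional ℝ E₁]
    [FiniteDimensional ℝ G]
    {A : E → E₁ →L[ℝ] G} {O : Set E} (hO : IsOpen O) (hA : ContDiffOn ℝ ∞ A O) {x₀ : E}
    (hx₀ : x₀ ∈ O) (hinj : Function.Injective (A x₀)) :
    ∃ (q : G →L[ℝ] E₁) (g : E → E₁ →L[ℝ] G) (O' : Set E), IsOpen O' ∧ x₀ ∈ O' ∧ O' ⊆ O ∧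
      ContDiffOn ℝ ∞ g O' ∧ ∀ x ∈ O', (∀ v, q (g x v) = v) ∧
        (g x).toLinearMap.range = (A x).toLinearMap.range := by
  obtain ⟨q', hq'⟩ := (A x₀).toLinearMap.exists_leftInverse_of_injective
    (LinearMap.ker_eq_bot.2 hinj)
  set q : G →L[ℝ] E₁ := q'.toContinuousLinearMap with hq
  have hM : ContDiffOn ℝ ∞ (fun x => q ∘L A x) O := contDiffOn_const.clm_comp hA
  have hM0 : q ∘L A x₀ = ContinuousLinearEquiv.refl ℝ E₁ := by
    ext v
    exact congrArg (fun f => f v) hq'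
  obtain ⟨O', hO', hO'o, hx'⟩ : ∃ O' ⊆ O, IsOpen O' ∧ x₀ ∈ O' ∧
      ∀ x ∈ O', q ∘L A x ∈ Set.range ((↑) : (E₁ ≃L[ℝ] E₁) → E₁ →L[ℝ] E₁) := by
    have hopen := hM.continuousOn.isOpen_inter_preimage hO
      (ContinuousLinearEquiv.isOpen (𝕜 := ℝ) (E := E₁) (F := E₁))
    exact ⟨_, Set.inter_subset_left, hopen, ⟨hx₀, _, hM0.symm⟩, fun x hx => hx.2⟩
  -- Precomposition with the inverse of `q ∘L A x` does not change the range and makes `q` a left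
  -- inverse at every point of `O'`.
  refine ⟨q, fun x => A x ∘L (q ∘L A x).inverse, O', hO'o, hx'.1, hO', ?_, ?_⟩
  · refine (hA.mono hO').clm_comp fun x hx => ?_
    obtain ⟨e, he⟩ := hx'.2 x hx
    have h1 : ContDiffAt ℝ ∞ ContinuousLinearMap.inverse (q ∘L A x) := by
      rw [← he]
      exact contDiffAt_map_inverse e
    exact h1.comp_contDiffWithinAt x ((hM.mono hO') x hx)
  · intro x hx
    obtain ⟨e, he⟩ := hx'.2 x hx
    have he' : ∀ v, q (A x v) = e v := fun v => (congrArg (fun f => f v) he).symm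
    beta_reduce
    rw [← he, ContinuousLinearMap.inverse_equiv]
    refine ⟨fun v => by simp [he'], ?_⟩
    ext y
    simp only [LinearMap.mem_range]
    constructor
    · rintro ⟨v, rfl⟩
      exact ⟨e.symm v, rfl⟩
    · rintro ⟨v, rfl⟩
      exact ⟨e v, by simp⟩

/-- **Frobenius theorem** in a vector space: a smooth family `A x` of injective operators whose
ranges are closed under the Lie bracket is integrated near `x₀` by a map `f` whose
composition with some linear map is a translation. -/
theorem exists_integral_map [FiniteDimensional ℝ E] [FiniteDimensional ℝ E₁]
    {A : E → E₁ →L[ℝ] E} {O : Set E} (hO : IsOpen O) (hA : ContDiffOn ℝ ∞ A O) {x₀ : E}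
    (hx₀ : x₀ ∈ O) (hinj : Function.Injective (A x₀))
    (hinv : ∀ O' ⊆ O, IsOpen O' → ∀ X Y : E → E, ContDiffOn ℝ ∞ X O' → ContDiffOn ℝ ∞ Y O' →
      (∀ x ∈ O', X x ∈ (A x).toLinearMap.range) → (∀ x ∈ O', Y x ∈ (A x).toLinearMap.range) →
      ∀ x ∈ O', lieBracket ℝ X Y x ∈ (A x).toLinearMap.range) :
    ∃ (U : Set E₁) (f : E₁ → E) (f' : E₁ → E₁ →L[ℝ] E) (q : E →L[ℝ] E₁) (c : E₁), IsOpen U ∧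
      0 ∈ U ∧ f 0 = x₀ ∧ ContDiffOn ℝ ∞ f U ∧ ∀ u ∈ U, f u ∈ O ∧ HasFDerivAt f (f' u) u ∧
        (f' u).toLinearMap.range = (A (f u)).toLinearMap.range ∧ q (f u) = c + u ∧
        ∀ v, q (f' u v) = v := by
  obtain ⟨q, g, O', hO', hx₀', hO'O, hg, hgA⟩ := exists_normalized_family hO hA hx₀ hinj
  have hgd : ∀ x ∈ O', DifferentiableAt ℝ g x := fun x hx =>
    ((hg x hx).contDiffAt (hO'.mem_nhds hx)).differentiableAt (by simp)
  have hqg : ∀ x ∈ O', ∀ w v, q (fderiv ℝ g x w v) = 0 := by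
    intro x hx w v
    have h1 : HasFDerivAt (fun y => q (g y v)) (q ∘L (fderiv ℝ g x).flip v) x :=
      q.hasFDerivAt.comp x ((ContinuousLinearMap.apply ℝ E v).hasFDerivAt.comp x
        (hgd x hx).hasFDerivAt)
    have h2 : HasFDerivAt (fun y => q (g y v)) (0 : E →L[ℝ] E₁) x :=
      (hasFDerivAt_const v x).congr_of_eventuallyEq (by
        filter_upwards [hO'.mem_nhds hx] with y hy using (hgA y hy).1 v)
    exact congrArg (fun f => f w) (h1.unique h2)
  -- The normalized fields `g · v` with constant `v` commute: their bracket is some `g x z`, and `z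
  -- = q (g x z) = 0` because `q` kills all derivatives of `g`. Vanishing of these brackets is the
  -- integrability condition of the equation `Df = g (f)`.
  have hsym : ∀ x ∈ O', ∀ v w, fderiv ℝ g x (g x v) w = fderiv ℝ g x (g x w) v := by
    intro x hx v w
    have hv : ∀ v, ContDiffOn ℝ ∞ (fun y => g y v) O' := fun v => hg.clm_apply contDiffOn_const
    have hr : ∀ v, ∀ y ∈ O', g y v ∈ (A y).toLinearMap.range := fun v y hy => by
      rw [← (hgA y hy).2]; exact ⟨v, rfl⟩
    have hb := hinv O' hO'O hO' _ _ (hv v) (hv w) (hr v) (hr w) x hx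
    have hfd : ∀ v, fderiv ℝ (fun y => g y v) x = (fderiv ℝ g x).flip v := fun v =>
      ((ContinuousLinearMap.apply ℝ E v).hasFDerivAt.comp x (hgd x hx).hasFDerivAt).fderiv
    rw [lieBracket, hfd, hfd, ← (hgA x hx).2] at hb
    obtain ⟨z, hz⟩ := hb
    have hz0 : z = 0 := by
      rw [← (hgA x hx).1 z]
      change q ((g x).toLinearMap z) = 0
      rw [hz, map_sub]
      simp [hqg x hx]
    rw [hz0, map_zero] at hz
    exact sub_eq_zero.1 hz.symm
  -- The existence result wants a globally smooth coefficient; only its germ at `x₀` matters.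
  obtain ⟨k, hk, hkg⟩ := hg.exists_contDiff_eventuallyEq hO' hx₀'
  have hgood : ∀ᶠ x in 𝓝 x₀, k x = g x ∧ fderiv ℝ k x = fderiv ℝ g x ∧ x ∈ O' := by
    filter_upwards [hkg, hkg.fderiv (𝕜 := ℝ), hO'.mem_nhds hx₀'] with x h1 h2 h3 using ⟨h1, h2, h3⟩
  obtain ⟨f, hf0, hf⟩ := exists_hasFDerivAt_of_integrable
    (ContinuousLinearMap.id ℝ (E₁ →L[ℝ] E)) (hk.of_le (by simp)) x₀ (by
      filter_upwards [hgood] with x hx v w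
      simpa [hx.1, hx.2.1] using hsym x hx.2.2 v w)
  have hfc : ContinuousAt f 0 := hf.self_of_nhds.continuousAt
  rw [ContinuousAt, hf0] at hfc
  obtain ⟨ε, hε, hball⟩ := Metric.eventually_nhds_iff_ball.1 (hf.and (hfc.eventually hgood))
  have hfd : ∀ u ∈ Metric.ball (0 : E₁) ε, HasFDerivAt f (g (f u)) u := fun u hu => by
    have := (hball u hu).1
    rwa [(hball u hu).2.1] at this
  refine ⟨Metric.ball 0 ε, f, fun u => g (f u), q, q x₀, Metric.isOpen_ball,
    Metric.mem_ball_self hε, hf0, contDiffOn_of_hasFDerivAt hk Metric.isOpen_ball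
      (fun u hu => (hball u hu).1), fun u hu => ?_⟩
  obtain ⟨h1, -, h2⟩ := (hball u hu).2
  refine ⟨hO'O h2, hfd u hu, (hgA _ h2).2, ?_, (hgA _ h2).1⟩
  -- As `q` is a left inverse of `Df = g (f)`, the map `q ∘ f - id` is constant on the ball. This
  -- identity will make `f` an embedding.
  have hconst : ∀ u ∈ Metric.ball (0 : E₁) ε,
      HasFDerivAt (fun u => q (f u) - u) (0 : E₁ →L[ℝ] E₁) u := fun u hu => by
    have h3 : HasFDerivAt (fun u => q (f u) - u) _ u :=
      (q.hasFDerivAt.comp u (hfd u hu)).sub (hasFDerivAt_id u)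
    convert h3 using 1
    ext v
    simp [(hgA _ (hball u hu).2.2.2).1]
  have h4 := Metric.isOpen_ball.is_const_of_fderiv_eq_zero
    (convex_ball (0 : E₁) ε).isPreconnected
    (fun u hu => (hconst u hu).differentiableAt.differentiableWithinAt)
    (fun u hu => (hconst u hu).fderiv) hu (Metric.mem_ball_self hε)
  simp only [hf0, sub_zero] at h4
  rw [← h4]
  abel

end FrobeniusVectorSpace

/-! ### Vector fields and brackets read in a chart. -/

section Coordinates

variable {EP : Type*} [NormedAddCommGroup EP] [NormedSpace ℝ EP]
  {P : Type*} [TopologicalSpace P] [ChartedSpace EP P] [IsManifold 𝓘(ℝ, EP) ∞ P]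

/-- The derivative at `p` of the chart around `p₀`. -/
def chartDeriv (p₀ p : P) : TangentSpace 𝓘(ℝ, EP) p →L[ℝ] EP :=
  mfderiv 𝓘(ℝ, EP) 𝓘(ℝ, EP) (extChartAt 𝓘(ℝ, EP) p₀) p

theorem chartDeriv_isInvertible {p₀ p : P} (hp : p ∈ (extChartAt 𝓘(ℝ, EP) p₀).source) :
    (chartDeriv (EP := EP) p₀ p).IsInvertible :=
  isInvertible_mfderiv_extChartAt hp

theorem chartDeriv_injective {p₀ p : P} (hp : p ∈ (extChartAt 𝓘(ℝ, EP) p₀).source) :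
    Function.Injective (chartDeriv (EP := EP) p₀ p) :=
  (chartDeriv_isInvertible hp).injective

/-- The expression of a vector field in the chart around `p₀`. -/
def coordField (p₀ : P) (X : ∀ p : P, TangentSpace 𝓘(ℝ, EP) p) (x : EP) : EP :=
  chartDeriv p₀ ((extChartAt 𝓘(ℝ, EP) p₀).symm x) (X ((extChartAt 𝓘(ℝ, EP) p₀).symm x))

/-- The vector field with a given expression in the chart around `p₀`. -/
def fieldOfCoord (p₀ : P) (Y : EP → EP) : ∀ p : P, TangentSpace 𝓘(ℝ, EP) p :=
  fun p => (chartDeriv p₀ p).inverse (Y (extChartAt 𝓘(ℝ, EP) p₀ p))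

theorem chartDeriv_fieldOfCoord {p₀ p : P} (hp : p ∈ (extChartAt 𝓘(ℝ, EP) p₀).source)
    (Y : EP → EP) : chartDeriv p₀ p (fieldOfCoord p₀ Y p) = Y (extChartAt 𝓘(ℝ, EP) p₀ p) := by
  obtain ⟨e, he⟩ := chartDeriv_isInvertible hp
  rw [fieldOfCoord, ← he, ContinuousLinearMap.inverse_equiv]
  exact e.apply_symm_apply _

/-- The trivialization of the tangent bundle at `p₀` is given by the derivative of the chart around
`p₀`. -/
theorem smoothFieldOn_iff_chartDeriv {p₀ : P} {U : Set P}
    (hU : U ⊆ (extChartAt 𝓘(ℝ, EP) p₀).source) (X : ∀ p : P, TangentSpace 𝓘(ℝ, EP) p) :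
    SmoothFieldOn X U ↔
      ContMDiffOn 𝓘(ℝ, EP) 𝓘(ℝ, EP) ∞ (fun p => chartDeriv p₀ p (X p)) U := by
  have hU' : U ⊆ (trivializationAt EP (TangentSpace 𝓘(ℝ, EP)) p₀).baseSet := by
    intro p hp
    simpa using hU hp
  refine forall₂_congr fun p hp => ?_
  rw [(trivializationAt EP (TangentSpace 𝓘(ℝ, EP)) p₀).contMDiffWithinAt_section U (hU' hp)]
  have : ∀ q ∈ U, (trivializationAt EP (TangentSpace 𝓘(ℝ, EP)) p₀ ⟨q, X q⟩).2 =
      chartDeriv p₀ q (X q) := fun q hq => by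
    have h1 : q ∈ (chartAt EP p₀).source := by simpa using hU hq
    rw [chartDeriv, ← TangentBundle.continuousLinearMapAt_trivializationAt h1,
      Trivialization.continuousLinearMapAt_apply, Trivialization.coe_linearMapAt_of_mem _ (hU' hq)]
  exact contMDiffWithinAt_congr this (this p hp)

/-- The domain, in the chart around `p₀`, of the coordinate expression of fields defined
on `U`. -/
def coordDomain (p₀ : P) (U : Set P) : Set EP :=
  (extChartAt 𝓘(ℝ, EP) p₀).target ∩ (extChartAt 𝓘(ℝ, EP) p₀).symm ⁻¹' U

theorem isOpen_coordDomain (p₀ : P) {U : Set P} (hU : IsOpen U) :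
    IsOpen (coordDomain (EP := EP) p₀ U) :=
  (continuousOn_extChartAt_symm p₀).isOpen_inter_preimage (isOpen_extChartAt_target p₀) hU

theorem mem_coordDomain {p₀ p : P} {U : Set P} (hp : p ∈ (extChartAt 𝓘(ℝ, EP) p₀).source)
    (hpU : p ∈ U) : extChartAt 𝓘(ℝ, EP) p₀ p ∈ coordDomain (EP := EP) p₀ U :=
  ⟨(extChartAt 𝓘(ℝ, EP) p₀).map_source hp, by
    rwa [Set.mem_preimage, (extChartAt 𝓘(ℝ, EP) p₀).left_inv hp]⟩

theorem ContMDiffOn.contDiffOn_coord {G : Type*} [NormedAddCommGroup G] [NormedSpace ℝ G] {p₀ : P}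
    {U : Set P} {f : P → G} (hf : ContMDiffOn 𝓘(ℝ, EP) 𝓘(ℝ, G) ∞ f U) :
    ContDiffOn ℝ ∞ (fun x => f ((extChartAt 𝓘(ℝ, EP) p₀).symm x)) (coordDomain p₀ U) :=
  contMDiffOn_iff_contDiffOn.1 (hf.comp
    ((contMDiffOn_extChartAt_symm p₀).mono Set.inter_subset_left) fun _ hx => hx.2)

theorem SmoothFieldOn.mono {X : ∀ p : P, TangentSpace 𝓘(ℝ, EP) p} {U V : Set P}
    (hX : SmoothFieldOn X U) (h : V ⊆ U) : SmoothFieldOn X V :=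
  ContMDiffOn.mono hX h

theorem SmoothFieldOn.coordField {p₀ : P} {X : ∀ p : P, TangentSpace 𝓘(ℝ, EP) p} {U : Set P}
    (hX : SmoothFieldOn X U) : ContDiffOn ℝ ∞ (coordField p₀ X) (coordDomain p₀ U) := by
  have h := ((smoothFieldOn_iff_chartDeriv Set.inter_subset_left X).1 (hX.mono
    (Set.inter_subset_right (s := (extChartAt 𝓘(ℝ, EP) p₀).source)))).contDiffOn_coord (p₀ := p₀)
  exact h.mono fun x hx => ⟨hx.1, (extChartAt 𝓘(ℝ, EP) p₀).map_target hx.1, hx.2⟩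

theorem ContDiffOn.smoothFieldOn_fieldOfCoord {p₀ : P} {Y : EP → EP} {O : Set EP}
    (hY : ContDiffOn ℝ ∞ Y O) : SmoothFieldOn (fieldOfCoord p₀ Y)
      ((extChartAt 𝓘(ℝ, EP) p₀).source ∩ extChartAt 𝓘(ℝ, EP) p₀ ⁻¹' O) := by
  rw [smoothFieldOn_iff_chartDeriv Set.inter_subset_left]
  refine ContMDiffOn.congr (f := fun p => Y (extChartAt 𝓘(ℝ, EP) p₀ p)) ?_
    fun p hp => chartDeriv_fieldOfCoord hp.1 Y
  refine (contMDiffOn_iff_contDiffOn.2 hY).comp ((contMDiffOn_extChartAt (x := p₀)).mono ?_)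
    fun p hp => hp.2
  rw [extChartAt_source]
  exact Set.inter_subset_left

theorem coordField_fieldOfCoord {p₀ : P} (Y : EP → EP) {x : EP}
    (hx : x ∈ (extChartAt 𝓘(ℝ, EP) p₀).target) : coordField p₀ (fieldOfCoord p₀ Y) x = Y x := by
  rw [coordField, chartDeriv_fieldOfCoord ((extChartAt 𝓘(ℝ, EP) p₀).map_target hx),
    (extChartAt 𝓘(ℝ, EP) p₀).right_inv hx]

theorem fieldOfCoord_coordField {p₀ : P} (X : ∀ p : P, TangentSpace 𝓘(ℝ, EP) p) {p : P}
    (hp : p ∈ (extChartAt 𝓘(ℝ, EP) p₀).source) : fieldOfCoord p₀ (coordField p₀ X) p = X p := by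
  apply chartDeriv_injective hp
  rw [chartDeriv_fieldOfCoord hp, coordField, (extChartAt 𝓘(ℝ, EP) p₀).left_inv hp]

theorem mlieBracket_eq_lieBracket (X Y : ∀ x : EP, TangentSpace 𝓘(ℝ, EP) x) :
    mlieBracket 𝓘(ℝ, EP) X Y = lieBracket ℝ X Y := by
  rw [← mlieBracketWithin_univ, mlieBracketWithin_eq_lieBracketWithin]
  exact lieBracketWithin_univ (V := (X : EP → EP))

/-- Near `p` each field is the pull-back, under the chart, of its coordinate expression, and Lie
brackets are natural under pull-back. -/
theorem chartDeriv_mlieBracket [CompleteSpace EP] {p₀ p : P} {U : Set P} (hU : IsOpen U)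
    (hp : p ∈ (extChartAt 𝓘(ℝ, EP) p₀).source) (hpU : p ∈ U)
    {X Y : ∀ p : P, TangentSpace 𝓘(ℝ, EP) p} (hX : SmoothFieldOn X U) (hY : SmoothFieldOn Y U) :
    chartDeriv p₀ p (mlieBracket 𝓘(ℝ, EP) X Y p) =
      lieBracket ℝ (coordField p₀ X) (coordField p₀ Y) (extChartAt 𝓘(ℝ, EP) p₀ p) := by
  have hd : ∀ {X : ∀ p : P, TangentSpace 𝓘(ℝ, EP) p}, SmoothFieldOn X U →
      MDifferentiableAt 𝓘(ℝ, EP) 𝓘(ℝ, EP).tangent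
        (fun x : EP => (⟨x, (coordField p₀ X : ∀ x : EP, TangentSpace 𝓘(ℝ, EP) x) x⟩ :
          TangentBundle 𝓘(ℝ, EP) EP))
        (extChartAt 𝓘(ℝ, EP) p₀ p) := fun hX => by
    have h1 := hX.coordField.contDiffAt (x := extChartAt 𝓘(ℝ, EP) p₀ p)
      ((isOpen_coordDomain p₀ hU).mem_nhds (mem_coordDomain hp hpU))
    exact (contMDiffAt_vectorSpace_iff_contDiffAt.2 h1).mdifferentiableAt (by simp)
  have he : ∀ X : ∀ p : P, TangentSpace 𝓘(ℝ, EP) p,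
      X =ᶠ[𝓝 p] fieldOfCoord p₀ (coordField p₀ X) := fun X => by
    filter_upwards [(isOpen_extChartAt_source p₀).mem_nhds hp] with q hq
    rw [fieldOfCoord_coordField X hq]
  have hman : IsManifold 𝓘(ℝ, EP) (minSmoothness ℝ 2) P := by
    rw [minSmoothness_of_isRCLikeNormedField]
    infer_instance
  have hmain := mpullback_mlieBracket (I := 𝓘(ℝ, EP)) (I' := 𝓘(ℝ, EP)) (n := ∞)
    (f := extChartAt 𝓘(ℝ, EP) p₀) (x₀ := p) (hd hX) (hd hY)
    (contMDiffAt_extChartAt' (by simpa using hp)) (by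
      rw [minSmoothness_of_isRCLikeNormedField]; exact WithTop.coe_le_coe.2 le_top)
  rw [(he X).mlieBracket_vectorField_eq (he Y)]
  refine (congrArg (chartDeriv p₀ p) hmain.symm).trans ?_
  refine (chartDeriv_fieldOfCoord hp (mlieBracket 𝓘(ℝ, EP)
    (coordField p₀ X : ∀ x : EP, TangentSpace 𝓘(ℝ, EP) x) (coordField p₀ Y))).trans ?_
  exact congrFun (mlieBracket_eq_lieBracket _ _) _

end Coordinates

/-! ### The Frobenius theorem on a manifold. -/

section FrobeniusManifold

variable {EP : Type*} [NormedAddCommGroup EP] [NormedSpace ℝ EP]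
  {P : Type*} [TopologicalSpace P] [ChartedSpace EP P] [IsManifold 𝓘(ℝ, EP) ∞ P]

/-- The operator sending the standard basis to the values of the fields `X i` at `p`, read in the
chart around `p₀`. -/
def coordFrame {d : ℕ} (p₀ : P) (X : Fin d → ∀ p : P, TangentSpace 𝓘(ℝ, EP) p) (x : EP) :
    EuclideanSpace ℝ (Fin d) →L[ℝ] EP :=
  ∑ i, (EuclideanSpace.proj i : EuclideanSpace ℝ (Fin d) →L[ℝ] ℝ).smulRight (coordField p₀ (X i) x)

theorem coordFrame_apply {d : ℕ} (p₀ : P) (X : Fin d → ∀ p : P, TangentSpace 𝓘(ℝ, EP) p) (x : EP)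
    (v : EuclideanSpace ℝ (Fin d)) :
    coordFrame p₀ X x v = chartDeriv p₀ ((extChartAt 𝓘(ℝ, EP) p₀).symm x)
      (∑ i, v i • X i ((extChartAt 𝓘(ℝ, EP) p₀).symm x)) := by
  refine Eq.trans ?_ (map_sum (chartDeriv p₀ ((extChartAt 𝓘(ℝ, EP) p₀).symm x)) _ _).symm
  simp only [coordFrame, coordField, sum_apply, ContinuousLinearMap.smulRight_apply]
  exact Finset.sum_congr rfl fun i _ => ((chartDeriv p₀ _).map_smul _ _).symm

theorem contDiffOn_coordFrame {d : ℕ} (p₀ : P) {X : Fin d → ∀ p : P, TangentSpace 𝓘(ℝ, EP) p}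
    {U : Set P} (hX : ∀ i, SmoothFieldOn (X i) U) :
    ContDiffOn ℝ ∞ (coordFrame p₀ X) (coordDomain p₀ U) := by
  unfold coordFrame
  exact ContDiffOn.sum fun i _ => contDiffOn_const.smulRight (hX i).coordField

theorem range_coordFrame {d : ℕ} (p₀ : P) (X : Fin d → ∀ p : P, TangentSpace 𝓘(ℝ, EP) p) (x : EP) :
    (coordFrame p₀ X x).toLinearMap.range =
      (Submodule.span ℝ (Set.range fun i => X i ((extChartAt 𝓘(ℝ, EP) p₀).symm x))).map
        (chartDeriv p₀ ((extChartAt 𝓘(ℝ, EP) p₀).symm x)).toLinearMap := by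
  ext y
  simp only [LinearMap.mem_range, Submodule.mem_map, Submodule.mem_span_range_iff_exists_fun]
  constructor
  · rintro ⟨v, rfl⟩
    exact ⟨_, ⟨v, rfl⟩, (coordFrame_apply p₀ X x v).symm⟩
  · rintro ⟨_, ⟨c, rfl⟩, rfl⟩
    exact ⟨WithLp.toLp 2 c, coordFrame_apply p₀ X x _⟩

theorem injective_coordFrame {d : ℕ} (p₀ : P) {X : Fin d → ∀ p : P, TangentSpace 𝓘(ℝ, EP) p}
    {x : EP} (hx : x ∈ (extChartAt 𝓘(ℝ, EP) p₀).target)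
    (hli : LinearIndependent ℝ fun i => X i ((extChartAt 𝓘(ℝ, EP) p₀).symm x)) :
    Function.Injective (coordFrame p₀ X x) := by
  rw [injective_iff_map_eq_zero]
  intro v hv
  rw [coordFrame_apply, ← map_zero (chartDeriv p₀ ((extChartAt 𝓘(ℝ, EP) p₀).symm x))] at hv
  have h := chartDeriv_injective ((extChartAt 𝓘(ℝ, EP) p₀).map_target hx) hv
  ext i
  exact Fintype.linearIndependent_iff.1 hli _ h i

/-- **Frobenius theorem**: a smooth involutive distribution is integrable. -/
theorem IsSmoothDistribution.isIntegrable [FiniteDimensional ℝ EP]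
    {L : ∀ p : P, Submodule ℝ (TangentSpace 𝓘(ℝ, EP) p)} (hL : IsSmoothDistribution L)
    (hinv : IsInvolutiveDistribution L) : IsIntegrableDistribution L := by
  intro p₀
  obtain ⟨U, hU, hpU, d, X, hX, hXL⟩ := hL p₀
  have hp₀ := mem_extChartAt_source (I := 𝓘(ℝ, EP)) p₀
  have : CompleteSpace EP := FiniteDimensional.complete ℝ EP
  set φ := extChartAt 𝓘(ℝ, EP) p₀ with hφ
  have hrange : ∀ x ∈ coordDomain p₀ U, (coordFrame p₀ X x).toLinearMap.range =
      (L (φ.symm x)).map (chartDeriv p₀ (φ.symm x)).toLinearMap := fun x hx => by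
    rw [range_coordFrame, (hXL _ hx.2).2]
  obtain ⟨V, f, f', q, c, hV, h0, hf0, hf, hfV⟩ := exists_integral_map
    (isOpen_coordDomain p₀ hU) (contDiffOn_coordFrame p₀ hX) (mem_coordDomain hp₀ hpU)
    (injective_coordFrame p₀ (φ.map_source hp₀) (by
      rw [φ.left_inv hp₀]; exact (hXL p₀ hpU).1)) (by
    -- Involutivity is transported to the chart: the coordinate fields are pulled back to `P`,
    -- bracketed there, and the bracket is pushed forward again.
    intro O' hO' hO'o Y Z hY hZ hYL hZL x hx
    have hmem : ∀ Y : EP → EP, (∀ x ∈ O', Y x ∈ (coordFrame p₀ X x).toLinearMap.range) →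
        ∀ p ∈ φ.source ∩ φ ⁻¹' O', fieldOfCoord p₀ Y p ∈ L p := by
      intro Y hYL p hp
      have h1 := hYL _ hp.2
      rw [hrange _ (hO' hp.2), φ.left_inv hp.1] at h1
      obtain ⟨w, hw, hwY⟩ := h1
      have h2 : w = fieldOfCoord p₀ Y p := by
        apply chartDeriv_injective hp.1
        rw [chartDeriv_fieldOfCoord hp.1]
        exact hwY
      rwa [← h2]
    have hopen : IsOpen (φ.source ∩ φ ⁻¹' O') :=
      (continuousOn_extChartAt p₀).isOpen_inter_preimage (isOpen_extChartAt_source p₀) hO'o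
    have hxt := (hO' hx).1
    have hxs : φ.symm x ∈ φ.source ∩ φ ⁻¹' O' :=
      ⟨φ.map_target hxt, by rwa [Set.mem_preimage, φ.right_inv hxt]⟩
    have hb := hinv _ _ _ hopen hY.smoothFieldOn_fieldOfCoord hZ.smoothFieldOn_fieldOfCoord
      (hmem Y hYL) (hmem Z hZL) _ hxs
    rw [hrange x (hO' hx)]
    refine ⟨_, hb, ?_⟩
    have hcb := chartDeriv_mlieBracket hopen hxs.1 hxs (hY.smoothFieldOn_fieldOfCoord (p₀ := p₀))
      (hZ.smoothFieldOn_fieldOfCoord (p₀ := p₀))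
    refine hcb.trans ?_
    rw [← hφ, φ.right_inv hxt]
    have he : ∀ Y : EP → EP, coordField p₀ (fieldOfCoord p₀ Y) =ᶠ[𝓝 x] Y := fun Y => by
      filter_upwards [(isOpen_extChartAt_target p₀).mem_nhds hxt] with y hy
      exact coordField_fieldOfCoord Y hy
    exact (he Y).lieBracket_vectorField_eq (he Z))
  have hmapsV : ∀ u ∈ V, f u ∈ φ.target := fun u hu => (hfV u hu).1.1
  refine ⟨d, V, φ.symm ∘ f, hV, ⟨0, h0, by rw [Function.comp_apply, hf0, φ.left_inv hp₀]⟩,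
    (contMDiffOn_extChartAt_symm p₀).comp (contMDiffOn_iff_contDiffOn.2 hf) hmapsV, ?_, ?_⟩
  -- The continuous map `q ∘ φ` undoes the parametrization up to translation by `c`, which forces
  -- the parametrization to be an embedding into the chart domain and then into `P`.
  · let F : V → φ.source := fun u => ⟨φ.symm (f u), φ.map_target (hmapsV u u.2)⟩
    have hFc : Continuous F := by
      refine Continuous.subtype_mk ?_ _
      exact ((continuousOn_extChartAt_symm p₀).comp hf.continuousOn hmapsV).domRestrict
    have hgc : Continuous fun p : φ.source => q (φ p) :=
      q.continuous.comp (continuousOn_extChartAt p₀).domRestrict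
    have hgF : IsEmbedding ((fun p : φ.source => q (φ p)) ∘ F) := by
      have : (fun p : φ.source => q (φ p)) ∘ F = (Homeomorph.addLeft c) ∘ Subtype.val := by
        funext u
        simp only [Function.comp_apply, F, φ.right_inv (hmapsV u u.2), (hfV u u.2).2.2.2.1]
        rfl
      rw [this]
      exact (Homeomorph.addLeft c).isEmbedding.comp IsEmbedding.subtypeVal
    exact IsEmbedding.subtypeVal.comp (IsEmbedding.of_comp hFc hgc hgF)
  · intro u hu
    obtain ⟨hu1, hu2, hu3, hu4, hu5⟩ := hfV u hu
    have hs : φ.symm (f u) ∈ φ.source := φ.map_target (hmapsV u hu)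
    have hd : MDifferentiableAt 𝓘(ℝ, EuclideanSpace ℝ (Fin d)) 𝓘(ℝ, EP) (φ.symm ∘ f) u :=
      (((contMDiffOn_extChartAt_symm p₀).comp (contMDiffOn_iff_contDiffOn.2 hf) hmapsV).contMDiffAt
        (hV.mem_nhds hu)).mdifferentiableAt (by simp)
    have hcomp : ∀ v, chartDeriv p₀ (φ.symm (f u))
        (mfderiv 𝓘(ℝ, EuclideanSpace ℝ (Fin d)) 𝓘(ℝ, EP) (φ.symm ∘ f) u v) = f' u v := by
      intro v
      have h1 := mfderiv_comp (I'' := 𝓘(ℝ, EP)) u (g := φ) (mdifferentiableAt_extChartAt (by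
        rw [← extChartAt_source (I := 𝓘(ℝ, EP))]; exact hs)) hd
      have h2 : (φ ∘ (φ.symm ∘ f)) =ᶠ[𝓝 u] f := by
        filter_upwards [hV.mem_nhds hu] with w hw
        exact φ.right_inv (hmapsV w hw)
      rw [h2.mfderiv_eq, mfderiv_eq_fderiv, hu2.fderiv] at h1
      exact (congrArg (fun A => A v) h1).symm
    constructor
    · intro v w hvw
      have := congrArg (fun z => q (chartDeriv p₀ (φ.symm (f u)) z)) hvw
      simp only [hcomp] at this
      exact (hu5 v).symm.trans (this.trans (hu5 w))
    · apply Submodule.map_injective_of_injective (f := (chartDeriv p₀ (φ.symm (f u))).toLinearMap)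
        (chartDeriv_injective hs)
      rw [Function.comp_apply, ← hrange _ hu1, ← hu3]
      ext y
      simp only [Submodule.mem_map, LinearMap.mem_range]
      constructor
      · rintro ⟨_, ⟨v, rfl⟩, rfl⟩
        exact ⟨v, (hcomp v).symm⟩
      · rintro ⟨v, rfl⟩
        exact ⟨_, ⟨v, rfl⟩, hcomp v⟩

end FrobeniusManifold

/-! ### Local sections, smoothness and involutivity. -/

section Distributions

variable {EP : Type*} [NormedAddCommGroup EP] [NormedSpace ℝ EP]
  {P : Type*} [TopologicalSpace P] [ChartedSpace EP P] [IsManifold 𝓘(ℝ, EP) ∞ P]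
  {E : Type*} [NormedAddCommGroup E] [NormedSpace ℝ E]
  {G : Type*} [NormedAddCommGroup G] [NormedSpace ℝ G]

/-- Every vector in the kernel of one member of a smooth family of operators whose kernels have
constant dimension extends to a smooth family of vectors in the kernels. -/
theorem exists_kernel_section [FiniteDimensional ℝ E] [FiniteDimensional ℝ G]
    {A : P → E →L[ℝ] G} {U : Set P} (hU : IsOpen U)
    (hA : ContMDiffOn 𝓘(ℝ, EP) 𝓘(ℝ, E →L[ℝ] G) ∞ A U) {p₀ : P} (hp₀ : p₀ ∈ U)
    (hdim : ∀ p ∈ U, finrank ℝ (A p).toLinearMap.ker = finrank ℝ (A p₀).toLinearMap.ker)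
    {v : E} (hv : A p₀ v = 0) :
    ∃ (U' : Set P) (w : P → E), IsOpen U' ∧ p₀ ∈ U' ∧ U' ⊆ U ∧
      ContMDiffOn 𝓘(ℝ, EP) 𝓘(ℝ, E) ∞ w U' ∧ w p₀ = v ∧ ∀ p ∈ U', A p (w p) = 0 := by
  -- With `r` a left inverse of `A p₀` on a complement `C` of its kernel, `B p = r ∘ A p` is
  -- invertible on `C` for `p` near `p₀`. The section is the projection of `v` to the kernel of `B
  -- p` along `C`.
  obtain ⟨C, hC⟩ := (A p₀).toLinearMap.ker.exists_isCompl
  obtain ⟨r', hr'⟩ := ((A p₀).toLinearMap ∘ₗ C.subtype).exists_leftInverse_of_injective (by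
    rw [LinearMap.ker_comp, ← Submodule.disjoint_iff_comap_eq_bot]
    exact hC.disjoint.symm)
  set r : G →L[ℝ] C := r'.toContinuousLinearMap with hr
  set B : P → E →L[ℝ] C := fun p => r ∘L A p with hB
  have hBs : ContMDiffOn 𝓘(ℝ, EP) 𝓘(ℝ, E →L[ℝ] C) ∞ B U := contMDiffOn_const.clm_comp hA
  set M : P → C →L[ℝ] C := fun p => B p ∘L C.subtypeL with hM
  have hMs : ContMDiffOn 𝓘(ℝ, EP) 𝓘(ℝ, C →L[ℝ] C) ∞ M U := hBs.clm_comp contMDiffOn_const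
  have hM0 : M p₀ = ContinuousLinearEquiv.refl ℝ C := by
    ext1 c
    exact congrArg (fun f => f c) hr'
  set U' := U ∩ M ⁻¹' Set.range ((↑) : (C ≃L[ℝ] C) → C →L[ℝ] C) with hU'
  have hU'o : IsOpen U' := hMs.continuousOn.isOpen_inter_preimage hU
    (ContinuousLinearEquiv.isOpen (𝕜 := ℝ) (E := C) (F := C))
  have hinv : ContMDiffOn 𝓘(ℝ, EP) 𝓘(ℝ, C →L[ℝ] C) ∞ (fun p => (M p).inverse) U' := by
    intro p hp
    obtain ⟨e, he⟩ := hp.2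
    have h1 : ContDiffAt ℝ ∞ ContinuousLinearMap.inverse (M p) := by
      rw [← he]
      exact contDiffAt_map_inverse e
    exact h1.contMDiffAt.comp_contMDiffWithinAt p ((hMs p hp.1).mono Set.inter_subset_left)
  refine ⟨U', fun p => v - C.subtypeL ((M p).inverse (B p v)), hU'o, ⟨hp₀, _, hM0.symm⟩,
    Set.inter_subset_left, ?_, ?_, ?_⟩
  · exact contMDiffOn_const.sub (contMDiffOn_const.clm_apply (hinv.clm_apply
      ((hBs.mono Set.inter_subset_left).clm_apply contMDiffOn_const)))
  · simp [hB, hv]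
  · intro p hp
    obtain ⟨e, he⟩ := hp.2
    have hBC : ∀ c : C, B p (c : E) = e c := fun c => (congrArg (fun f => f c) he).symm
    -- One inclusion is clear. Since `B p` maps onto `C`, its kernel has the dimension of the kernel
    -- of `A p₀`, which by constancy is that of the kernel of `A p`.
    have hker : (A p).toLinearMap.ker = (B p).toLinearMap.ker := by
      apply Submodule.eq_of_le_of_finrank_eq
      · intro x hx
        have hx' : A p x = 0 := hx
        simp [hB, hx']
      · have h1 := (B p).toLinearMap.finrank_range_add_finrank_ker
        have h2 : (B p).toLinearMap.range = ⊤ := LinearMap.range_eq_top.2 fun c =>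
          ⟨(e.symm c : C), by simpa using hBC (e.symm c)⟩
        rw [h2, finrank_top] at h1
        have h3 := Submodule.finrank_add_eq_of_isCompl hC
        rw [hdim p hp.1]
        omega
    have hmem : v - C.subtypeL ((M p).inverse (B p v)) ∈ (B p).toLinearMap.ker := by
      rw [← he, ContinuousLinearMap.inverse_equiv]
      simp [hBC]
    rw [← hker] at hmem
    exact hmem

/-- `u` is the value at `p₀` of a smooth local section of `L`. -/
def HasLocalSection (L : ∀ p : P, Submodule ℝ (TangentSpace 𝓘(ℝ, EP) p)) (p₀ : P)
    (u : TangentSpace 𝓘(ℝ, EP) p₀) : Prop :=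
  ∃ (U : Set P) (X : ∀ p : P, TangentSpace 𝓘(ℝ, EP) p), IsOpen U ∧ p₀ ∈ U ∧ SmoothFieldOn X U ∧
    (∀ p ∈ U, X p ∈ L p) ∧ X p₀ = u

/-- Independent values of smooth fields remain independent nearby. -/
theorem exists_linearIndependent_nhds [FiniteDimensional ℝ EP] {p₀ : P} {ι : Type*} [Finite ι]
    {X : ι → ∀ p : P, TangentSpace 𝓘(ℝ, EP) p} {U : Set P} (hU : IsOpen U) (hp₀ : p₀ ∈ U)
    (hX : ∀ i, SmoothFieldOn (X i) U) (hli : LinearIndependent ℝ fun i => X i p₀) :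
    ∃ U' ⊆ U, IsOpen U' ∧ p₀ ∈ U' ∧ ∀ p ∈ U', LinearIndependent ℝ fun i => X i p := by
  have := Fintype.ofFinite ι
  set W := U ∩ (extChartAt 𝓘(ℝ, EP) p₀).source with hW
  have hWo : IsOpen W := hU.inter (isOpen_extChartAt_source p₀)
  have hc : ContinuousOn (fun p => fun i => chartDeriv p₀ p (X i p)) W :=
    continuousOn_pi.2 fun i => ((smoothFieldOn_iff_chartDeriv Set.inter_subset_right (X i)).1
      ((hX i).mono Set.inter_subset_left)).continuousOn
  refine ⟨_, Set.inter_subset_left.trans Set.inter_subset_left, hc.isOpen_inter_preimage hWo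
    (isOpen_setOfPred_linearIndependent (𝕜 := ℝ) (ι := ι) (E := EP)),
    ⟨⟨hp₀, mem_extChartAt_source p₀⟩, ?_⟩, ?_⟩
  · exact hli.map' (chartDeriv p₀ p₀).toLinearMap
      (LinearMap.ker_eq_bot.2 (chartDeriv_injective (mem_extChartAt_source p₀)))
  · intro p hp
    exact LinearIndependent.of_comp (chartDeriv p₀ p).toLinearMap hp.2

/-- A family of subspaces of constant dimension is a smooth distribution as soon as at each point it
is spanned by the values of smooth local sections. -/
theorem isSmoothDistribution_of_hasLocalSection [FiniteDimensional ℝ EP]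
    {L : ∀ p : P, Submodule ℝ (TangentSpace 𝓘(ℝ, EP) p)} {d : ℕ} (hd : ∀ p, finrank ℝ (L p) = d)
    (S : ∀ p : P, Set (TangentSpace 𝓘(ℝ, EP) p)) (hS : ∀ p, Submodule.span ℝ (S p) = L p)
    (hsec : ∀ p, ∀ u ∈ S p, HasLocalSection L p u) : IsSmoothDistribution L := by
  intro p₀
  have hfin : ∀ p : P, FiniteDimensional ℝ (TangentSpace 𝓘(ℝ, EP) p) := fun p =>
    inferInstanceAs (FiniteDimensional ℝ EP)
  -- A basis is extracted from the spanning set, so each basis vector extends to a section; these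
  -- sections remain independent nearby, and their number equals the rank.
  obtain ⟨b, hbS, hbspan, hbli⟩ := exists_linearIndependent ℝ (S p₀)
  have hbfin : b.Finite := hbli.setFinite
  have : Fintype b := hbfin.fintype
  have hcard : Fintype.card b = d := by
    rw [← hd p₀, ← hS p₀, ← hbspan, finrank_span_set_eq_card hbli, Set.toFinset_card]
  let e : Fin d ≃ b := (Fintype.equivFinOfCardEq hcard).symm
  choose U X hUo hpU hX hXL hXp using fun i : Fin d => hsec p₀ (e i) (hbS (e i).2)
  have hWo : IsOpen (⋂ i, U i) := isOpen_iInter_of_finite hUo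
  obtain ⟨W, hWU, hW, hpW, hWli⟩ := exists_linearIndependent_nhds (X := X) hWo
    (Set.mem_iInter.2 hpU) (fun i => (hX i).mono (Set.iInter_subset U i)) (by
      rw [funext hXp]
      exact hbli.comp _ e.injective)
  refine ⟨W, hW, hpW, d, X, fun i => (hX i).mono (hWU.trans (Set.iInter_subset U i)),
    fun q hq => ⟨hWli q hq, ?_⟩⟩
  apply Submodule.eq_of_le_of_finrank_eq
  · rw [Submodule.span_le]
    rintro _ ⟨i, rfl⟩
    exact hXL i q (Set.mem_iInter.1 (hWU hq) i)
  · rw [finrank_span_eq_card (hWli q hq), hd, Fintype.card_fin]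

/-- If `A X` and `A Y` are locally constant, then `A [X, Y]` depends only on the
values of `X` and `Y` at the point. -/
theorem apply_lieBracket_of_eventually_const {A : EP → EP →L[ℝ] G} {X Y : EP → EP} {x : EP}
    (hA : DifferentiableAt ℝ A x) (hX : DifferentiableAt ℝ X x) (hY : DifferentiableAt ℝ Y x)
    {a b : G} (hAX : ∀ᶠ y in 𝓝 x, A y (X y) = a) (hAY : ∀ᶠ y in 𝓝 x, A y (Y y) = b) :
    A x (lieBracket ℝ X Y x) = fderiv ℝ A x (Y x) (X x) - fderiv ℝ A x (X x) (Y x) := by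
  -- This is the derivative of the constant function `A y (Z y)` in the direction `v`.
  have key : ∀ {Z : EP → EP} {c : G}, DifferentiableAt ℝ Z x → (∀ᶠ y in 𝓝 x, A y (Z y) = c) →
      ∀ v, A x (fderiv ℝ Z x v) = - fderiv ℝ A x v (Z x) := by
    intro Z c hZ hc v
    have h1 := hA.hasFDerivAt.clm_apply hZ.hasFDerivAt
    have h2 : HasFDerivAt (fun y => A y (Z y)) (0 : EP →L[ℝ] G) x :=
      (hasFDerivAt_const c x).congr_of_eventuallyEq hc
    have h3 := congrArg (fun f => f v) (h1.unique h2)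
    simp only [add_apply, ContinuousLinearMap.comp_apply, ContinuousLinearMap.flip_apply,
      zero_apply] at h3
    exact eq_neg_of_add_eq_zero_left h3
  rw [lieBracket, map_sub, key hY hAY, key hX hAX]
  abel

/-- A smooth distribution which at every point is spanned by values of smooth local sections whose
brackets at that point are in the distribution is involutive. -/
theorem IsSmoothDistribution.isInvolutive [FiniteDimensional ℝ EP]
    {L : ∀ p : P, Submodule ℝ (TangentSpace 𝓘(ℝ, EP) p)} (hL : IsSmoothDistribution L)
    (S : ∀ p : P, Set (TangentSpace 𝓘(ℝ, EP) p)) (hS : ∀ p, Submodule.span ℝ (S p) = L p)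
    (hbr : ∀ p, ∀ u ∈ S p, ∀ v ∈ S p, ∃ (U : Set P) (X Y : ∀ p : P, TangentSpace 𝓘(ℝ, EP) p),
      IsOpen U ∧ p ∈ U ∧ SmoothFieldOn X U ∧ SmoothFieldOn Y U ∧ (∀ q ∈ U, X q ∈ L q) ∧
      (∀ q ∈ U, Y q ∈ L q) ∧ X p = u ∧ Y p = v ∧ mlieBracket 𝓘(ℝ, EP) X Y p ∈ L p) :
    IsInvolutiveDistribution L := by
  intro U₁ X₁ Y₁ hU₁ hX₁ hY₁ hX₁L hY₁L p₀ hp₀U₁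
  have : CompleteSpace EP := FiniteDimensional.complete ℝ EP
  obtain ⟨U, hU, hpU, d, Z, hZ, hZL⟩ := hL p₀
  have hp₀ := mem_extChartAt_source (I := 𝓘(ℝ, EP)) p₀
  set φ := extChartAt 𝓘(ℝ, EP) p₀ with hφ
  obtain ⟨q, g, O, hO, hpO, hOU, hg, hgA⟩ := exists_normalized_family
    (isOpen_coordDomain p₀ hU) (contDiffOn_coordFrame p₀ hZ) (mem_coordDomain hp₀ hpU)
    (injective_coordFrame p₀ (φ.map_source hp₀) (by
      rw [φ.left_inv hp₀]; exact (hZL p₀ hpU).1))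
  have hrange : ∀ x ∈ O, (g x).toLinearMap.range =
      (L (φ.symm x)).map (chartDeriv p₀ (φ.symm x)).toLinearMap := fun x hx => by
    rw [(hgA x hx).2, range_coordFrame, (hZL _ (hOU hx).2).2]
  -- `A x` is the projection along the coordinate image of `L`. It kills all sections of `L`, so its
  -- value on a bracket of sections is bilinear in the values of the sections at the point, and it
  -- can be tested on a spanning set.
  let A : EP → EP →L[ℝ] EP := fun x => ContinuousLinearMap.id ℝ EP - g x ∘L q
  have hA : DifferentiableAt ℝ A (φ p₀) := by
    have h1 : DifferentiableAt ℝ g (φ p₀) :=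
      ((hg _ hpO).contDiffAt (hO.mem_nhds hpO)).differentiableAt (by simp)
    exact (differentiableAt_const _).sub (h1.clm_comp (differentiableAt_const _))
  have hAmem : ∀ x ∈ O, ∀ y, A x y = 0 ↔ y ∈ (g x).toLinearMap.range := by
    intro x hx y
    constructor
    · intro h
      exact ⟨q y, (sub_eq_zero.1 h).symm⟩
    · rintro ⟨v, rfl⟩
      simp [A, (hgA x hx).1]
  have hAL : ∀ v, A (φ p₀) (chartDeriv p₀ p₀ v) = 0 ↔ v ∈ L p₀ := by
    intro v
    rw [hAmem _ hpO, hrange _ hpO, φ.left_inv hp₀]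
    constructor
    · rintro ⟨w, hw, hwv⟩
      rwa [← chartDeriv_injective hp₀ hwv]
    · exact fun hv => ⟨v, hv, rfl⟩
  have hmain : ∀ (W : Set P) (X Y : ∀ p : P, TangentSpace 𝓘(ℝ, EP) p), IsOpen W → p₀ ∈ W →
      SmoothFieldOn X W → SmoothFieldOn Y W → (∀ q ∈ W, X q ∈ L q) → (∀ q ∈ W, Y q ∈ L q) →
      A (φ p₀) (chartDeriv p₀ p₀ (mlieBracket 𝓘(ℝ, EP) X Y p₀)) =
        fderiv ℝ A (φ p₀) (chartDeriv p₀ p₀ (Y p₀)) (chartDeriv p₀ p₀ (X p₀)) -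
        fderiv ℝ A (φ p₀) (chartDeriv p₀ p₀ (X p₀)) (chartDeriv p₀ p₀ (Y p₀)) := by
    intro W X Y hW hpW hX hY hXL hYL
    have hWn := (isOpen_coordDomain p₀ hW).mem_nhds (mem_coordDomain hp₀ hpW)
    have hd : ∀ {X : ∀ p : P, TangentSpace 𝓘(ℝ, EP) p}, SmoothFieldOn X W →
        DifferentiableAt ℝ (coordField p₀ X) (φ p₀) := fun hX =>
      (hX.coordField.contDiffAt hWn).differentiableAt (by simp)
    have h0 : ∀ {X : ∀ p : P, TangentSpace 𝓘(ℝ, EP) p}, (∀ q ∈ W, X q ∈ L q) →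
        ∀ᶠ x in 𝓝 (φ p₀), A x (coordField p₀ X x) = 0 := fun hXL => by
      filter_upwards [hWn, hO.mem_nhds hpO] with x hx hxO
      rw [hAmem x hxO, hrange x hxO]
      exact ⟨_, hXL _ hx.2, rfl⟩
    have hval : ∀ X : ∀ p : P, TangentSpace 𝓘(ℝ, EP) p,
        coordField p₀ X (φ p₀) = chartDeriv p₀ p₀ (X p₀) := fun X => by
      rw [coordField, φ.left_inv hp₀]
    rw [chartDeriv_mlieBracket hW hp₀ hpW hX hY, apply_lieBracket_of_eventually_const hA (hd hX)
      (hd hY) (h0 hXL) (h0 hYL), hval, hval]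
  rw [← hAL, hmain U₁ X₁ Y₁ hU₁ hp₀U₁ hX₁ hY₁ hX₁L hY₁L]
  have hbilin : ∀ u ∈ Submodule.span ℝ (S p₀), ∀ v ∈ Submodule.span ℝ (S p₀),
      fderiv ℝ A (φ p₀) (chartDeriv p₀ p₀ v) (chartDeriv p₀ p₀ u) -
        fderiv ℝ A (φ p₀) (chartDeriv p₀ p₀ u) (chartDeriv p₀ p₀ v) = 0 := by
    intro u hu v hv
    induction hu, hv using Submodule.span_induction₂ with
    | mem_mem u v hu hv =>
      obtain ⟨W, X, Y, hW, hpW, hX, hY, hXL, hYL, rfl, rfl, hB⟩ := hbr p₀ u hu v hv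
      rw [← hmain W X Y hW hpW hX hY hXL hYL]
      exact (hAL _).2 hB
    | zero_left v _ => simp
    | zero_right u _ => simp
    | add_left x y z _ _ _ h1 h2 =>
      simp only [map_add, add_apply]
      rw [add_sub_add_comm, h1, h2, add_zero]
    | add_right x y z _ _ _ h1 h2 =>
      simp only [map_add, add_apply]
      rw [add_sub_add_comm, h1, h2, add_zero]
    | smul_left c x y _ _ h =>
      simp only [map_smul, smul_apply]
      rw [← smul_sub, h, smul_zero]
    | smul_right c x y _ _ h =>
      simp only [map_smul, smul_apply]
      rw [← smul_sub, h, smul_zero]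
  exact hbilin _ (by rw [hS]; exact hX₁L p₀ hp₀U₁) _ (by rw [hS]; exact hY₁L p₀ hp₀U₁)

end Distributions

/-! ### Submersions: vertical fields and projectable lifts. -/

section Submersions

variable {EP : Type*} [NormedAddCommGroup EP] [NormedSpace ℝ EP]
  {EM : Type*} [NormedAddCommGroup EM] [NormedSpace ℝ EM]
  {EF : Type*} [NormedAddCommGroup EF] [NormedSpace ℝ EF]
  {P : Type*} [TopologicalSpace P] [ChartedSpace EP P] [IsManifold 𝓘(ℝ, EP) ∞ P]
  {M : Type*} [TopologicalSpace M] [ChartedSpace EM M] [IsManifold 𝓘(ℝ, EM) ∞ M]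
  {F : Type*} [TopologicalSpace F] [ChartedSpace EF F] [IsManifold 𝓘(ℝ, EF) ∞ F]

theorem IsSmoothFiberBundle.contMDiff {pr : P → M} (hpr : IsSmoothFiberBundle EP EM EF F pr) :
    ContMDiff 𝓘(ℝ, EP) 𝓘(ℝ, EM) ∞ pr := by
  intro p
  obtain ⟨e, he, he1, -⟩ := hpr (pr p)
  have hp : p ∈ e.source := e.mem_source.2 he
  have h1 := (he1.contMDiffAt (e.open_source.mem_nhds hp)).fst
  refine h1.congr_of_eventuallyEq ?_
  filter_upwards [e.open_source.mem_nhds hp] with q hq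
  exact (e.coe_fst hq).symm

/-- A local trivialization gives a smooth local section of `pr` through `p`, with constant fiber
component; its derivative is a right inverse. -/
theorem IsSmoothFiberBundle.surjective_mfderiv {pr : P → M}
    (hpr : IsSmoothFiberBundle EP EM EF F pr) (p : P) :
    Function.Surjective (mfderiv 𝓘(ℝ, EP) 𝓘(ℝ, EM) pr p) := by
  obtain ⟨e, he, he1, he2⟩ := hpr (pr p)
  have hp : p ∈ e.source := e.mem_source.2 he
  have hep : e.toOpenPartialHomeomorph.symm (e p) = p := e.toOpenPartialHomeomorph.left_inv hp
  have ht : e p ∈ e.target := e.toOpenPartialHomeomorph.map_source hp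
  let s : M → P := fun m => e.toOpenPartialHomeomorph.symm (m, (e p).2)
  have hsp : s (pr p) = p := by
    have : (pr p, (e p).2) = e p := by rw [← e.coe_fst hp]
    simp only [s, this, hep]
  have hs : MDifferentiableAt 𝓘(ℝ, EM) 𝓘(ℝ, EP) s (pr p) := by
    have h1 : ContMDiffAt (𝓘(ℝ, EM).prod 𝓘(ℝ, EF)) 𝓘(ℝ, EP) ∞ e.toOpenPartialHomeomorph.symm
        (pr p, (e p).2) := by
      have : (pr p, (e p).2) = e p := by rw [← e.coe_fst hp]
      rw [this]
      exact he2.contMDiffAt (e.open_target.mem_nhds ht)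
    have h2 : ContMDiffAt 𝓘(ℝ, EM) (𝓘(ℝ, EM).prod 𝓘(ℝ, EF)) ∞ (fun m : M => (m, (e p).2)) (pr p) :=
      contMDiffAt_id.prodMk contMDiffAt_const
    exact (h1.comp (pr p) h2).mdifferentiableAt (by simp)
  have hprd : MDifferentiableAt 𝓘(ℝ, EP) 𝓘(ℝ, EM) pr (s (pr p)) :=
    (hpr.contMDiff _).mdifferentiableAt (by simp)
  have hcomp := mfderiv_comp (pr p) hprd hs
  have hid : pr ∘ s =ᶠ[𝓝 (pr p)] id := by
    filter_upwards [e.open_baseSet.mem_nhds he] with m hm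
    exact e.proj_symm_apply' hm
  rw [hid.mfderiv_eq, mfderiv_id] at hcomp
  intro w
  have h3 := congrArg (fun A => A w) hcomp
  rw [hsp] at h3
  exact ⟨_, h3.symm⟩

/-- The expression of the map `pr` in the charts around `p₀` and `pr p₀`. -/
def coordProj (EP EM : Type*) [NormedAddCommGroup EP] [NormedSpace ℝ EP] [NormedAddCommGroup EM]
    [NormedSpace ℝ EM] {P : Type*} [TopologicalSpace P] [ChartedSpace EP P] {M : Type*}
    [TopologicalSpace M] [ChartedSpace EM M] (pr : P → M) (p₀ : P) (x : EP) : EM :=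
  extChartAt 𝓘(ℝ, EM) (pr p₀) (pr ((extChartAt 𝓘(ℝ, EP) p₀).symm x))

/-- The points near `p₀` that lie in the chart around `p₀` and are mapped by `pr` to the chart
around `pr p₀`. -/
def chartNhd (EP EM : Type*) [NormedAddCommGroup EP] [NormedSpace ℝ EP] [NormedAddCommGroup EM]
    [NormedSpace ℝ EM] {P : Type*} [TopologicalSpace P] [ChartedSpace EP P] {M : Type*}
    [TopologicalSpace M] [ChartedSpace EM M] (pr : P → M) (p₀ : P) : Set P :=
  (extChartAt 𝓘(ℝ, EP) p₀).source ∩ pr ⁻¹' (extChartAt 𝓘(ℝ, EM) (pr p₀)).source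

/-- The derivative of `pr`, read in the chart around `pr p₀`. -/
def projDeriv (EM : Type*) [NormedAddCommGroup EM] [NormedSpace ℝ EM] [ChartedSpace EM M]
    (pr : P → M) (p₀ p : P) (v : TangentSpace 𝓘(ℝ, EP) p) : EM :=
  chartDeriv (EP := EM) (pr p₀) (pr p) (mfderiv 𝓘(ℝ, EP) 𝓘(ℝ, EM) pr p v)

theorem isOpen_chartNhd {pr : P → M} (hpr : Continuous pr) (p₀ : P) :
    IsOpen (chartNhd EP EM pr p₀) :=
  (isOpen_extChartAt_source p₀).inter ((isOpen_extChartAt_source (pr p₀)).preimage hpr)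

theorem mem_chartNhd (pr : P → M) (p₀ : P) : p₀ ∈ chartNhd EP EM pr p₀ :=
  ⟨mem_extChartAt_source p₀, mem_extChartAt_source (pr p₀)⟩

theorem contDiffOn_coordProj {pr : P → M} (hpr : ContMDiff 𝓘(ℝ, EP) 𝓘(ℝ, EM) ∞ pr) (p₀ : P) :
    ContDiffOn ℝ ∞ (coordProj EP EM pr p₀) (coordDomain p₀ (chartNhd EP EM pr p₀)) := by
  refine ContMDiffOn.contDiffOn_coord (f := fun p => extChartAt 𝓘(ℝ, EM) (pr p₀) (pr p)) ?_
  exact (contMDiffOn_extChartAt (I := 𝓘(ℝ, EM)) (x := pr p₀)).comp hpr.contMDiffOn fun p hp => by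
    have := hp.2
    rwa [Set.mem_preimage, extChartAt_source] at this

theorem fderiv_coordProj {pr : P → M} (hpr : ContMDiff 𝓘(ℝ, EP) 𝓘(ℝ, EM) ∞ pr) {p₀ p : P}
    (hp : p ∈ chartNhd EP EM pr p₀) (v : TangentSpace 𝓘(ℝ, EP) p) :
    fderiv ℝ (coordProj EP EM pr p₀) (extChartAt 𝓘(ℝ, EP) p₀ p) (chartDeriv p₀ p v) =
      projDeriv EM pr p₀ p v := by
  have h1 : MDifferentiableAt 𝓘(ℝ, EP) 𝓘(ℝ, EM) pr p := (hpr p).mdifferentiableAt (by simp)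
  have h2 : MDifferentiableAt 𝓘(ℝ, EM) 𝓘(ℝ, EM) (extChartAt 𝓘(ℝ, EM) (pr p₀)) (pr p) :=
    mdifferentiableAt_extChartAt (by rw [← extChartAt_source (I := 𝓘(ℝ, EM))]; exact hp.2)
  have h3 : MDifferentiableAt 𝓘(ℝ, EP) 𝓘(ℝ, EP) (extChartAt 𝓘(ℝ, EP) p₀) p :=
    mdifferentiableAt_extChartAt (by rw [← extChartAt_source (I := 𝓘(ℝ, EP))]; exact hp.1)
  have h4 : DifferentiableAt ℝ (coordProj EP EM pr p₀) (extChartAt 𝓘(ℝ, EP) p₀ p) :=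
    ((contDiffOn_coordProj hpr p₀).contDiffAt ((isOpen_coordDomain p₀
      (isOpen_chartNhd hpr.continuous p₀)).mem_nhds (mem_coordDomain hp.1 hp))).differentiableAt
      (by simp)
  have h5 := mfderiv_comp p h2 h1
  have h6 := mfderiv_comp p h4.mdifferentiableAt h3
  have h7 : coordProj EP EM pr p₀ ∘ extChartAt 𝓘(ℝ, EP) p₀ =ᶠ[𝓝 p]
      extChartAt 𝓘(ℝ, EM) (pr p₀) ∘ pr := by
    filter_upwards [(isOpen_extChartAt_source p₀).mem_nhds hp.1] with q hq
    simp only [Function.comp_apply, coordProj]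
    rw [(extChartAt 𝓘(ℝ, EP) p₀).left_inv hq]
  rw [h7.mfderiv_eq, h5, mfderiv_eq_fderiv] at h6
  exact (congrArg (fun A => A v) h6).symm

theorem projDeriv_eq_zero_iff {pr : P → M} {p₀ p : P} (hp : p ∈ chartNhd EP EM pr p₀)
    (v : TangentSpace 𝓘(ℝ, EP) p) :
    projDeriv EM pr p₀ p v = 0 ↔ v ∈ verticalSpace EP EM pr p := by
  have h := chartDeriv_injective (EP := EM) hp.2
  unfold projDeriv
  rw [map_eq_zero_iff _ h]
  exact Iff.rfl

theorem finrank_verticalSpace [FiniteDimensional ℝ EP] [FiniteDimensional ℝ EM] {pr : P → M} {p : P}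
    (hsurj : Function.Surjective (mfderiv 𝓘(ℝ, EP) 𝓘(ℝ, EM) pr p)) :
    finrank ℝ EM + finrank ℝ (verticalSpace EP EM pr p) = finrank ℝ EP := by
  have : FiniteDimensional ℝ (TangentSpace 𝓘(ℝ, EP) p) :=
    inferInstanceAs (FiniteDimensional ℝ EP)
  have h := (mfderiv 𝓘(ℝ, EP) 𝓘(ℝ, EM) pr p).toLinearMap.finrank_range_add_finrank_ker
  have h2 : (mfderiv 𝓘(ℝ, EP) 𝓘(ℝ, EM) pr p).toLinearMap.range = ⊤ :=
    LinearMap.range_eq_top.2 hsurj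
  rw [h2, finrank_top] at h
  exact h

/-- Smooth local fields extending vertical vectors, and projectable lifts of the constant fields
of a chart. -/
theorem exists_adapted_fields [FiniteDimensional ℝ EP] [FiniteDimensional ℝ EM] {pr : P → M}
    (hpr : ContMDiff 𝓘(ℝ, EP) 𝓘(ℝ, EM) ∞ pr) {p₀ : P}
    (hsurj : Function.Surjective (mfderiv 𝓘(ℝ, EP) 𝓘(ℝ, EM) pr p₀)) :
    ∃ (U : Set P) (Z : TangentSpace 𝓘(ℝ, EP) p₀ → ∀ p : P, TangentSpace 𝓘(ℝ, EP) p)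
      (H : EM → ∀ p : P, TangentSpace 𝓘(ℝ, EP) p), IsOpen U ∧ p₀ ∈ U ∧ U ⊆ chartNhd EP EM pr p₀ ∧
      (∀ v, SmoothVerticalFieldOn EM pr (Z v) U) ∧
      (∀ v ∈ verticalSpace EP EM pr p₀, Z v p₀ = v) ∧ (∀ w, SmoothFieldOn (H w) U) ∧
      ∀ w, ∀ p ∈ U, projDeriv EM pr p₀ p (H w p) = w := by
  have hp₀ := mem_chartNhd (EP := EP) (EM := EM) pr p₀
  have hNo := isOpen_chartNhd (EP := EP) (EM := EM) hpr.continuous p₀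
  set φ := extChartAt 𝓘(ℝ, EP) p₀ with hφ
  set A := fderiv ℝ (coordProj EP EM pr p₀) with hA
  have hOo := isOpen_coordDomain (EP := EP) p₀ hNo
  have hx₀ : φ p₀ ∈ coordDomain p₀ (chartNhd EP EM pr p₀) := mem_coordDomain hp₀.1 hp₀
  have hAs : ContDiffOn ℝ ∞ A (coordDomain p₀ (chartNhd EP EM pr p₀)) :=
    (contDiffOn_coordProj hpr p₀).fderiv_of_isOpen hOo (by simp)
  have hAsurj : Function.Surjective (A (φ p₀)) := by
    intro w
    obtain ⟨w', hw'⟩ := (chartDeriv_isInvertible (EP := EM) hp₀.2).surjective w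
    obtain ⟨v, hv⟩ := hsurj w'
    exact ⟨chartDeriv p₀ p₀ v, by rw [hA, fderiv_coordProj hpr hp₀, projDeriv, hv, hw']⟩
  obtain ⟨R₀', hR₀'⟩ := (A (φ p₀)).toLinearMap.exists_rightInverse_of_surjective
    (LinearMap.range_eq_top.2 hAsurj)
  set R₀ : EM →L[ℝ] EP := R₀'.toContinuousLinearMap with hR₀
  set N : EP → EM →L[ℝ] EM := fun x => A x ∘L R₀ with hN
  have hNs : ContDiffOn ℝ ∞ N (coordDomain p₀ (chartNhd EP EM pr p₀)) :=
    hAs.clm_comp contDiffOn_const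
  have hN0 : N (φ p₀) = ContinuousLinearEquiv.refl ℝ EM := by
    ext1 w
    exact congrArg (fun f => f w) hR₀'
  set O := coordDomain p₀ (chartNhd EP EM pr p₀) ∩
    N ⁻¹' Set.range ((↑) : (EM ≃L[ℝ] EM) → EM →L[ℝ] EM) with hO
  have hOopen : IsOpen O := hNs.continuousOn.isOpen_inter_preimage hOo
    (ContinuousLinearEquiv.isOpen (𝕜 := ℝ) (E := EM) (F := EM))
  have hinv : ContDiffOn ℝ ∞ (fun x => (N x).inverse) O := by
    intro x hx
    obtain ⟨e, he⟩ := hx.2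
    have h1 : ContDiffAt ℝ ∞ ContinuousLinearMap.inverse (N x) := by
      rw [← he]
      exact contDiffAt_map_inverse e
    exact h1.comp_contDiffWithinAt x ((hNs x hx.1).mono Set.inter_subset_left)
  -- A smooth right inverse of `A x` near the base point. Then `R x w` lifts `w`, and subtracting `R
  -- x (A x v)` from a constant vector `v` makes it vertical.
  set R : EP → EM →L[ℝ] EP := fun x => R₀ ∘L (N x).inverse with hR
  have hRs : ContDiffOn ℝ ∞ R O := contDiffOn_const.clm_comp hinv
  have hAR : ∀ x ∈ O, ∀ w, A x (R x w) = w := by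
    intro x hx w
    obtain ⟨e, he⟩ := hx.2
    have h1 : ∀ w, A x (R₀ w) = e w := fun w => (congrArg (fun f => f w) he).symm
    simp only [hR]
    rw [← he, ContinuousLinearMap.inverse_equiv]
    simp [h1]
  have hmem : ∀ p ∈ φ.source ∩ φ ⁻¹' O, p ∈ chartNhd EP EM pr p₀ := fun p hp => by
    have := hp.2.1.2
    rwa [Set.mem_preimage, ← hφ, φ.left_inv hp.1] at this
  have hproj : ∀ p ∈ φ.source ∩ φ ⁻¹' O, ∀ Y : EP → EP,
      projDeriv EM pr p₀ p (fieldOfCoord p₀ Y p) = A (φ p) (Y (φ p)) := fun p hp Y => by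
    rw [← fderiv_coordProj hpr (hmem p hp), chartDeriv_fieldOfCoord hp.1]
  refine ⟨φ.source ∩ φ ⁻¹' O,
    fun v => fieldOfCoord p₀ fun x => chartDeriv p₀ p₀ v - R x (A x (chartDeriv p₀ p₀ v)),
    fun w => fieldOfCoord p₀ fun x => R x w,
    (continuousOn_extChartAt p₀).isOpen_inter_preimage (isOpen_extChartAt_source p₀) hOopen,
    ⟨hp₀.1, hx₀, _, hN0.symm⟩, hmem, fun v => ⟨?_, ?_⟩, ?_, ?_, ?_⟩
  · exact (contDiffOn_const.sub (hRs.clm_apply ((hAs.mono Set.inter_subset_left).clm_apply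
      contDiffOn_const))).smoothFieldOn_fieldOfCoord
  · intro p hp
    rw [← projDeriv_eq_zero_iff (hmem p hp), hproj p hp, map_sub, hAR _ hp.2, sub_self]
  · intro v hv
    apply chartDeriv_injective hp₀.1
    rw [chartDeriv_fieldOfCoord hp₀.1]
    have : A (φ p₀) (chartDeriv p₀ p₀ v) = 0 := by
      rw [hA, fderiv_coordProj hpr hp₀, projDeriv_eq_zero_iff hp₀]
      exact hv
    rw [← hφ, this, map_zero, sub_zero]
  · exact fun w => (hRs.clm_apply contDiffOn_const).smoothFieldOn_fieldOfCoord
  · exact fun w p hp => by rw [hproj p hp, hAR _ hp.2]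

/-- Brackets of projectable fields with constant projections are vertical. -/
theorem mlieBracket_mem_verticalSpace [CompleteSpace EP] {pr : P → M}
    (hpr : ContMDiff 𝓘(ℝ, EP) 𝓘(ℝ, EM) ∞ pr) {p₀ : P} {U : Set P} (hU : IsOpen U) (hp₀U : p₀ ∈ U)
    {X Y : ∀ p : P, TangentSpace 𝓘(ℝ, EP) p} (hX : SmoothFieldOn X U) (hY : SmoothFieldOn Y U)
    {a b : EM} (hXa : ∀ p ∈ U, p ∈ chartNhd EP EM pr p₀ → projDeriv EM pr p₀ p (X p) = a)
    (hYb : ∀ p ∈ U, p ∈ chartNhd EP EM pr p₀ → projDeriv EM pr p₀ p (Y p) = b) :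
    mlieBracket 𝓘(ℝ, EP) X Y p₀ ∈ verticalSpace EP EM pr p₀ := by
  have hp₀ := mem_chartNhd (EP := EP) (EM := EM) pr p₀
  have hNo := isOpen_chartNhd (EP := EP) (EM := EM) hpr.continuous p₀
  set φ := extChartAt 𝓘(ℝ, EP) p₀ with hφ
  have hn : coordDomain p₀ (U ∩ chartNhd EP EM pr p₀) ∈ 𝓝 (φ p₀) :=
    (isOpen_coordDomain p₀ (hU.inter hNo)).mem_nhds (mem_coordDomain hp₀.1 ⟨hp₀U, hp₀⟩)
  have hcd : ContDiffAt ℝ ∞ (coordProj EP EM pr p₀) (φ p₀) :=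
    (contDiffOn_coordProj hpr p₀).contDiffAt
      ((isOpen_coordDomain p₀ hNo).mem_nhds (mem_coordDomain hp₀.1 hp₀))
  have hd : ∀ {X : ∀ p : P, TangentSpace 𝓘(ℝ, EP) p}, SmoothFieldOn X U →
      DifferentiableAt ℝ (coordField p₀ X) (φ p₀) := fun hX =>
    (hX.coordField.contDiffAt ((isOpen_coordDomain p₀ hU).mem_nhds
      (mem_coordDomain hp₀.1 hp₀U))).differentiableAt (by simp)
  have hc : ∀ {X : ∀ p : P, TangentSpace 𝓘(ℝ, EP) p} {a : EM},
      (∀ p ∈ U, p ∈ chartNhd EP EM pr p₀ → projDeriv EM pr p₀ p (X p) = a) →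
      ∀ᶠ x in 𝓝 (φ p₀), fderiv ℝ (coordProj EP EM pr p₀) x (coordField p₀ X x) = a := by
    intro X a hXa
    filter_upwards [hn] with x hx
    have := fderiv_coordProj hpr hx.2.2 (X (φ.symm x))
    rw [← hφ, φ.right_inv hx.1] at this
    rw [coordField, ← hφ, this]
    exact hXa _ hx.2.1 hx.2.2
  have hA : DifferentiableAt ℝ (fderiv ℝ (coordProj EP EM pr p₀)) (φ p₀) :=
    (hcd.fderiv_right (m := 1) (WithTop.coe_le_coe.2 le_top)).differentiableAt one_ne_zero
  rw [← projDeriv_eq_zero_iff hp₀, ← fderiv_coordProj hpr hp₀,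
    chartDeriv_mlieBracket hU hp₀.1 hp₀U hX hY,
    apply_lieBracket_of_eventually_const hA (hd hX) (hd hY) (hc hXa) (hc hYb), sub_eq_zero]
  -- What is left is the antisymmetrized second derivative of the coordinate projection, which is
  -- zero.
  refine (hcd.isSymmSndFDerivAt ?_) _ _
  rw [minSmoothness_of_isRCLikeNormedField]
  exact WithTop.coe_le_coe.2 le_top

end Submersions

/-! ### Linear algebra of component systems. -/

section Components

variable {V : Type*} [AddCommGroup V] [Module ℝ V] {Z : Type*} [AddCommGroup Z] [Module ℝ Z]
  {Y : Type*} [AddCommGroup Y] [Module ℝ Y] {ι : Type*}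

theorem finrank_map_add_finrank_inf_ker [FiniteDimensional ℝ V] (f : V →ₗ[ℝ] Z)
    (S : Submodule ℝ V) :
    finrank ℝ (S.map f) + finrank ℝ (S ⊓ f.ker : Submodule ℝ V) = finrank ℝ S := by
  rw [← (f.domRestrict S).finrank_range_add_finrank_ker, LinearMap.range_domRestrict,
    LinearMap.ker_domRestrict, ← Submodule.map_comap_subtype,
    (Submodule.equivMapOfInjective S.subtype S.subtype_injective _).finrank_eq]

/-- The vectors in all members of a family of subspaces, except possibly the `a`-th one. -/
def infExcept (K : ι → Submodule ℝ V) (a : ι) : Submodule ℝ V := ⨅ b, ⨅ _ : b ≠ a, K b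

theorem mem_infExcept {K : ι → Submodule ℝ V} {a : ι} {v : V} :
    v ∈ infExcept K a ↔ ∀ b, b ≠ a → v ∈ K b := by
  simp [infExcept, Submodule.mem_iInf]

/-- A linear map `flat` taking the subspace `L` onto a space `A` which splits into components
detected by the maps `ρ c`, such that the kernel of each single component of `flat` is contained
in `L`. -/
structure IsComponentSystem (flat : V →ₗ[ℝ] Z) (L : Submodule ℝ V) (A : Submodule ℝ Z)
    (ρ : ι → Z →ₗ[ℝ] Y) : Prop where
  map_eq : L.map flat = A
  ker_le : ∀ c, (ρ c ∘ₗ flat).ker ≤ L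
  exists_component : ∀ a, ∀ α ∈ A, ∃ α' ∈ A, ρ a α' = ρ a α ∧ ∀ b, b ≠ a → ρ b α' = 0

/-- For `v ∈ L`, each component of `flat v` is realized by a vector `u a` whose image has no other
component. The sum of the `u a` has the same components as `v`, so the difference lies in all
kernels and hence in any one of the summands. -/
theorem IsComponentSystem.le_iSup [Finite ι] [Nonempty ι] {flat : V →ₗ[ℝ] Z} {L : Submodule ℝ V}
    {A : Submodule ℝ Z} {ρ : ι → Z →ₗ[ℝ] Y} (h : IsComponentSystem flat L A ρ) :
    L ≤ ⨆ a, infExcept (fun c => (ρ c ∘ₗ flat).ker) a := by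
  have := Fintype.ofFinite ι
  intro v hv
  have hex : ∀ a, ∃ u : V, ρ a (flat u) = ρ a (flat v) ∧ ∀ b, b ≠ a → ρ b (flat u) = 0 := by
    intro a
    obtain ⟨α', hα', h1, h2⟩ := h.exists_component a (flat v) (h.map_eq ▸ ⟨v, hv, rfl⟩)
    rw [← h.map_eq] at hα'
    obtain ⟨u, -, rfl⟩ := hα'
    exact ⟨u, h1, h2⟩
  choose u hu1 hu2 using hex
  have hmem : ∀ a, u a ∈ ⨆ a, infExcept (fun c => (ρ c ∘ₗ flat).ker) a := fun a =>
    Submodule.mem_iSup_of_mem a (mem_infExcept.2 fun b hb => hu2 a b hb)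
  obtain ⟨a₀⟩ := ‹Nonempty ι›
  have hrest : v - ∑ a, u a ∈ ⨆ a, infExcept (fun c => (ρ c ∘ₗ flat).ker) a := by
    refine Submodule.mem_iSup_of_mem a₀ (mem_infExcept.2 fun b _ => ?_)
    rw [LinearMap.mem_ker, LinearMap.comp_apply, map_sub, map_sub, map_sum, map_sum,
      Finset.sum_eq_single b (fun a _ hab => hu2 a b (Ne.symm hab)) (by simp), hu1, sub_self]
  have := Submodule.add_mem _ hrest (Submodule.sum_mem _ fun a (_ : a ∈ Finset.univ) => hmem a)
  rwa [sub_add_cancel] at this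

theorem IsComponentSystem.infExcept_le [Nontrivial ι] {flat : V →ₗ[ℝ] Z} {L : Submodule ℝ V}
    {A : Submodule ℝ Z} {ρ : ι → Z →ₗ[ℝ] Y} (h : IsComponentSystem flat L A ρ) (a : ι) :
    infExcept (fun c => (ρ c ∘ₗ flat).ker) a ≤ L := by
  obtain ⟨b, hb⟩ := exists_ne a
  exact fun v hv => h.ker_le b (mem_infExcept.1 hv b hb)

/-- The intersection on the left is contained in `L`, contains the kernel of `flat`, and is mapped
onto the space of forms in `A` having only an `a`-th component. Subtracting the rank formulas for it
and for `L` eliminates the kernel of `flat`. Constancy of this dimension thus reduces to that of `L`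
and of spaces of forms. -/
theorem IsComponentSystem.finrank_infExcept [FiniteDimensional ℝ V] [Nontrivial ι]
    {flat : V →ₗ[ℝ] Z} {L : Submodule ℝ V} {A : Submodule ℝ Z} {ρ : ι → Z →ₗ[ℝ] Y}
    (h : IsComponentSystem flat L A ρ) (a : ι) :
    finrank ℝ (infExcept (fun c => (ρ c ∘ₗ flat).ker) a) + finrank ℝ A =
      finrank ℝ L + finrank ℝ (A ⊓ infExcept (fun c => (ρ c).ker) a : Submodule ℝ Z) := by
  have h1 := finrank_map_add_finrank_inf_ker flat L
  have h2 := finrank_map_add_finrank_inf_ker flat (infExcept (fun c => (ρ c ∘ₗ flat).ker) a)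
  have hle := h.infExcept_le a
  have hker : flat.ker ≤ infExcept (fun c => (ρ c ∘ₗ flat).ker) a := fun v hv =>
    mem_infExcept.2 fun b _ => by
      rw [LinearMap.mem_ker, LinearMap.comp_apply, LinearMap.mem_ker.1 hv, map_zero]
  have hmap : (infExcept (fun c => (ρ c ∘ₗ flat).ker) a).map flat =
      A ⊓ infExcept (fun c => (ρ c).ker) a := by
    ext α
    constructor
    · rintro ⟨v, hv, rfl⟩
      exact ⟨h.map_eq ▸ ⟨v, hle hv, rfl⟩, mem_infExcept.2 fun b hb => mem_infExcept.1 hv b hb⟩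
    · rintro ⟨hα, hα'⟩
      rw [SetLike.mem_coe, ← h.map_eq] at hα
      obtain ⟨u, -, rfl⟩ := hα
      exact ⟨u, mem_infExcept.2 fun b hb => mem_infExcept.1 hα' b hb, rfl⟩
  rw [inf_eq_right.2 (hker.trans hle), h.map_eq] at h1
  rw [inf_eq_right.2 hker, hmap] at h2
  omega

end Components

/-! ### Integrability from three involutive kernels. -/

section Integrability

variable {EP : Type*} [NormedAddCommGroup EP] [NormedSpace ℝ EP]
  {P : Type*} [TopologicalSpace P] [ChartedSpace EP P] [IsManifold 𝓘(ℝ, EP) ∞ P]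

/-- A family of subspaces of constant dimension spanned near each point by the partial intersections
of at least three "involutive kernels" is a smooth integrable distribution. -/
theorem integrable_of_kernels [FiniteDimensional ℝ EP] {ι : Type*} [Fintype ι]
    (hι : 3 ≤ Fintype.card ι) {L : ∀ p : P, Submodule ℝ (TangentSpace 𝓘(ℝ, EP) p)} {d : ℕ}
    (hd : ∀ p, finrank ℝ (L p) = d)
    (hK : ∀ p₀ : P, ∃ K : ι → ∀ p : P, Submodule ℝ (TangentSpace 𝓘(ℝ, EP) p),
      (∃ U : Set P, IsOpen U ∧ p₀ ∈ U ∧ ∀ p ∈ U, ∀ c, K c p ≤ L p) ∧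
      L p₀ ≤ ⨆ a, infExcept (fun c => K c p₀) a ∧
      (∀ a, ∀ v ∈ infExcept (fun c => K c p₀) a,
        HasLocalSection (fun p => infExcept (fun c => K c p) a) p₀ v) ∧
      ∀ c (U : Set P) (X Y : ∀ p : P, TangentSpace 𝓘(ℝ, EP) p), IsOpen U → p₀ ∈ U →
        SmoothFieldOn X U → SmoothFieldOn Y U → (∀ p ∈ U, X p ∈ K c p) → (∀ p ∈ U, Y p ∈ K c p) →
        mlieBracket 𝓘(ℝ, EP) X Y p₀ ∈ K c p₀) :
    IsSmoothDistribution L ∧ IsInvolutiveDistribution L ∧ IsIntegrableDistribution L := by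
  classical
  -- Here three components are essential: sections of the summands with indices `a` and `b` have the
  -- kernel with the third index `c` in common.
  have hthree : ∀ a b : ι, ∃ c, c ≠ a ∧ c ≠ b := by
    intro a b
    have h1 : ({a, b} : Finset ι).card < (Finset.univ : Finset ι).card := by
      rw [Finset.card_univ]
      exact (Finset.card_le_two).trans_lt hι
    obtain ⟨c, -, hc⟩ := Finset.exists_mem_notMem_of_card_lt_card h1
    simp only [Finset.mem_insert, Finset.mem_singleton, not_or] at hc
    exact ⟨c, hc⟩
  choose K hKU hKsup hKsec hKbr using hK
  let S : ∀ p : P, Set (TangentSpace 𝓘(ℝ, EP) p) := fun p =>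
    ⋃ a, (infExcept (fun c => K p c p) a : Set (TangentSpace 𝓘(ℝ, EP) p))
  have hS : ∀ p, Submodule.span ℝ (S p) = L p := by
    intro p
    apply le_antisymm
    · rw [Submodule.span_le]
      refine Set.iUnion_subset fun a v hv => ?_
      obtain ⟨U, hU, hpU, hUK⟩ := hKU p
      obtain ⟨c, hc, -⟩ := hthree a a
      exact hUK p hpU c (mem_infExcept.1 hv c hc)
    · refine (hKsup p).trans (iSup_le fun a => ?_)
      exact fun v hv => Submodule.subset_span (Set.mem_iUnion.2 ⟨a, hv⟩)
  have hsmooth : IsSmoothDistribution L := by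
    refine isSmoothDistribution_of_hasLocalSection hd S hS fun p u hu => ?_
    obtain ⟨a, ha⟩ := Set.mem_iUnion.1 hu
    obtain ⟨U, X, hU, hpU, hX, hXK, hXp⟩ := hKsec p a u ha
    obtain ⟨U', hU', hpU', hUK⟩ := hKU p
    obtain ⟨c, hc, -⟩ := hthree a a
    exact ⟨U ∩ U', X, hU.inter hU', ⟨hpU, hpU'⟩, hX.mono Set.inter_subset_left,
      fun q hq => hUK q hq.2 c (mem_infExcept.1 (hXK q hq.1) c hc), hXp⟩
  have hinv : IsInvolutiveDistribution L := by
    refine hsmooth.isInvolutive S hS fun p u hu v hv => ?_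
    obtain ⟨a, ha⟩ := Set.mem_iUnion.1 hu
    obtain ⟨b, hb⟩ := Set.mem_iUnion.1 hv
    obtain ⟨c, hca, hcb⟩ := hthree a b
    obtain ⟨U, X, hU, hpU, hX, hXK, hXp⟩ := hKsec p a u ha
    obtain ⟨V, Y, hV, hpV, hY, hYK, hYp⟩ := hKsec p b v hb
    obtain ⟨U', hU', hpU', hUK⟩ := hKU p
    have hXc : ∀ q ∈ U ∩ V ∩ U', X q ∈ K p c q := fun q hq => mem_infExcept.1 (hXK q hq.1.1) c hca
    have hYc : ∀ q ∈ U ∩ V ∩ U', Y q ∈ K p c q := fun q hq => mem_infExcept.1 (hYK q hq.1.2) c hcb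
    have hX' := hX.mono (Set.inter_subset_left.trans Set.inter_subset_left : U ∩ V ∩ U' ⊆ U)
    have hY' := hY.mono (Set.inter_subset_left.trans Set.inter_subset_right : U ∩ V ∩ U' ⊆ V)
    exact ⟨U ∩ V ∩ U', X, Y, (hU.inter hV).inter hU', ⟨⟨hpU, hpV⟩, hpU'⟩, hX', hY',
      fun q hq => hUK q hq.2 c (hXc q hq), fun q hq => hUK q hq.2 c (hYc q hq), hXp, hYp,
      hUK p hpU' c (hKbr p c _ X Y ((hU.inter hV).inter hU') ⟨⟨hpU, hpV⟩, hpU'⟩ hX' hY' hXc hYc)⟩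
  exact ⟨hsmooth, hinv, hsmooth.isIntegrable hinv⟩

/-- Local sections of a subbundle of constant rank cut out by smooth linear equations in a
framed bundle. -/
theorem hasLocalSection_of_frame {s : ℕ} {J : Type*} [Fintype J] {U : Set P} (hU : IsOpen U)
    {p₀ : P} (hp₀ : p₀ ∈ U) {Z : Fin s → ∀ p : P, TangentSpace 𝓘(ℝ, EP) p}
    (hZ : ∀ i, SmoothFieldOn (Z i) U) (hli : ∀ p ∈ U, LinearIndependent ℝ fun i => Z i p)
    {K : ∀ p : P, Submodule ℝ (TangentSpace 𝓘(ℝ, EP) p)}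
    (hKZ : ∀ p ∈ U, K p ≤ Submodule.span ℝ (Set.range fun i => Z i p))
    {c : J → Fin s → P → ℝ} (hc : ∀ j i, ContMDiffOn 𝓘(ℝ, EP) 𝓘(ℝ, ℝ) ∞ (c j i) U)
    (hKc : ∀ p ∈ U, ∀ x : Fin s → ℝ, ∑ i, x i • Z i p ∈ K p ↔ ∀ j, ∑ i, x i * c j i p = 0)
    (hdim : ∀ p ∈ U, finrank ℝ (K p) = finrank ℝ (K p₀)) {v : TangentSpace 𝓘(ℝ, EP) p₀}
    (hv : v ∈ K p₀) : HasLocalSection K p₀ v := by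
  -- In the frame `Z`, the subspace `K p` becomes the kernel of the matrix `c j i p`, and smooth
  -- coefficient vectors are provided by `exists_kernel_section`.
  let A : P → (Fin s → ℝ) →L[ℝ] (J → ℝ) := fun p =>
    ∑ i, (ContinuousLinearMap.proj i : (Fin s → ℝ) →L[ℝ] ℝ).smulRight fun j => c j i p
  have hAapply : ∀ p x j, A p x j = ∑ i, x i * c j i p := by
    intro p x j
    simp [A, Finset.sum_apply]
  have hA : ContMDiffOn 𝓘(ℝ, EP) 𝓘(ℝ, (Fin s → ℝ) →L[ℝ] (J → ℝ)) ∞ A U := by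
    have hrow : ∀ i, ContMDiffOn 𝓘(ℝ, EP) 𝓘(ℝ, J → ℝ) ∞ (fun p => fun j => c j i p) U :=
      fun i => contMDiffOn_pi_space.2 fun j => hc j i
    refine contMDiffOn_finsetSum fun i _ => ?_
    exact (((ContinuousLinearMap.smulRightL ℝ (Fin s → ℝ) (J → ℝ)
      (ContinuousLinearMap.proj i)).contMDiff).comp_contMDiffOn (hrow i))
  have hAker : ∀ p ∈ U, ∀ x, A p x = 0 ↔ ∑ i, x i • Z i p ∈ K p := by
    intro p hp x
    rw [hKc p hp, funext_iff]
    simp [hAapply]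
  have hker : ∀ p ∈ U, finrank ℝ (A p).toLinearMap.ker = finrank ℝ (K p) := by
    intro p hp
    have hinj : Function.Injective (Fintype.linearCombination ℝ fun i => Z i p) := by
      rw [injective_iff_map_eq_zero]
      exact fun x hx => funext fun i => Fintype.linearIndependent_iff.1 (hli p hp) x hx i
    have hmap : (A p).toLinearMap.ker.map (Fintype.linearCombination ℝ fun i => Z i p) = K p := by
      ext w
      constructor
      · rintro ⟨x, hx, rfl⟩
        exact (hAker p hp x).1 hx
      · intro hw
        obtain ⟨x, rfl⟩ := (Submodule.mem_span_range_iff_exists_fun ℝ).1 (hKZ p hp hw)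
        exact ⟨x, (hAker p hp x).2 hw, rfl⟩
    rw [(Submodule.equivMapOfInjective _ hinj _).finrank_eq, hmap]
  obtain ⟨x₀, rfl⟩ := Submodule.mem_span_range_iff_exists_fun ℝ |>.1 (hKZ p₀ hp₀ hv)
  obtain ⟨U', w, hU', hpU', hU'U, hw, hw0, hwA⟩ := exists_kernel_section hU hA hp₀
    (fun p hp => by rw [hker p hp, hker p₀ hp₀, hdim p hp]) ((hAker p₀ hp₀ x₀).2 hv)
  refine ⟨U', fun p => ∑ i, w p i • Z i p, hU', hpU', ?_,
    fun p hp => (hAker p (hU'U hp) (w p)).1 (hwA p hp), by simp [hw0]⟩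
  exact ContMDiffOn.sum_section fun i _ =>
    (contMDiffOn_pi_space.1 hw i).smul_section ((hZ i).mono hU'U)

end Integrability

/-! ### Integrability of families with component systems. -/

section ComponentSystems

variable {W : Type*} [AddCommGroup W] [Module ℝ W]

/-- The kernel of a linear map on a subspace, as a subspace of the ambient space. -/
def kernelIn {Y : Type*} [AddCommGroup Y] [Module ℝ Y] (V : Submodule ℝ W) (β : V →ₗ[ℝ] Y) :
    Submodule ℝ W := β.ker.map V.subtype

theorem mem_kernelIn {Y : Type*} [AddCommGroup Y] [Module ℝ Y] {V : Submodule ℝ W} {β : V →ₗ[ℝ] Y}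
    {w : W} : w ∈ kernelIn V β ↔ ∃ h : w ∈ V, β ⟨w, h⟩ = 0 := by
  simp [kernelIn]

theorem infExcept_kernelIn {Y ι : Type*} [AddCommGroup Y] [Module ℝ Y] [Nontrivial ι]
    {V : Submodule ℝ W} (β : ι → V →ₗ[ℝ] Y) (a : ι) :
    infExcept (fun c => kernelIn V (β c)) a = (infExcept (fun c => (β c).ker) a).map V.subtype := by
  ext w
  simp only [mem_infExcept, mem_kernelIn, Submodule.mem_map, LinearMap.mem_ker]
  constructor
  · intro h
    obtain ⟨b, hb⟩ := exists_ne a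
    exact ⟨⟨w, (h b hb).1⟩, fun b hb => (h b hb).2, rfl⟩
  · rintro ⟨w, h, rfl⟩ b hb
    exact ⟨w.2, h b hb⟩

variable {EP : Type*} [NormedAddCommGroup EP] [NormedSpace ℝ EP]
  {P : Type*} [TopologicalSpace P] [ChartedSpace EP P] [IsManifold 𝓘(ℝ, EP) ∞ P]

/-- A family of subspaces of constant dimension, taken by linear maps `flat` onto spaces which
split into at least three components, is an integrable smooth distribution, provided that
the kernels of the components of `flat` are closed under brackets. -/
theorem integrable_of_componentSystems [FiniteDimensional ℝ EP] {ι : Type*} [Fintype ι]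
    (hι : 3 ≤ Fintype.card ι) {V L : ∀ p : P, Submodule ℝ (TangentSpace 𝓘(ℝ, EP) p)} {d m : ℕ}
    (hd : ∀ p, finrank ℝ (L p) = d) (hLV : ∀ p, L p ≤ V p)
    (Z : P → Type*) [∀ p, AddCommGroup (Z p)] [∀ p, Module ℝ (Z p)]
    (flat : ∀ p, V p →ₗ[ℝ] Z p) (A : ∀ p, Submodule ℝ (Z p))
    (hloc : ∀ p₀ : P, ∃ (U : Set P)
      (ρ : ι → ∀ p, Z p →ₗ[ℝ] MultilinearMap ℝ (fun _ : Fin m => V p) ℝ)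
      (s : ℕ) (X : Fin s → ∀ p : P, TangentSpace 𝓘(ℝ, EP) p),
      IsOpen U ∧ p₀ ∈ U ∧
      (∀ p ∈ U, IsComponentSystem (flat p) ((L p).submoduleOf (V p)) (A p) fun c => ρ c p) ∧
      (∀ p ∈ U, finrank ℝ (A p) = finrank ℝ (A p₀)) ∧
      (∀ a, ∀ p ∈ U, finrank ℝ (A p ⊓ infExcept (fun c => (ρ c p).ker) a : Submodule ℝ (Z p)) =
        finrank ℝ (A p₀ ⊓ infExcept (fun c => (ρ c p₀).ker) a : Submodule ℝ (Z p₀))) ∧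
      (∀ i, SmoothFieldOn (X i) U) ∧ (∀ p ∈ U, LinearIndependent ℝ fun i => X i p) ∧
      (∀ p ∈ U, Submodule.span ℝ (Set.range fun i => X i p) = V p) ∧
      (∀ c i (I : Fin m → Fin s), ∃ f : P → ℝ, ContMDiffOn 𝓘(ℝ, EP) 𝓘(ℝ, ℝ) ∞ f U ∧ ∀ p ∈ U,
        ∀ (hi : X i p ∈ V p) (hI : ∀ j, X (I j) p ∈ V p),
        f p = ρ c p (flat p ⟨X i p, hi⟩) fun j => ⟨X (I j) p, hI j⟩) ∧
      ∀ c (U' : Set P) (X Y : ∀ p : P, TangentSpace 𝓘(ℝ, EP) p), IsOpen U' → p₀ ∈ U' → U' ⊆ U →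
        SmoothFieldOn X U' → SmoothFieldOn Y U' →
        (∀ p ∈ U', X p ∈ kernelIn (V p) (ρ c p ∘ₗ flat p)) →
        (∀ p ∈ U', Y p ∈ kernelIn (V p) (ρ c p ∘ₗ flat p)) →
        mlieBracket 𝓘(ℝ, EP) X Y p₀ ∈ kernelIn (V p₀) (ρ c p₀ ∘ₗ flat p₀)) :
    IsSmoothDistribution L ∧ IsInvolutiveDistribution L ∧ IsIntegrableDistribution L := by
  have : Nontrivial ι := Fintype.one_lt_card_iff_nontrivial.1 (by omega)
  refine integrable_of_kernels hι hd fun p₀ => ?_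
  obtain ⟨U, ρ, s, X, hU, hpU, hsys, hA, hAa, hX, hli, hspan, hf, hbr⟩ := hloc p₀
  have hfd : ∀ p : P, FiniteDimensional ℝ (TangentSpace 𝓘(ℝ, EP) p) := fun p =>
    inferInstanceAs (FiniteDimensional ℝ EP)
  have hLfin : ∀ p, finrank ℝ ((L p).submoduleOf (V p)) = d := fun p => by
    rw [← hd p, (Submodule.submoduleOfEquivOfLe (hLV p)).finrank_eq]
  refine ⟨fun c p => kernelIn (V p) (ρ c p ∘ₗ flat p), ⟨U, hU, hpU, fun p hp c w hw => ?_⟩, ?_, ?_,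
    ?_⟩
  · obtain ⟨h, hw⟩ := mem_kernelIn.1 hw
    exact (hsys p hp).ker_le c hw
  · intro w hw
    have h1 := (hsys p₀ hpU).le_iSup (show (⟨w, hLV p₀ hw⟩ : V p₀) ∈ (L p₀).submoduleOf (V p₀)
      from hw)
    have h2 := Submodule.mem_map_of_mem (f := (V p₀).subtype) h1
    rw [Submodule.map_iSup] at h2
    simp only [infExcept_kernelIn]
    exact h2
  -- The linear equations for the partial intersection are the components with index `b ≠ a`,
  -- evaluated on all tuples of frame vectors.
  · intro a v hv
    choose f hfs hfe using hf
    have hXV : ∀ p ∈ U, ∀ i, X i p ∈ V p := fun p hp i =>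
      hspan p hp ▸ Submodule.subset_span ⟨i, rfl⟩
    have : Fintype {b // b ≠ a} := Fintype.ofFinite _
    refine hasLocalSection_of_frame (J := {b // b ≠ a} × (Fin m → Fin s)) hU hpU hX hli
      (c := fun j i => f j.1 i j.2) ?_ (fun j i => hfs _ _ _) ?_ ?_ hv
    · intro p hp w hw
      rw [hspan p hp]
      obtain ⟨b, hb⟩ := exists_ne a
      exact (mem_kernelIn.1 (mem_infExcept.1 hw b hb)).1
    · intro p hp x
      have hxV : ∑ i, x i • X i p ∈ V p :=
        Submodule.sum_mem _ fun i _ => Submodule.smul_mem _ _ (hXV p hp i)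
      have hxsum : (⟨∑ i, x i • X i p, hxV⟩ : V p) = ∑ i, x i • ⟨X i p, hXV p hp i⟩ := by
        ext
        simp
      have hspan' : ⊤ ≤ Submodule.span ℝ (Set.range fun i => (⟨X i p, hXV p hp i⟩ : V p)) := by
        intro w _
        obtain ⟨x, hx⟩ := (Submodule.mem_span_range_iff_exists_fun ℝ).1
          (show (w : TangentSpace 𝓘(ℝ, EP) p) ∈ Submodule.span ℝ (Set.range fun i => X i p) by
            rw [hspan p hp]; exact w.2)
        refine (Submodule.mem_span_range_iff_exists_fun ℝ).2 ⟨x, ?_⟩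
        ext
        simpa using hx
      have hli' : LinearIndependent ℝ fun i => (⟨X i p, hXV p hp i⟩ : V p) :=
        LinearIndependent.of_comp (V p).subtype (hli p hp)
      rw [mem_infExcept]
      have hiff : ∀ b, (∑ i, x i • X i p ∈ kernelIn (V p) (ρ b p ∘ₗ flat p)) ↔
          ∀ I : Fin m → Fin s, ∑ i, x i * f b i I p = 0 := by
        intro b
        have hval : ∀ I : Fin m → Fin s, ∑ i, x i * f b i I p =
            ρ b p (flat p ⟨∑ i, x i • X i p, hxV⟩) fun j => ⟨X (I j) p, hXV p hp (I j)⟩ := by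
          intro I
          rw [hxsum, map_sum, map_sum, sum_apply]
          refine Finset.sum_congr rfl fun i _ => ?_
          rw [map_smul, map_smul, smul_apply, smul_eq_mul,
            hfe b i I p hp (hXV p hp i) fun j => hXV p hp (I j)]
        simp only [hval]
        constructor
        · intro h I
          obtain ⟨_, h0⟩ := mem_kernelIn.1 h
          rw [LinearMap.comp_apply] at h0
          rw [h0]
          rfl
        · intro h
          refine mem_kernelIn.2 ⟨hxV, ?_⟩
          refine Basis.ext_multilinear (fun _ => Basis.mk hli' hspan') fun I => ?_
          simpa using h I
      constructor
      · rintro h ⟨⟨b, hb⟩, I⟩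
        exact (hiff b).1 (h b hb) I
      · intro h b hb
        exact (hiff b).2 fun I => h ⟨⟨b, hb⟩, I⟩
    -- In the dimension formula of a component system every other term is constant on `U`.
    · have hkey : ∀ p ∈ U, finrank ℝ (infExcept (fun c => kernelIn (V p) (ρ c p ∘ₗ flat p)) a :
          Submodule ℝ (TangentSpace 𝓘(ℝ, EP) p)) + finrank ℝ (A p₀) = d + finrank ℝ
            (A p₀ ⊓ infExcept (fun c => (ρ c p₀).ker) a : Submodule ℝ (Z p₀)) := by
        intro p hp
        rw [infExcept_kernelIn, ← hAa a p hp, ← hA p hp, ← hLfin p,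
          ← (hsys p hp).finrank_infExcept a,
          (Submodule.equivMapOfInjective _ (V p).subtype_injective _).finrank_eq]
      intro p hp
      have h1 := hkey p hp
      have h2 := hkey p₀ hpU
      exact Nat.add_right_cancel (h1.trans h2.symm)
  · intro c U' X' Y' hU' hpU' hX' hY' hXK hYK
    exact hbr c (U' ∩ U) X' Y' (hU'.inter hU) ⟨hpU', hpU⟩ Set.inter_subset_right
      (hX'.mono Set.inter_subset_left) (hY'.mono Set.inter_subset_left)
      (fun p hp => hXK p hp.1) (fun p hp => hYK p hp.1)

end ComponentSystems

/-! ### Alternating forms vanishing on a subspace. -/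

section AlternatingForms

variable {V : Type*} [AddCommGroup V] [Module ℝ V] {T : Type*} [AddCommGroup T] [Module ℝ T]

theorem exists_linearIndependent_apply_zero_eq [FiniteDimensional ℝ V] {q : V} (hq : q ≠ 0) {k : ℕ}
    (hk : k + 1 ≤ finrank ℝ V) :
    ∃ w : Fin (k + 1) → V, LinearIndependent ℝ w ∧ w 0 = q := by
  induction k with
  | zero => exact ⟨![q], (linearIndependent_unique_iff (ι := Fin 1)).2 hq, rfl⟩
  | succ k ih =>
    obtain ⟨w, hw, h0⟩ := ih (by omega)
    obtain ⟨x, hx⟩ := exists_linearIndependent_snoc_of_lt_finrank (R := ℝ) (v := w) hw (by omega)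
    exact ⟨_, hx, by rw [← Fin.castSucc_zero, Fin.snoc_castSucc, h0]⟩

/-- Linear functions vanishing on `L`, with a dual family starting with a given vector that does not
belong to `L`. -/
theorem exists_dual_family [FiniteDimensional ℝ V] {L : Submodule ℝ V} {v : V} (hv : v ∉ L) {k : ℕ}
    (hk : k + 1 ≤ finrank ℝ (V ⧸ L)) :
    ∃ (ξ : V →ₗ[ℝ] Fin (k + 1) → ℝ) (u : Fin (k + 1) → V), (∀ x ∈ L, ξ x = 0) ∧ u 0 = v ∧
      ∀ i, ξ (u i) = Pi.single i 1 := by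
  obtain ⟨w, hw, h0⟩ := exists_linearIndependent_apply_zero_eq (q := L.mkQ v) (by simpa using hv) hk
  obtain ⟨f, hf⟩ := (Fintype.linearCombination ℝ w).exists_leftInverse_of_injective
    (LinearMap.ker_eq_bot.2 hw.fintypeLinearCombination_injective)
  have hfw : ∀ i, f (w i) = Pi.single i 1 := fun i => by
    have := LinearMap.congr_fun hf (Pi.single i 1)
    simpa [Fintype.linearCombination_apply_single] using this
  choose u hu using fun i => L.mkQ_surjective (w i)
  -- The lift of `w 0`, the class of `v`, is taken to be `v` itself.
  refine ⟨f ∘ₗ L.mkQ, Function.update u 0 v, fun x hx => ?_, Function.update_self .., fun i => ?_⟩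
  · rw [LinearMap.comp_apply, (L.mkQ_apply x).trans ((Submodule.Quotient.mk_eq_zero L).2 hx), map_zero]
  · rw [LinearMap.comp_apply, ← hfw]
    congr 1
    rcases eq_or_ne i 0 with rfl | hi
    · rw [Function.update_self, h0]
    · rw [Function.update_of_ne hi, hu]

theorem AlternatingMap.vecCons_swap {k : ℕ} (Ω : V [⋀^Fin (k + 1)]→ₗ[ℝ] T) (l : V)
    (u : Fin k → V) (i : Fin k) :
    Ω (Matrix.vecCons l u) = -Ω (Matrix.vecCons (u i) (Function.update u i l)) := by
  rw [← Ω.map_swap _ (Fin.succ_ne_zero i).symm]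
  congr 1
  ext j
  refine Fin.cases ?_ (fun j => ?_) j
  · simp
  · rcases eq_or_ne j i with rfl | hj
    · simp
    · rw [Function.comp_apply, Equiv.swap_apply_of_ne_of_ne (Fin.succ_ne_zero _) (by simpa using hj)]
      simp [hj]

theorem AlternatingMap.eq_zero_of_curryLeft_eq_zero {k : ℕ} {Ω : V [⋀^Fin (k + 1)]→ₗ[ℝ] T} {l : V}
    (hl : Ω.curryLeft l = 0) {w : Fin (k + 1) → V} {i : Fin (k + 1)} (hi : w i = l) : Ω w = 0 := by
  rcases eq_or_ne i 0 with rfl | h0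
  · rw [← Matrix.cons_head_tail w, ← Ω.curryLeft_apply_apply]
    change Ω.curryLeft (w 0) _ = 0
    rw [hi, hl, zero_apply]
  · have h := Ω.map_swap w h0
    rw [← neg_eq_zero, ← h, ← Matrix.cons_head_tail (w ∘ Equiv.swap i 0),
      ← Ω.curryLeft_apply_apply]
    have h1 : Matrix.vecHead (w ∘ Equiv.swap i 0) = l := by simp [Matrix.vecHead, hi]
    rw [h1, hl, zero_apply]

/-- Any `k` vectors are dependent modulo `L`. Replacing one that occurs with non-zero coefficient by
the resulting combination in `L` multiplies the value of the form by this coefficient and makes it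
zero. -/
theorem annihilatorForms_eq_bot [FiniteDimensional ℝ V] {L : Submodule ℝ V} {k : ℕ}
    (hk : finrank ℝ (V ⧸ L) < k) : annihilatorForms T k L = ⊥ := by
  refine (Submodule.eq_bot_iff _).2 fun α hα => ?_
  ext v
  have hdep : ¬ LinearIndependent ℝ fun i => L.mkQ (v i) := fun h => by
    have := h.fintype_card_le_finrank
    rw [Fintype.card_fin] at this
    omega
  obtain ⟨g, hg, j, hj⟩ := Fintype.not_linearIndependent_iff.1 hdep
  have hmem : ∑ i, g i • v i ∈ L := by
    rw [← Submodule.Quotient.mk_eq_zero, ← Submodule.mkQ_apply, map_sum]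
    simpa using hg
  have h0 := hα (Function.update v j (∑ i, g i • v i)) ⟨j, by rwa [Function.update_self]⟩
  rw [α.map_update_sum, Finset.sum_eq_single j] at h0
  · rw [α.map_update_smul, Function.update_eq_self] at h0
    exact (smul_eq_zero.1 h0).resolve_left hj
  · intro i _ hij
    rw [α.map_update_smul, α.map_update_self v hij.symm, smul_zero]
  · simp

theorem finrank_eq_of_mem_iff {Z Z' : Type*} [AddCommGroup Z] [Module ℝ Z] [AddCommGroup Z']
    [Module ℝ Z'] {S : Submodule ℝ Z} {S' : Submodule ℝ Z'} (Φ : Z ≃ₗ[ℝ] Z')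
    (h : ∀ x, x ∈ S ↔ Φ x ∈ S') : finrank ℝ S = finrank ℝ S' := by
  have : S.map Φ.toLinearMap = S' := by
    ext y
    constructor
    · rintro ⟨x, hx, rfl⟩
      exact (h x).1 hx
    · intro hy
      exact ⟨Φ.symm y, (h _).2 (by simpa using hy), by simp⟩
  rw [← this]
  exact (LinearEquiv.finrank_map_eq Φ S).symm

/-- Isomorphisms of the subspaces and of complements are glued. This is used to compare spaces of
forms at different points. -/
theorem exists_linearEquiv_mem_iff {V' : Type*} [AddCommGroup V'] [Module ℝ V']
    [FiniteDimensional ℝ V] [FiniteDimensional ℝ V'] {L : Submodule ℝ V} {L' : Submodule ℝ V'}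
    (hV : finrank ℝ V = finrank ℝ V') (hL : finrank ℝ L = finrank ℝ L') :
    ∃ e : V ≃ₗ[ℝ] V', ∀ x, x ∈ L ↔ e x ∈ L' := by
  obtain ⟨C, hC⟩ := L.exists_isCompl
  obtain ⟨C', hC'⟩ := L'.exists_isCompl
  have h1 := Submodule.finrank_add_eq_of_isCompl hC
  have h2 := Submodule.finrank_add_eq_of_isCompl hC'
  let e1 : L ≃ₗ[ℝ] L' := LinearEquiv.ofFinrankEq _ _ hL
  let e2 : C ≃ₗ[ℝ] C' := LinearEquiv.ofFinrankEq _ _ (by omega)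
  refine ⟨(L.prodEquivOfIsCompl C hC).symm ≪≫ₗ e1.prodCongr e2 ≪≫ₗ L'.prodEquivOfIsCompl C' hC',
    fun x => ?_⟩
  obtain ⟨⟨a, b⟩, rfl⟩ := (L.prodEquivOfIsCompl C hC).surjective x
  rw [LinearEquiv.trans_apply, LinearEquiv.trans_apply, LinearEquiv.symm_apply_apply,
    LinearEquiv.prodCongr_apply, Submodule.coe_prodEquivOfIsCompl',
    Submodule.coe_prodEquivOfIsCompl']
  rw [L.add_mem_iff_right a.2, L'.add_mem_iff_right (e1 a).2]
  constructor
  · intro hb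
    have h0 : b = 0 := by
      ext
      simpa using (Submodule.disjoint_def.1 hC.disjoint) b hb b.2
    rw [h0, map_zero]
    exact L'.zero_mem
  · intro hb
    have h0 : e2 b = 0 := by
      ext
      simpa using (Submodule.disjoint_def.1 hC'.disjoint) _ hb (e2 b).2
    rw [e2.map_eq_zero_iff.1 h0]
    exact L.zero_mem

end AlternatingForms

/-! ### Component systems of polylagrangian forms. -/

section Polylagrangian

variable {V : Type*} [AddCommGroup V] [Module ℝ V] {T : Type*} [AddCommGroup T] [Module ℝ T]
  {ι : Type*}

/-- The component of a vector-valued alternating form given by a linear function. -/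
def formComponent (k : ℕ) (t : T →ₗ[ℝ] ℝ) :
    (V [⋀^Fin k]→ₗ[ℝ] T) →ₗ[ℝ] MultilinearMap ℝ (fun _ : Fin k => V) ℝ :=
  (AlternatingMap.toMultilinearMapLM (S := ℝ)) ∘ₗ LinearMap.compAlternatingMapₗ (S := ℝ) t

@[simp]
theorem formComponent_apply (k : ℕ) (t : T →ₗ[ℝ] ℝ) (α : V [⋀^Fin k]→ₗ[ℝ] T) (v : Fin k → V) :
    formComponent k t α v = t (α v) := rfl

/-- If the codimension were less than `k`, there would be no non-zero `k`-forms annihilated by `L`.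
Then `Ω` itself would be annihilated by `L`, and it would vanish for the same reason. -/
theorem IsPolylagrangianSubspace.finrank_quotient_ge [FiniteDimensional ℝ V] {k : ℕ}
    {Ω : V [⋀^Fin (k + 1)]→ₗ[ℝ] T} (hΩ : Ω ≠ 0) {L : Submodule ℝ V}
    (hL : IsPolylagrangianSubspace Ω L) : k ≤ finrank ℝ (V ⧸ L) := by
  by_contra! hk
  refine hΩ ?_
  have hA : Ω ∈ annihilatorForms T (k + 1) L := by
    rintro v ⟨i, hi⟩
    have : Ω.curryLeft (v i) ∈ annihilatorForms T k L := hL ▸ Submodule.mem_map_of_mem hi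
    rw [annihilatorForms_eq_bot hk, Submodule.mem_bot] at this
    exact AlternatingMap.eq_zero_of_curryLeft_eq_zero this rfl
  rwa [annihilatorForms_eq_bot (by omega), Submodule.mem_bot] at hA

/-- For `v ∉ L`, a determinant of linear functions vanishing on `L`, times the basis vector `b c`,
takes the value `b c` on a tuple starting with `v`. It is `i_l Ω` for some `l`, and interchanging
`l` and `v` contradicts the vanishing of the `c`-th component of `i_v Ω`. Components are isolated by
projecting the values to the line of one basis vector. -/
theorem IsPolylagrangianSubspace.isComponentSystem [FiniteDimensional ℝ V] (b : Basis ι ℝ T) {k : ℕ}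
    {Ω : V [⋀^Fin (k + 1)]→ₗ[ℝ] T} (hΩ : Ω ≠ 0) {L : Submodule ℝ V}
    (hL : IsPolylagrangianSubspace Ω L) (hk : 1 ≤ k ∨ finrank ℝ (V ⧸ L) = 0) :
    IsComponentSystem Ω.curryLeft L (annihilatorForms T k L)
      fun c => formComponent k (b.coord c) where
  map_eq := hL
  ker_le c v hv := by
    by_contra hvL
    have hN := hL.finrank_quotient_ge hΩ
    have h0 : finrank ℝ (V ⧸ L) ≠ 0 := fun h => by
      have := Module.finrank_zero_iff.1 h
      rw [Submodule.Quotient.subsingleton_iff] at this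
      exact hvL (this ▸ Submodule.mem_top)
    -- The codimension is non-zero because `v ∉ L`, so `k ≥ 1`: the contracted form has a slot for
    -- `v`.
    obtain ⟨k, rfl⟩ : ∃ k', k = k' + 1 := ⟨k - 1, by omega⟩
    obtain ⟨ξ, u, hξL, hu0, hξu⟩ := exists_dual_family hvL hN
    let α : V [⋀^Fin (k + 1)]→ₗ[ℝ] T :=
      (LinearMap.toSpanSingleton ℝ T (b c)).compAlternatingMap
        (Matrix.detRowAlternating.compLinearMap ξ)
    have hα : ∀ w, α w = (Matrix.of fun i => ξ (w i)).det • b c := fun w => rfl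
    have hαA : α ∈ annihilatorForms T (k + 1) L := by
      rintro w ⟨i, hi⟩
      rw [hα, Matrix.det_eq_zero_of_row_eq_zero i (fun j => congrFun (hξL _ hi) j), zero_smul]
    rw [← hL] at hαA
    obtain ⟨l, -, hl⟩ := hαA
    have h1 : b.coord c (α u) = 1 := by
      have : (Matrix.of fun i => ξ (u i)) = (1 : Matrix (Fin (k + 1)) (Fin (k + 1)) ℝ) := by
        ext i j
        rw [Matrix.of_apply, hξu, Matrix.one_apply, Pi.single_apply]
        simp only [eq_comm]
      rw [hα, this, Matrix.det_one, one_smul]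
      simp
    rw [← hl, AlternatingMap.curryLeft_apply_apply, AlternatingMap.vecCons_swap _ _ _ 0, hu0, map_neg,
      ← AlternatingMap.curryLeft_apply_apply, ← formComponent_apply] at h1
    have h2 : formComponent (k + 1) (b.coord c) (Ω.curryLeft v) = 0 := hv
    rw [h2] at h1
    simp at h1
  exists_component a α hα := by
    refine ⟨(LinearMap.toSpanSingleton ℝ T (b a) ∘ₗ b.coord a).compAlternatingMap α,
      fun v hv => ?_, ?_, fun c hc => ?_⟩
    · simp [hα v hv]
    · ext v
      simp
    · ext v
      simp [Finsupp.single_eq_of_ne hc]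

/-- The data depend, up to isomorphism, only on dimensions, so the dimensions of all the spaces of
forms involved do not change from point to point. -/
theorem exists_equiv_polylagrangian {V' T' : Type*} [AddCommGroup V'] [Module ℝ V']
    [AddCommGroup T'] [Module ℝ T'] [FiniteDimensional ℝ V] [FiniteDimensional ℝ V']
    (b : Basis ι ℝ T) (b' : Basis ι ℝ T') (k : ℕ) {L : Submodule ℝ V} {L' : Submodule ℝ V'}
    (hV : finrank ℝ V = finrank ℝ V') (hL : finrank ℝ L = finrank ℝ L') :
    ∃ Φ : (V [⋀^Fin k]→ₗ[ℝ] T) ≃ₗ[ℝ] (V' [⋀^Fin k]→ₗ[ℝ] T'),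
      (∀ α, α ∈ annihilatorForms T k L ↔ Φ α ∈ annihilatorForms T' k L') ∧
      ∀ c α, α ∈ (formComponent k (b.coord c)).ker ↔ Φ α ∈ (formComponent k (b'.coord c)).ker := by
  obtain ⟨e, he⟩ := exists_linearEquiv_mem_iff hV hL
  let t : T ≃ₗ[ℝ] T' := b.equiv b' (Equiv.refl ι)
  have ht : ∀ x c, b'.coord c (t x) = b.coord c x := by
    intro x c
    have : b'.coord c ∘ₗ t.toLinearMap = b.coord c := by
      refine b.ext fun i => ?_
      simp [t]
    exact LinearMap.congr_fun this x
  refine ⟨AlternatingMap.domLCongr ℝ T (Fin k) ℝ e ≪≫ₗ LinearEquiv.alternatingMapCongrRight t,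
    fun α => ?_, fun c α => ?_⟩
  · have hΦ : ∀ v, (AlternatingMap.domLCongr ℝ T (Fin k) ℝ e ≪≫ₗ
        LinearEquiv.alternatingMapCongrRight t) α v = t (α fun i => e.symm (v i)) := fun v => rfl
    constructor
    · rintro hα v ⟨i, hi⟩
      rw [hΦ, hα _ ⟨i, (he _).2 (by simpa using hi)⟩, map_zero]
    · rintro hα v ⟨i, hi⟩
      have := hα (fun i => e (v i)) ⟨i, (he _).1 hi⟩
      simpa [hΦ] using this
  · simp only [LinearMap.mem_ker]
    have hΦ : ∀ v, (AlternatingMap.domLCongr ℝ T (Fin k) ℝ e ≪≫ₗ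
        LinearEquiv.alternatingMapCongrRight t) α v = t (α fun i => e.symm (v i)) := fun v => rfl
    constructor
    · intro hα
      ext v
      rw [formComponent_apply, hΦ, ht, ← formComponent_apply, hα]
      rfl
    · intro hα
      ext v
      have := congrArg (fun β => β fun i => e (v i)) hα
      simp only [formComponent_apply, hΦ, ht] at this
      simpa using this

end Polylagrangian

/-! ### Combinatorics of Cartan's formula. -/

section CartanFormula

/-- In the second sum `j` stands for the field with index `j + 1`, so `B 0 0` is the term with the
bracket of the first two fields; all the others are assumed to vanish. -/
theorem eq_zero_of_cartan_sum_eq_zero {E : Type*} [AddCommGroup E] [Module ℝ E] {k : ℕ}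
    {D : Fin (k + 2) → E} {B : Fin (k + 1) → Fin (k + 1) → E}
    (h : (∑ i : Fin (k + 2), (-1 : ℝ) ^ (i : ℕ) • D i) -
      ∑ i : Fin (k + 1), ∑ j ∈ Finset.Ici i, (-1 : ℝ) ^ (i + j : ℕ) • B i j = 0)
    (hD : ∀ i, D i = 0) (hB : ∀ i j, i ≤ j → j ≠ 0 → B i j = 0) : B 0 0 = 0 := by
  simp only [hD, smul_zero, Finset.sum_const_zero, zero_sub, neg_eq_zero] at h
  rw [Finset.sum_eq_single 0, Finset.sum_eq_single 0] at h
  · simpa using h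
  · intro j hj hj0
    rw [hB 0 j (Finset.mem_Ici.1 hj) hj0, smul_zero]
  · simp
  · intro i _ hi
    refine Finset.sum_eq_zero fun j hj => ?_
    have hij := Finset.mem_Ici.1 hj
    rw [hB i j hij (fun h0 => hi (le_antisymm (h0 ▸ hij) (Fin.zero_le i))), smul_zero]
  · simp

variable {α : Type*} {k : ℕ} (W : Fin (k + 2) → α)

theorem Fin.removeNth_apply_zero {i : Fin (k + 2)} (hi : i ≠ 0) : i.removeNth W 0 = W 0 := by
  rw [Fin.removeNth, Fin.succAbove_ne_zero_zero hi]

/-- Two members of a family are kept or replaced by the removal of one member. -/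
theorem Fin.removeNth_mem_pair (i : Fin (k + 2)) :
    i.removeNth W 0 = W 0 ∨ i.removeNth W 0 = W 1 := by
  rcases eq_or_ne i 0 with rfl | hi
  · exact Or.inr rfl
  · exact Or.inl (Fin.removeNth_apply_zero W hi)

theorem Fin.exists_removeNth_removeNth_eq (W : Fin (k + 3) → α) {i j : Fin (k + 2)} (hj : j ≠ 0) :
    (j.removeNth (i.castSucc.removeNth W)) 0 = W 0 ∨
      (j.removeNth (i.castSucc.removeNth W)) 0 = W 1 := by
  rw [Fin.removeNth_apply_zero _ hj]
  exact Fin.removeNth_mem_pair W _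

end CartanFormula

/-! ### Closed vertical forms and their component kernels. -/

section VerticalForms

variable {EP : Type*} [NormedAddCommGroup EP] [NormedSpace ℝ EP] [FiniteDimensional ℝ EP]
  {EM : Type*} [NormedAddCommGroup EM] [NormedSpace ℝ EM] [FiniteDimensional ℝ EM]
  {P : Type*} [TopologicalSpace P] [ChartedSpace EP P] [IsManifold 𝓘(ℝ, EP) ∞ P]
  {M : Type*} [TopologicalSpace M] [ChartedSpace EM M] [IsManifold 𝓘(ℝ, EM) ∞ M]

/-- A smooth local frame of the vertical bundle. -/
theorem exists_vertical_frame {pr : P → M} {p₀ : P} {U : Set P}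
    (hsurj : ∀ p, Function.Surjective (mfderiv 𝓘(ℝ, EP) 𝓘(ℝ, EM) pr p))
    {Z : TangentSpace 𝓘(ℝ, EP) p₀ → ∀ p : P, TangentSpace 𝓘(ℝ, EP) p} (hU : IsOpen U)
    (hp₀ : p₀ ∈ U) (hZ : ∀ v, SmoothVerticalFieldOn EM pr (Z v) U)
    (hZ₀ : ∀ v ∈ verticalSpace EP EM pr p₀, Z v p₀ = v) :
    ∃ U' ⊆ U, IsOpen U' ∧ p₀ ∈ U' ∧ ∃ (s : ℕ) (X : Fin s → ∀ p : P, TangentSpace 𝓘(ℝ, EP) p),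
      (∀ i, SmoothVerticalFieldOn EM pr (X i) U') ∧
      (∀ p ∈ U', LinearIndependent ℝ fun i => X i p) ∧
      ∀ p ∈ U', Submodule.span ℝ (Set.range fun i => X i p) = verticalSpace EP EM pr p := by
  have hfd : ∀ p : P, FiniteDimensional ℝ (TangentSpace 𝓘(ℝ, EP) p) := fun p =>
    inferInstanceAs (FiniteDimensional ℝ EP)
  let b := finBasis ℝ (verticalSpace EP EM pr p₀)
  have hli : LinearIndependent ℝ fun i => Z (b i) p₀ := by
    have h1 := b.linearIndependent.map' (verticalSpace EP EM pr p₀).subtype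
      (Submodule.ker_subtype _)
    have h2 : (fun i => Z (b i) p₀) = (verticalSpace EP EM pr p₀).subtype ∘ b :=
      funext fun i => hZ₀ _ (b i).2
    rw [h2]
    exact h1
  obtain ⟨U', hU'U, hU', hp₀', hli'⟩ :=
    exists_linearIndependent_nhds (X := fun i => Z (b i)) hU hp₀ (fun i => (hZ _).1) hli
  refine ⟨U', hU'U, hU', hp₀', _, fun i => Z (b i),
    fun i => ⟨(hZ _).1.mono hU'U, fun p hp => (hZ _).2 p (hU'U hp)⟩, hli', fun p hp => ?_⟩
  refine Submodule.eq_of_le_of_finrank_eq ?_ ?_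
  · rw [Submodule.span_le]
    rintro _ ⟨i, rfl⟩
    exact (hZ _).2 p (hU'U hp)
  · rw [finrank_span_eq_card (hli' p hp), Fintype.card_fin]
    have h1 := finrank_verticalSpace (hsurj p)
    have h2 := finrank_verticalSpace (hsurj p₀)
    omega

variable {FT : Type*} [NormedAddCommGroup FT] [NormedSpace ℝ FT] [FiniteDimensional ℝ FT]
  {T : M → Type*} [∀ m, AddCommGroup (T m)] [∀ m, Module ℝ (T m)]
  [∀ m, TopologicalSpace (T m)] [TopologicalSpace (TotalSpace FT T)] [FiberBundle FT T]
  [VectorBundle ℝ FT T]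

theorem VerticalForm.eval_of_mem {pr : P → M} {j : ℕ} (Ω : VerticalForm EP EM pr T j) {p : P}
    {v : Fin j → TangentSpace 𝓘(ℝ, EP) p} (h : ∀ i, v i ∈ verticalSpace EP EM pr p) :
    Ω.eval p v = Ω p fun i => ⟨v i, h i⟩ := dif_pos h

theorem VerticalForm.apply_eval_eq_zero {pr : P → M} {k : ℕ} (Ω : VerticalForm EP EM pr T (k + 1))
    {p : P} {t : T (pr p) →ₗ[ℝ] ℝ} {v : TangentSpace 𝓘(ℝ, EP) p}
    (hv : v ∈ kernelIn (verticalSpace EP EM pr p) (formComponent k t ∘ₗ (Ω p).curryLeft))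
    {w : Fin (k + 1) → TangentSpace 𝓘(ℝ, EP) p} {i : Fin (k + 1)} (hi : w i = v) :
    t (Ω.eval p w) = 0 := by
  by_cases h : ∀ i, w i ∈ verticalSpace EP EM pr p
  · obtain ⟨hvV, h0⟩ := mem_kernelIn.1 hv
    rw [Ω.eval_of_mem h]
    refine AlternatingMap.eq_zero_of_curryLeft_eq_zero (Ω := t.compAlternatingMap (Ω p))
      (l := ⟨v, hvV⟩) (w := fun i => ⟨w i, h i⟩) (i := i) ?_ (Subtype.ext hi)
    ext z
    exact congrArg (fun β => β z) h0
  · rw [VerticalForm.eval, dif_neg h, map_zero]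

/-- The derivative at `p₀` is taken in the trivialization around `pr p₀`, the same one that defines
the component, so the linear function `t` can be moved inside it. -/
theorem apply_verticalDeriv_eq_zero {pr : P → M} {p₀ : P} (t : FT →ₗ[ℝ] ℝ)
    {f : ∀ p : P, T (pr p)}
    (hf : ∀ᶠ p in 𝓝 p₀, t ((trivializationAt FT T (pr p₀)).linearMapAt ℝ (pr p) (f p)) = 0)
    (hpr : Continuous pr) (v : TangentSpace 𝓘(ℝ, EP) p₀) :
    t ((trivializationAt FT T (pr p₀)).linearMapAt ℝ (pr p₀) (verticalDeriv FT pr f p₀ v)) = 0 := by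
  set e := trivializationAt FT T (pr p₀) with he
  have hp₀ : pr p₀ ∈ e.baseSet := mem_baseSet_trivializationAt FT T (pr p₀)
  refine (congrArg t (Trivialization.linearMapAt_symm (R := ℝ) e hp₀ _)).trans ?_
  by_cases hd : MDifferentiableAt 𝓘(ℝ, EP) 𝓘(ℝ, FT) (fun q => (e ⟨pr q, f q⟩).2) p₀
  · have h1 := (LinearMap.toContinuousLinearMap t).hasMFDerivAt.comp p₀ hd.hasMFDerivAt
    have h2 : (LinearMap.toContinuousLinearMap t) ∘ (fun q => (e ⟨pr q, f q⟩).2) =ᶠ[𝓝 p₀]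
        fun _ => (0 : ℝ) := by
      filter_upwards [hf, (e.open_baseSet.preimage hpr).mem_nhds hp₀] with q hq hqb
      rwa [Trivialization.coe_linearMapAt_of_mem e hqb] at hq
    have h3 := (hasMFDerivAt_const (I := 𝓘(ℝ, EP)) (I' := 𝓘(ℝ, ℝ)) (0 : ℝ) p₀).congr_of_eventuallyEq
      h2
    have h4 := hasMFDerivAt_unique h1 h3
    exact congrArg (fun g => g v) h4
  -- Without differentiability the derivative has the default value zero, and the claim persists.
  · rw [mfderiv_zero_of_not_mdifferentiableAt hd]
    exact map_zero t

/-- The kernels of the components of a vertically closed form are closed under brackets. -/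
theorem VerticalForm.IsVerticallyClosed.mlieBracket_mem_kernelIn {pr : P → M}
    (hpr : ContMDiff 𝓘(ℝ, EP) 𝓘(ℝ, EM) ∞ pr) {p₀ : P}
    (hsurj : Function.Surjective (mfderiv 𝓘(ℝ, EP) 𝓘(ℝ, EM) pr p₀)) {k : ℕ}
    {Ω : VerticalForm EP EM pr T (k + 1)} (hΩ : Ω.IsVerticallyClosed FT) (t : FT →ₗ[ℝ] ℝ)
    {U : Set P} {X Y : ∀ p : P, TangentSpace 𝓘(ℝ, EP) p} (hU : IsOpen U) (hp₀ : p₀ ∈ U)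
    (hX : SmoothFieldOn X U) (hY : SmoothFieldOn Y U)
    (hXK : ∀ p ∈ U, X p ∈ kernelIn (verticalSpace EP EM pr p) (formComponent k
      (t ∘ₗ (trivializationAt FT T (pr p₀)).linearMapAt ℝ (pr p)) ∘ₗ (Ω p).curryLeft))
    (hYK : ∀ p ∈ U, Y p ∈ kernelIn (verticalSpace EP EM pr p) (formComponent k
      (t ∘ₗ (trivializationAt FT T (pr p₀)).linearMapAt ℝ (pr p)) ∘ₗ (Ω p).curryLeft)) :
    mlieBracket 𝓘(ℝ, EP) X Y p₀ ∈ kernelIn (verticalSpace EP EM pr p₀) (formComponent k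
      (t ∘ₗ (trivializationAt FT T (pr p₀)).linearMapAt ℝ (pr p₀)) ∘ₗ (Ω p₀).curryLeft) := by
  have hXV : ∀ p ∈ U, X p ∈ verticalSpace EP EM pr p := fun p hp => (mem_kernelIn.1 (hXK p hp)).1
  have hYV : ∀ p ∈ U, Y p ∈ verticalSpace EP EM pr p := fun p hp => (mem_kernelIn.1 (hYK p hp)).1
  have hbr : mlieBracket 𝓘(ℝ, EP) X Y p₀ ∈ verticalSpace EP EM pr p₀ :=
    mlieBracket_mem_verticalSpace hpr hU hp₀ hX hY
      (fun p hp hpc => (projDeriv_eq_zero_iff hpc _).2 (hXV p hp))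
      (fun p hp hpc => (projDeriv_eq_zero_iff hpc _).2 (hYV p hp))
  obtain ⟨U₁, Z, -, hU₁, hp₁, -, hZ, hZ₀, -, -⟩ := exists_adapted_fields (p₀ := p₀) hpr hsurj
  refine mem_kernelIn.2 ⟨hbr, ?_⟩
  ext z
  -- Cartan's formula is applied to `X`, `Y` and vertical extensions of the given vectors `z j`.
  let W : Fin (k + 2) → ∀ p : P, TangentSpace 𝓘(ℝ, EP) p :=
    Matrix.vecCons X (Matrix.vecCons Y fun j => Z (z j))
  have hW : ∀ i, SmoothVerticalFieldOn EM pr (W i) (U ∩ U₁) := by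
    intro i
    refine Fin.cases ?_ (fun i => Fin.cases ?_ (fun i => ?_) i) i
    · exact ⟨hX.mono Set.inter_subset_left, fun p hp => hXV p hp.1⟩
    · exact ⟨hY.mono Set.inter_subset_left, fun p hp => hYV p hp.1⟩
    · exact ⟨(hZ _).1.mono Set.inter_subset_right, fun p hp => (hZ _).2 p hp.2⟩
  have hW0 : ∀ p ∈ U, ∀ v : TangentSpace 𝓘(ℝ, EP) p, (v = W 0 p ∨ v = W 1 p) → v ∈
      kernelIn (verticalSpace EP EM pr p) (formComponent k
        (t ∘ₗ (trivializationAt FT T (pr p₀)).linearMapAt ℝ (pr p)) ∘ₗ (Ω p).curryLeft) := by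
    rintro p hp v (rfl | rfl)
    · exact hXK p hp
    · exact hYK p hp
  have h := congrArg (t ∘ₗ (trivializationAt FT T (pr p₀)).linearMapAt ℝ (pr p₀))
    (hΩ (U ∩ U₁) W (hU.inter hU₁) hW p₀ ⟨hp₀, hp₁⟩)
  rw [VerticalForm.extDerivEval, map_sub, map_sum, map_sum, map_zero] at h
  simp only [map_sum, map_smul] at h
  have h2 := eq_zero_of_cartan_sum_eq_zero h ?_ ?_
  · refine Eq.trans ?_ h2
    have hv : ∀ i, Matrix.vecCons (mlieBracket 𝓘(ℝ, EP) X Y p₀) (fun j => (z j).1) i ∈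
        verticalSpace EP EM pr p₀ := by
      intro i
      refine Fin.cases hbr (fun i => (z i).2) i
    have htail : (fun j => Z (z j) p₀) = fun j => (z j).1 := funext fun j => hZ₀ _ (z j).2
    refine congrArg (t ∘ₗ (trivializationAt FT T (pr p₀)).linearMapAt ℝ (pr p₀)) (Eq.trans ?_
      (congrArg (fun w => Ω.eval p₀ (Matrix.vecCons (mlieBracket 𝓘(ℝ, EP) X Y p₀) w)) htail.symm))
    refine Eq.trans ?_ (Ω.eval_of_mem hv).symm
    refine congrArg (Ω p₀) (funext fun i => ?_)
    exact Fin.cases rfl (fun i => rfl) i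
  -- Only one field is removed, so `X` or `Y` remains as first argument and the component of the
  -- function being differentiated is zero near `p₀`.
  · intro i
    refine apply_verticalDeriv_eq_zero t ?_ hpr.continuous _
    filter_upwards [hU.mem_nhds hp₀] with q hq
    exact Ω.apply_eval_eq_zero (t := t ∘ₗ (trivializationAt FT T (pr p₀)).linearMapAt ℝ (pr q))
      (hW0 q hq _ (Fin.removeNth_mem_pair (fun l => W l q) i)) (i := 0) rfl
  -- For `j ≠ 0` the second removed field is neither `X` nor `Y`, so at least one of the two
  -- survives; it stands in slot `1`, right after the bracket.
  · intro i j _ hj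
    obtain ⟨k, rfl⟩ : ∃ k', k = k' + 1 := ⟨k - 1, by have := Fin.val_ne_zero_iff.2 hj; omega⟩
    exact Ω.apply_eval_eq_zero (t := t ∘ₗ (trivializationAt FT T (pr p₀)).linearMapAt ℝ (pr p₀))
      (hW0 p₀ hp₀ _ (Fin.exists_removeNth_removeNth_eq (fun l => W l p₀) hj)) (i := 1) rfl

end VerticalForms

/-! ### The polylagrangian case. -/

section Polylagrangian

theorem finrank_add_codimIn {W : Type*} [AddCommGroup W] [Module ℝ W] [FiniteDimensional ℝ W]
    {V L : Submodule ℝ W} (h : L ≤ V) : finrank ℝ L + codimIn V L = finrank ℝ V := by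
  rw [codimIn, ← (L.submoduleOf V).finrank_quotient_add_finrank,
    (Submodule.submoduleOfEquivOfLe h).finrank_eq, add_comm]

variable {EP : Type*} [NormedAddCommGroup EP] [NormedSpace ℝ EP] [FiniteDimensional ℝ EP]
  {EM : Type*} [NormedAddCommGroup EM] [NormedSpace ℝ EM] [FiniteDimensional ℝ EM]
  {P : Type*} [TopologicalSpace P] [ChartedSpace EP P] [IsManifold 𝓘(ℝ, EP) ∞ P]
  {M : Type*} [TopologicalSpace M] [ChartedSpace EM M] [IsManifold 𝓘(ℝ, EM) ∞ M]
  {FT : Type*} [NormedAddCommGroup FT] [NormedSpace ℝ FT] [FiniteDimensional ℝ FT]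
  {T : M → Type*} [∀ m, AddCommGroup (T m)] [∀ m, Module ℝ (T m)]
  [∀ m, TopologicalSpace (T m)] [TopologicalSpace (TotalSpace FT T)] [FiberBundle FT T]
  [VectorBundle ℝ FT T]

/-- The components of a smooth vertical form in a local trivialization are smooth. -/
theorem VerticalForm.IsSmooth.contMDiffOn_component [ContMDiffVectorBundle ∞ FT T 𝓘(ℝ, EM)]
    {pr : P → M} {j : ℕ} {Ω : VerticalForm EP EM pr T j} (hΩ : Ω.IsSmooth FT) (t : FT →ₗ[ℝ] ℝ)
    {m : M} {U : Set P} (hU : IsOpen U) (hUm : ∀ p ∈ U, pr p ∈ (trivializationAt FT T m).baseSet)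
    {X : Fin j → ∀ p : P, TangentSpace 𝓘(ℝ, EP) p} (hX : ∀ i, SmoothVerticalFieldOn EM pr (X i) U) :
    ContMDiffOn 𝓘(ℝ, EP) 𝓘(ℝ, ℝ) ∞
      (fun p => t ((trivializationAt FT T m).linearMapAt ℝ (pr p) (Ω.eval p fun i => X i p))) U := by
  have h := ((trivializationAt FT T m).contMDiffOn_iff (IB := 𝓘(ℝ, EM)) (n := ∞)
    (f := fun p => TotalSpace.mk' FT (pr p) (Ω.eval p fun i => X i p)) (s := U)
    (fun p hp => (Trivialization.mem_source _).2 (hUm p hp))).1 (hΩ U X hU hX)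
  refine ((LinearMap.toContinuousLinearMap t).contMDiff.comp_contMDiffOn h.2).congr fun p hp => ?_
  rw [Trivialization.coe_linearMapAt_of_mem _ (hUm p hp)]
  rfl

/-- The integrability theorem for polylagrangian bundles. -/
theorem IsPolylagrangianBundleForm.integrable [ContMDiffVectorBundle ∞ FT T 𝓘(ℝ, EM)] {pr : P → M}
    (hpr : ContMDiff 𝓘(ℝ, EP) 𝓘(ℝ, EM) ∞ pr)
    (hsurj : ∀ p, Function.Surjective (mfderiv 𝓘(ℝ, EP) 𝓘(ℝ, EM) pr p)) {k N : ℕ}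
    {Ω : VerticalForm EP EM pr T (k + 1)} {L : ∀ p : P, Submodule ℝ (TangentSpace 𝓘(ℝ, EP) p)}
    (hk : 1 ≤ k ∨ N = 0) (hΩ : IsPolylagrangianBundleForm FT N Ω)
    (hL : ∀ p : P, L p ≤ verticalSpace EP EM pr p ∧ codimIn (verticalSpace EP EM pr p) (L p) = N ∧
      IsPolylagrangianSubspace (Ω p) ((L p).submoduleOf (verticalSpace EP EM pr p)))
    (hFT : 3 ≤ finrank ℝ FT) :
    IsSmoothDistribution L ∧ IsInvolutiveDistribution L ∧ IsIntegrableDistribution L := by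
  have hfd : ∀ p : P, FiniteDimensional ℝ (TangentSpace 𝓘(ℝ, EP) p) := fun p =>
    inferInstanceAs (FiniteDimensional ℝ EP)
  have hV : ∀ p q : P, finrank ℝ (verticalSpace EP EM pr p) =
      finrank ℝ (verticalSpace EP EM pr q) := fun p q => by
    have h1 := finrank_verticalSpace (hsurj p)
    have h2 := finrank_verticalSpace (hsurj q)
    omega
  have hLdim : ∀ p q, finrank ℝ (L p) = finrank ℝ (L q) := fun p q => by
    have h1 := finrank_add_codimIn (hL p).1
    have h2 := finrank_add_codimIn (hL q).1
    rw [(hL p).2.1] at h1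
    rw [(hL q).2.1, hV q p] at h2
    omega
  let b := finBasis ℝ FT
  -- A point is needed only to name the common dimension of the spaces `L p`.
  rcases isEmpty_or_nonempty P with hP | ⟨⟨q⟩⟩
  · exact ⟨fun p => isEmptyElim p, fun _ _ _ _ _ _ _ _ p => isEmptyElim p, fun p => isEmptyElim p⟩
  refine integrable_of_componentSystems (ι := Fin (finrank ℝ FT)) (by simpa using hFT)
    (V := verticalSpace EP EM pr) (d := finrank ℝ (L q)) (m := k) (fun p => hLdim p q)
    (fun p => (hL p).1) (fun p => verticalSpace EP EM pr p [⋀^Fin k]→ₗ[ℝ] T (pr p))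
    (fun p => (Ω p).curryLeft)
    (fun p => annihilatorForms (T (pr p)) k ((L p).submoduleOf (verticalSpace EP EM pr p)))
    fun p₀ => ?_
  set e := trivializationAt FT T (pr p₀) with he
  obtain ⟨U₁, Z, -, hU₁, hp₁, -, hZ, hZ₀, -, -⟩ := exists_adapted_fields (p₀ := p₀) hpr (hsurj p₀)
  obtain ⟨U₂, hU₂₁, hU₂, hp₂, s, X, hX, hXli, hXspan⟩ :=
    exists_vertical_frame hsurj hU₁ hp₁ hZ hZ₀
  have hUo : IsOpen (U₂ ∩ pr ⁻¹' e.baseSet) := hU₂.inter (e.open_baseSet.preimage hpr.continuous)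
  have hpU : p₀ ∈ U₂ ∩ pr ⁻¹' e.baseSet := ⟨hp₂, mem_baseSet_trivializationAt FT T (pr p₀)⟩
  -- One fixed trivialization carries a basis of the typical fiber to all nearby fibers; its
  -- coordinate functions define the components.
  let B : ∀ p ∈ U₂ ∩ pr ⁻¹' e.baseSet, Basis (Fin (finrank ℝ FT)) ℝ (T (pr p)) := fun p hp =>
    b.map (e.linearEquivAt ℝ (pr p) hp.2).symm
  have hB : ∀ p hp c, (B p hp).coord c = b.coord c ∘ₗ e.linearMapAt ℝ (pr p) := by
    intro p hp c
    ext x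
    rw [LinearMap.comp_apply, Trivialization.linearMapAt_def_of_mem e hp.2]
    simp [B]
  have hdim : ∀ p hp, ∃ Φ : (verticalSpace EP EM pr p [⋀^Fin k]→ₗ[ℝ] T (pr p)) ≃ₗ[ℝ]
      (verticalSpace EP EM pr p₀ [⋀^Fin k]→ₗ[ℝ] T (pr p₀)), _ := fun p hp =>
    exists_equiv_polylagrangian (B p hp) (B p₀ hpU) k
      (L := (L p).submoduleOf (verticalSpace EP EM pr p))
      (L' := (L p₀).submoduleOf (verticalSpace EP EM pr p₀)) (hV p p₀) (by
        rw [(Submodule.submoduleOfEquivOfLe (hL p).1).finrank_eq,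
          (Submodule.submoduleOfEquivOfLe (hL p₀).1).finrank_eq, hLdim p p₀])
  have hXU : ∀ i, SmoothVerticalFieldOn EM pr (X i) (U₂ ∩ pr ⁻¹' e.baseSet) := fun i =>
    ⟨(hX i).1.mono Set.inter_subset_left, fun p hp => (hX i).2 p hp.1⟩
  refine ⟨U₂ ∩ pr ⁻¹' e.baseSet,
    fun c p => formComponent k (b.coord c ∘ₗ e.linearMapAt ℝ (pr p)), s, X, hUo, hpU, ?_, ?_, ?_,
    fun i => (hXU i).1, fun p hp => hXli p hp.1, fun p hp => hXspan p hp.1, ?_, ?_⟩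
  · intro p hp
    have h := (hL p).2.2.isComponentSystem (B p hp) (hΩ.polylagrangian p).1
      (hk.imp_right fun h0 => ((hL p).2.1.trans h0))
    simpa only [hB p hp] using h
  · intro p hp
    obtain ⟨Φ, h1, -⟩ := hdim p hp
    exact finrank_eq_of_mem_iff Φ h1
  · intro a p hp
    obtain ⟨Φ, h1, h2⟩ := hdim p hp
    simp only [hB] at h2
    refine finrank_eq_of_mem_iff Φ fun x => ?_
    rw [Submodule.mem_inf, Submodule.mem_inf, mem_infExcept, mem_infExcept]
    exact and_congr (h1 x) (forall₂_congr fun c _ => h2 c x)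
  · intro c i I
    refine ⟨_, hΩ.smooth.contMDiffOn_component (b.coord c) hUo (fun p hp => hp.2)
      (X := Matrix.vecCons (X i) fun j => X (I j))
      (fun j => Fin.cases (hXU i) (fun j => hXU (I j)) j), fun p hp hi hI => ?_⟩
    have hv : ∀ j, (Matrix.vecCons (X i) fun j => X (I j)) j p ∈ verticalSpace EP EM pr p :=
      fun j => Fin.cases hi hI j
    refine (congrArg (b.coord c ∘ₗ e.linearMapAt ℝ (pr p)) ((Ω.eval_of_mem hv).trans ?_))
    refine congrArg (Ω p) (funext fun j => ?_)
    exact Fin.cases rfl (fun j => rfl) j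
  · intro c U X Y hU hp₀ _ hX hY hXK hYK
    exact hΩ.closed.mlieBracket_mem_kernelIn hpr (hsurj p₀) (b.coord c) hU hp₀ hX hY hXK hYK

end Polylagrangian

/-! ### Horizontal forms and horizontal frames. -/

section Horizontal

variable {W : Type*} [AddCommGroup W] [Module ℝ W] {V : Submodule ℝ W} {r l n : ℕ}

theorem Fin.append_update_left {α : Type*} (u : Fin r → α) (x : Fin l → α) (i : Fin r) (a : α) :
    Fin.append (Function.update u i a) x =
      Function.update (Fin.append u x) (Fin.castAdd l i) a := by
  ext j
  refine Fin.addCases (fun j => ?_) (fun j => ?_) j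
  · rcases eq_or_ne j i with rfl | hj
    · simp
    · rw [Fin.append_left, Function.update_of_ne hj, Function.update_of_ne (by simpa using hj),
        Fin.append_left]
  · rw [Fin.append_right, Function.update_of_ne (by
      simp only [ne_eq, Fin.ext_iff, Fin.val_natAdd, Fin.val_castAdd]; omega), Fin.append_right]

theorem apply_eq_zero_of_mem_horizontalForms {k s : ℕ} {α : W [⋀^Fin k]→ₗ[ℝ] ℝ}
    (hα : α ∈ horizontalForms V k s) (hs : s < k) {w : Fin k → W}
    (hw : ∀ i : Fin k, i.val ≤ s → w i ∈ V) : α w = 0 := by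
  refine hα ((Finset.univ : Finset (Fin (s + 1))).map (Fin.castLEEmb hs)) w (by simp) ?_
  intro i hi
  obtain ⟨j, -, rfl⟩ := Finset.mem_map.1 hi
  exact hw _ (by simp only [Fin.castLEEmb_apply, Fin.val_castLE]; omega)

/-- The contraction of a form with a family of vectors in the last arguments, restricted to a
subspace. -/
def appendComponent (V : Submodule ℝ W) (r : ℕ) (x : Fin l → W) :
    (W [⋀^Fin (r + l)]→ₗ[ℝ] ℝ) →ₗ[ℝ] MultilinearMap ℝ (fun _ : Fin r => V) ℝ where
  toFun α :=
    { toFun := fun v => α (Fin.append (fun i => (v i : W)) x)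
      map_update_add' := fun {inst} v i a b => by
        obtain rfl : inst = instDecidableEqFin r := Subsingleton.elim _ _
        have h : ∀ a : V, (fun j => (Function.update v i a j : W)) =
            Function.update (fun j => (v j : W)) i (a : W) := fun a => by
          ext j
          rcases eq_or_ne j i with rfl | hj
          · simp
          · simp [hj]
        simp only [h, Fin.append_update_left, Submodule.coe_add, α.map_update_add]
      map_update_smul' := fun {inst} v i c a => by
        obtain rfl : inst = instDecidableEqFin r := Subsingleton.elim _ _
        have h : ∀ a : V, (fun j => (Function.update v i a j : W)) =
            Function.update (fun j => (v j : W)) i (a : W) := fun a => by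
          ext j
          rcases eq_or_ne j i with rfl | hj
          · simp
          · simp [hj]
        simp only [h, Fin.append_update_left, Submodule.coe_smul, α.map_update_smul] }
  map_add' α β := rfl
  map_smul' c α := rfl

@[simp]
theorem appendComponent_apply (x : Fin l → W) (α : W [⋀^Fin (r + l)]→ₗ[ℝ] ℝ) (v : Fin r → V) :
    appendComponent V r x α v = α (Fin.append (fun i => (v i : W)) x) := rfl

/-- A form vanishes on a vector in the kernel of one of its components, vertical vectors and the
vectors defining the component. -/
theorem AlternatingMap.apply_vecCons_append_eq_zero {Ω : W [⋀^Fin (r + l + 1)]→ₗ[ℝ] ℝ}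
    {x : Fin l → W} {v : W}
    (hv : v ∈ kernelIn V (appendComponent V r x ∘ₗ Ω.curryLeft ∘ₗ V.subtype)) {z : Fin r → W}
    (hz : ∀ i, z i ∈ V) : Ω (Matrix.vecCons v (Fin.append z x)) = 0 := by
  obtain ⟨hvV, h0⟩ := mem_kernelIn.1 hv
  exact congrArg (fun β => β fun i => ⟨z i, hz i⟩) h0

/-- Slots `0` to `r` are vertical and the last `l` are filled by `x`. By antisymmetry the kernel
vector can be moved from any vertical slot to slot `0`, where its contraction is tested by the
component. -/
theorem AlternatingMap.apply_eq_zero_of_mem_kernelIn {Ω : W [⋀^Fin (r + l + 1)]→ₗ[ℝ] ℝ}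
    {x : Fin l → W} {w : Fin (r + l + 1) → W} {i : Fin (r + l + 1)}
    (hw : ∀ i : Fin (r + l + 1), i.val ≤ r → w i ∈ V)
    (hx : ∀ j : Fin l, w (Fin.natAdd r j).succ = x j) (hi : i.val ≤ r)
    (hv : w i ∈ kernelIn V (appendComponent V r x ∘ₗ Ω.curryLeft ∘ₗ V.subtype)) : Ω w = 0 := by
  have hwe : w = Matrix.vecCons (w 0) (Fin.append (fun i => w (Fin.castAdd l i).succ) x) := by
    ext j
    refine Fin.cases rfl (fun j => ?_) j
    refine Fin.addCases (fun j => ?_) (fun j => ?_) j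
    · simp
    · simp [hx]
  have hz : ∀ i, w (Fin.castAdd l i).succ ∈ V := fun i => hw _ (by
    simp only [Fin.val_succ, Fin.val_castAdd]; omega)
  rw [hwe]
  induction i using Fin.cases with
  | zero => exact apply_vecCons_append_eq_zero hv hz
  | succ i =>
    obtain ⟨i, rfl⟩ : ∃ i' : Fin r, i = Fin.castAdd l i' :=
      ⟨⟨i, by rw [Fin.val_succ] at hi; omega⟩, rfl⟩
    rw [AlternatingMap.vecCons_swap _ _ _ (Fin.castAdd l i), Fin.append_left,
      ← Fin.append_update_left, apply_vecCons_append_eq_zero hv, neg_zero]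
    intro j
    rcases eq_or_ne j i with rfl | hj
    · rw [Function.update_self]
      exact hw 0 (Nat.zero_le _)
    · rw [Function.update_of_ne hj]
      exact hz j

/-- `h` is a family of vectors which is dual to the linear functions `q` with kernel `V`. -/
structure IsHorizontalFrame (V : Submodule ℝ W) (q : W →ₗ[ℝ] Fin n → ℝ) (h : Fin n → W) : Prop where
  ker_eq : q.ker = V
  apply_eq : ∀ μ, q (h μ) = Pi.single μ 1

/-- The projection killing the members of a horizontal frame with index in `S`. -/
def killFrame (q : W →ₗ[ℝ] Fin n → ℝ) (h : Fin n → W) (S : Finset (Fin n)) : W →ₗ[ℝ] W :=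
  LinearMap.id - ∑ μ ∈ S, (LinearMap.proj μ ∘ₗ q).smulRight (h μ)

theorem killFrame_apply (q : W →ₗ[ℝ] Fin n → ℝ) (h : Fin n → W) (S : Finset (Fin n)) (x : W) :
    killFrame q h S x = x - ∑ μ ∈ S, q x μ • h μ := by
  simp [killFrame]

namespace IsHorizontalFrame

variable {q : W →ₗ[ℝ] Fin n → ℝ} {h : Fin n → W} (hf : IsHorizontalFrame V q h)

include hf

theorem apply_eq_zero {x : W} (hx : x ∈ V) : q x = 0 := by
  rwa [← hf.ker_eq, LinearMap.mem_ker] at hx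

theorem killFrame_of_mem (S : Finset (Fin n)) {x : W} (hx : x ∈ V) : killFrame q h S x = x := by
  simp [killFrame_apply, hf.apply_eq_zero hx]

theorem killFrame_frame (S : Finset (Fin n)) (μ : Fin n) :
    killFrame q h S (h μ) = if μ ∈ S then 0 else h μ := by
  rw [killFrame_apply, hf.apply_eq]
  split_ifs with hμ
  · rw [Finset.sum_eq_single_of_mem μ hμ (fun ν _ hν => by simp [hν]), Pi.single_eq_same, one_smul,
      sub_self]
  · rw [Finset.sum_eq_zero (fun ν hν => by simp [ne_of_mem_of_not_mem hν hμ]), sub_zero]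

theorem killFrame_univ_mem (x : W) : killFrame q h Finset.univ x ∈ V := by
  rw [← hf.ker_eq, LinearMap.mem_ker, killFrame_apply, map_sub, map_sum]
  ext μ
  simp [hf.apply_eq, Pi.single_apply]

end IsHorizontalFrame

end Horizontal

/-! ### Component systems of multilagrangian forms. -/

section Multilagrangian

variable {W : Type*} [AddCommGroup W] [Module ℝ W] {V L : Submodule ℝ W} {r l n : ℕ}

/-- The rows with index in `J` are supported in the first `r` columns, and there are more than `r`
of them, so they are dependent. -/
theorem det_eq_zero_of_card_lt {A : Matrix (Fin (r + l)) (Fin (r + l)) ℝ} {J : Finset (Fin (r + l))}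
    (hJ : r < J.card) (h0 : ∀ i ∈ J, ∀ j : Fin l, A i (Fin.natAdd r j) = 0) : A.det = 0 := by
  by_contra hdet
  have hli := (Matrix.linearIndependent_rows_of_det_ne_zero hdet).comp
    (Subtype.val : J → Fin (r + l)) Subtype.val_injective
  have hli' : LinearIndependent ℝ fun (i : J) (j : Fin r) => A i (Fin.castAdd l j) := by
    rw [Fintype.linearIndependent_iff] at hli ⊢
    intro g hg
    refine hli g ?_
    ext j
    refine Fin.addCases (fun j => ?_) (fun j => ?_) j
    · have := congrFun hg j
      simpa using this
    · simp [h0]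
  have := hli'.fintype_card_le_finrank
  rw [Module.finrank_fin_fun, Fintype.card_coe] at this
  omega

/-- The members of a horizontal frame selected by a subset of the index set. -/
def frameTuple (h : Fin n → W) (c : {c : Finset (Fin n) // c.card = l}) (j : Fin l) : W :=
  h (c.1.orderEmbOfFin c.2 j)

/-- The form is the wedge product of `r + 1` functions that vanish on `L`, extended by zero along
the frame, with the `l` coordinate functions of `q` selected by `c`. The latter vanish on `V`, so at
most `r + 1` vertical arguments are allowed, and the dual tuple gives the identity matrix. -/
theorem exists_form_apply_append_eq_one [FiniteDimensional ℝ W] {q : W →ₗ[ℝ] Fin n → ℝ}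
    {h : Fin n → W} (hf : IsHorizontalFrame V q h) (c : {c : Finset (Fin n) // c.card = l})
    (hN : r + 1 ≤ codimIn V L) {v : V} (hv : (v : W) ∉ L) (hLV : L ≤ V) :
    ∃ α ∈ annihilatorForms ℝ (r + 1 + l) L ⊓ horizontalForms V (r + 1 + l) (r + 1),
      ∃ u : Fin (r + 1) → V, u 0 = v ∧
        α (Fin.append (fun i => (u i : W)) (frameTuple h c)) = 1 := by
  obtain ⟨ξ, u, hξL, hu0, hξu⟩ := exists_dual_family (L := L.submoduleOf V) (v := v) hv hN
  let P : W →ₗ[ℝ] V := (killFrame q h Finset.univ).codRestrict V hf.killFrame_univ_mem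
  have hP : ∀ x : V, P x = x := fun x => Subtype.ext (hf.killFrame_of_mem _ x.2)
  have hPh : ∀ μ, P (h μ) = 0 := fun μ => Subtype.ext (by
    simp [P, hf.killFrame_frame])
  let Ξ : W →ₗ[ℝ] Fin (r + 1 + l) → ℝ := LinearMap.pi fun j =>
    Fin.addCases (fun j => LinearMap.proj j ∘ₗ ξ ∘ₗ P)
      (fun j => LinearMap.proj (c.1.orderEmbOfFin c.2 j) ∘ₗ q) j
  have hΞl : ∀ x j, Ξ x (Fin.castAdd l j) = ξ (P x) j := fun x j => by simp [Ξ]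
  have hΞr : ∀ x j, Ξ x (Fin.natAdd (r + 1) j) = q x (c.1.orderEmbOfFin c.2 j) := fun x j => by
    simp [Ξ]
  let α : W [⋀^Fin (r + 1 + l)]→ₗ[ℝ] ℝ := Matrix.detRowAlternating.compLinearMap Ξ
  have hα : ∀ w, α w = (Matrix.of fun i => Ξ (w i)).det := fun w => rfl
  refine ⟨α, ⟨?_, ?_⟩, u, hu0, ?_⟩
  · rintro w ⟨i, hi⟩
    rw [hα]
    refine Matrix.det_eq_zero_of_row_eq_zero i fun j => ?_
    rw [Matrix.of_apply]
    refine Fin.addCases (fun j => ?_) (fun j => ?_) j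
    · rw [hΞl, hP ⟨w i, hLV hi⟩, hξL ⟨w i, hLV hi⟩ hi, Pi.zero_apply]
    · rw [hΞr, hf.apply_eq_zero (hLV hi), Pi.zero_apply]
  · intro J w hJ hw
    rw [hα]
    refine det_eq_zero_of_card_lt hJ fun i hi j => ?_
    rw [Matrix.of_apply, hΞr, hf.apply_eq_zero (hw i hi), Pi.zero_apply]
  · rw [hα, ← Matrix.det_one (n := Fin (r + 1 + l)) (R := ℝ)]
    congr 1
    ext i j
    rw [Matrix.of_apply]
    refine Fin.addCases (fun i => ?_) (fun i => ?_) i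
    · rw [Fin.append_left]
      refine Fin.addCases (fun j => ?_) (fun j => ?_) j
      · rw [hΞl, hP, hξu, Pi.single_apply, Matrix.one_apply]
        simp [eq_comm]
      · rw [hΞr, hf.apply_eq_zero (u i).2, Matrix.one_apply_ne (by
          simp only [ne_eq, Fin.ext_iff, Fin.val_natAdd, Fin.val_castAdd]; omega), Pi.zero_apply]
    · rw [Fin.append_right, frameTuple]
      refine Fin.addCases (fun j => ?_) (fun j => ?_) j
      · rw [hΞl, hPh, map_zero, Matrix.one_apply_ne (by
          simp only [ne_eq, Fin.ext_iff, Fin.val_natAdd, Fin.val_castAdd]; omega), Pi.zero_apply]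
      · rw [hΞr, hf.apply_eq, Pi.single_apply, Matrix.one_apply]
        simp [eq_comm]

/-- Here `r` is one less than the number of vertical arguments that `Ω` admits. The kernels are
contained in `L` by the interchange argument of the polylagrangian case, with the form of
`exists_form_apply_append_eq_one`. A component is isolated by composing with the projection that
kills the frame vectors outside `a`. -/
theorem isComponentSystem_of_map_curryLeft_eq [FiniteDimensional ℝ W] {q : W →ₗ[ℝ] Fin n → ℝ}
    {h : Fin n → W} (hf : IsHorizontalFrame V q h) {Ω : W [⋀^Fin (r + l + 1)]→ₗ[ℝ] ℝ} (hLV : L ≤ V)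
    (hL : L.map Ω.curryLeft = annihilatorForms ℝ (r + l) L ⊓ horizontalForms V (r + l) r)
    (hN : r ≤ codimIn V L) (hr : 1 ≤ r ∨ codimIn V L = 0) :
    IsComponentSystem (Ω.curryLeft ∘ₗ V.subtype) (L.submoduleOf V)
      (annihilatorForms ℝ (r + l) L ⊓ horizontalForms V (r + l) r)
      fun c : {c : Finset (Fin n) // c.card = l} => appendComponent V r (frameTuple h c) where
  map_eq := by
    rw [Submodule.map_comp, Submodule.submoduleOf, Submodule.map_comap_subtype,
      inf_eq_right.2 hLV, hL]
  ker_le c v hv := by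
    by_contra hvL
    have h0 : codimIn V L ≠ 0 := fun h => by
      have := Module.finrank_zero_iff.1 h
      rw [Submodule.Quotient.subsingleton_iff] at this
      exact hvL (this ▸ Submodule.mem_top)
    obtain ⟨r, rfl⟩ : ∃ r', r = r' + 1 := ⟨r - 1, by omega⟩
    obtain ⟨α, hα, u, hu0, h1⟩ := exists_form_apply_append_eq_one hf c hN (v := v) hvL hLV
    rw [← hL] at hα
    obtain ⟨x, hx, rfl⟩ := hα
    rw [AlternatingMap.curryLeft_apply_apply] at h1
    rw [AlternatingMap.apply_eq_zero_of_mem_kernelIn (V := V) (x := frameTuple h c)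
      (i := (Fin.castAdd l (0 : Fin (r + 1))).succ)] at h1
    · exact zero_ne_one h1
    · intro i hi
      induction i using Fin.cases with
      | zero => exact hLV hx
      | succ i =>
        obtain ⟨i, rfl⟩ : ∃ i' : Fin (r + 1), i = Fin.castAdd l i' :=
          ⟨⟨i, by rw [Fin.val_succ] at hi; omega⟩, rfl⟩
        simp
    · intro j
      simp
    · simp
    · rw [Matrix.cons_val_succ, Fin.append_left, hu0]
      exact mem_kernelIn.2 ⟨v.2, hv⟩
  exists_component a α hα := by
    have hmem : ∀ x ∈ V, killFrame q h a.1ᶜ x ∈ V := fun x hx => by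
      rwa [hf.killFrame_of_mem _ hx]
    refine ⟨α.compLinearMap (killFrame q h a.1ᶜ), ⟨?_, ?_⟩, ?_, ?_⟩
    · rintro w ⟨i, hi⟩
      refine hα.1 _ ⟨i, ?_⟩
      rwa [hf.killFrame_of_mem _ (hLV hi)]
    · intro J w hJ hw
      exact hα.2 J _ hJ fun i hi => hmem _ (hw i hi)
    · ext v
      rw [appendComponent_apply, appendComponent_apply, AlternatingMap.compLinearMap_apply]
      congr 1
      ext i
      refine Fin.addCases (fun i => ?_) (fun i => ?_) i
      · rw [Fin.append_left, hf.killFrame_of_mem _ (v i).2]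
      · rw [Fin.append_right, frameTuple, hf.killFrame_frame, if_neg]
        simp
    · intro b hb
      ext v
      rw [appendComponent_apply, AlternatingMap.compLinearMap_apply]
      -- Distinct index sets of equal size: some frame vector selected by `b` lies outside `a` and
      -- is killed.
      obtain ⟨μ, hμb, hμa⟩ : ∃ μ ∈ b.1, μ ∉ a.1 := by
        by_contra! hcon
        exact hb (Subtype.ext (Finset.eq_of_subset_of_card_le hcon (by rw [a.2, b.2])))
      obtain ⟨j, rfl⟩ : ∃ j, b.1.orderEmbOfFin b.2 j = μ := by
        have : μ ∈ Set.range (b.1.orderEmbOfFin b.2) := by simpa using hμb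
        exact this
      refine α.map_coord_zero (Fin.natAdd r j) ?_
      rw [Fin.append_right, frameTuple, hf.killFrame_frame, if_pos (by simpa using hμa)]

theorem IsHorizontalFrame.bijective_coprod {q : W →ₗ[ℝ] Fin n → ℝ} {h : Fin n → W}
    (hf : IsHorizontalFrame V q h) :
    Function.Bijective (V.subtype.coprod (Fintype.linearCombination ℝ h)) := by
  have hq : ∀ y, q (Fintype.linearCombination ℝ h y) = y := fun y => by
    ext μ
    simp [Fintype.linearCombination_apply, hf.apply_eq, Pi.single_apply]
  constructor
  · rw [← LinearMap.ker_eq_bot, LinearMap.ker_eq_bot']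
    rintro ⟨x, y⟩ hxy
    have hy : y = 0 := by
      have := congrArg q hxy
      rwa [LinearMap.coprod_apply, map_add, Submodule.subtype_apply, hf.apply_eq_zero x.2, hq,
        zero_add, map_zero] at this
    subst hy
    rw [LinearMap.coprod_apply, map_zero, add_zero] at hxy
    exact Prod.ext (Subtype.ext hxy) rfl
  · intro w
    refine ⟨(⟨_, hf.killFrame_univ_mem w⟩, q w), ?_⟩
    simp [killFrame_apply, Fintype.linearCombination_apply]

/-- Two spaces with a subspace, a flag and a horizontal frame are isomorphic if the dimensions
agree. -/
theorem IsHorizontalFrame.exists_linearEquiv [FiniteDimensional ℝ W] {W' : Type*} [AddCommGroup W']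
    [Module ℝ W'] [FiniteDimensional ℝ W'] {V' L' : Submodule ℝ W'} {q : W →ₗ[ℝ] Fin n → ℝ}
    {h : Fin n → W} {q' : W' →ₗ[ℝ] Fin n → ℝ} {h' : Fin n → W'} (hf : IsHorizontalFrame V q h)
    (hf' : IsHorizontalFrame V' q' h') (hLV : L ≤ V) (hLV' : L' ≤ V')
    (hV : finrank ℝ V = finrank ℝ V') (hL : finrank ℝ L = finrank ℝ L') :
    ∃ e : W ≃ₗ[ℝ] W', (∀ x, x ∈ V ↔ e x ∈ V') ∧ (∀ x, x ∈ L ↔ e x ∈ L') ∧ ∀ μ, e (h μ) = h' μ := by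
  obtain ⟨e1, he1⟩ := exists_linearEquiv_mem_iff (L := L.submoduleOf V) (L' := L'.submoduleOf V') hV
    (by rwa [(Submodule.submoduleOfEquivOfLe hLV).finrank_eq,
      (Submodule.submoduleOfEquivOfLe hLV').finrank_eq])
  let E := LinearEquiv.ofBijective _ hf.bijective_coprod
  let E' := LinearEquiv.ofBijective _ hf'.bijective_coprod
  let e : W ≃ₗ[ℝ] W' := E.symm ≪≫ₗ e1.prodCongr (LinearEquiv.refl ℝ (Fin n → ℝ)) ≪≫ₗ E'
  have heV : ∀ x : V, e x = e1 x := fun x => by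
    have : E (x, 0) = x := by simp [E]
    have h2 : E.symm (x : W) = (x, 0) := by rw [← this, E.symm_apply_apply]
    simp [e, h2, E']
  have heh : ∀ μ, e (h μ) = h' μ := fun μ => by
    have : E (0, Pi.single μ 1) = h μ := by simp [E]
    have h2 : E.symm (h μ) = (0, Pi.single μ 1) := by rw [← this, E.symm_apply_apply]
    simp [e, h2, E']
  have heV' : ∀ x, x ∈ V ↔ e x ∈ V' := by
    intro x
    constructor
    · intro hx
      rw [heV ⟨x, hx⟩]
      exact (e1 _).2
    · intro hx
      have h1 : e (e1.symm ⟨e x, hx⟩) = e x := by rw [heV, LinearEquiv.apply_symm_apply]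
      rw [← e.injective h1]
      exact (e1.symm _).2
  refine ⟨e, heV', fun x => ?_, heh⟩
  constructor
  · intro hx
    rw [heV ⟨x, hLV hx⟩]
    exact (he1 ⟨x, hLV hx⟩).1 hx
  · intro hx
    have hxV := (heV' x).2 (hLV' hx)
    refine (he1 ⟨x, hxV⟩).2 ?_
    rw [heV ⟨x, hxV⟩] at hx
    exact hx

theorem IsHorizontalFrame.exists_equiv_forms [FiniteDimensional ℝ W] {W' : Type*} [AddCommGroup W']
    [Module ℝ W'] [FiniteDimensional ℝ W'] {V' L' : Submodule ℝ W'} {q : W →ₗ[ℝ] Fin n → ℝ}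
    {h : Fin n → W} {q' : W' →ₗ[ℝ] Fin n → ℝ} {h' : Fin n → W'} (hf : IsHorizontalFrame V q h)
    (hf' : IsHorizontalFrame V' q' h') (hLV : L ≤ V) (hLV' : L' ≤ V')
    (hV : finrank ℝ V = finrank ℝ V') (hL : finrank ℝ L = finrank ℝ L') (r l : ℕ) :
    ∃ Φ : (W [⋀^Fin (r + l)]→ₗ[ℝ] ℝ) ≃ₗ[ℝ] (W' [⋀^Fin (r + l)]→ₗ[ℝ] ℝ),
      (∀ α, α ∈ annihilatorForms ℝ (r + l) L ⊓ horizontalForms V (r + l) r ↔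
        Φ α ∈ annihilatorForms ℝ (r + l) L' ⊓ horizontalForms V' (r + l) r) ∧
      ∀ (c : {c : Finset (Fin n) // c.card = l}) (α),
        α ∈ (appendComponent V r (frameTuple h c)).ker ↔
          Φ α ∈ (appendComponent V' r (frameTuple h' c)).ker := by
  obtain ⟨e, heV, heL, heh⟩ := hf.exists_linearEquiv hf' hLV hLV' hV hL
  have heV' : ∀ x, x ∈ V' ↔ e.symm x ∈ V := fun x => by rw [heV, e.apply_symm_apply]
  have heL' : ∀ x, x ∈ L' ↔ e.symm x ∈ L := fun x => by rw [heL, e.apply_symm_apply]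
  have heh' : ∀ μ, e.symm (h' μ) = h μ := fun μ => by rw [← heh, e.symm_apply_apply]
  have hΦ : ∀ (α : W [⋀^Fin (r + l)]→ₗ[ℝ] ℝ) v,
      AlternatingMap.domLCongr ℝ ℝ (Fin (r + l)) ℝ e α v = α fun i => e.symm (v i) :=
    fun α v => rfl
  refine ⟨AlternatingMap.domLCongr ℝ ℝ (Fin (r + l)) ℝ e, fun α => ?_, fun c α => ?_⟩
  · refine and_congr ⟨fun hα v hv => ?_, fun hα v hv => ?_⟩
      ⟨fun hα J w hJ hw => ?_, fun hα J w hJ hw => ?_⟩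
    · obtain ⟨i, hi⟩ := hv
      exact hα _ ⟨i, (heL' _).1 hi⟩
    · obtain ⟨i, hi⟩ := hv
      have := hα (fun i => e (v i)) ⟨i, (heL _).1 hi⟩
      simpa [hΦ] using this
    · exact hα J _ hJ fun i hi => (heV' _).1 (hw i hi)
    · have := hα J (fun i => e (w i)) hJ fun i hi => (heV _).1 (hw i hi)
      simpa [hΦ] using this
  · simp only [LinearMap.mem_ker]
    have happ : ∀ v : Fin r → W', (fun i => e.symm (Fin.append v (frameTuple h' c) i)) =
        Fin.append (fun i => e.symm (v i)) (frameTuple h c) := fun v => by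
      ext i
      refine Fin.addCases (fun i => ?_) (fun i => ?_) i
      · simp
      · simp [frameTuple, heh']
    constructor
    · intro hα
      ext v
      rw [appendComponent_apply, hΦ, happ]
      exact congrArg (fun β => β fun i => ⟨e.symm (v i), (heV' _).1 (v i).2⟩) hα
    · intro hα
      ext v
      have := congrArg (fun β => β fun i => (⟨e (v i), (heV _).1 (v i).2⟩ : V')) hα
      simp only [appendComponent_apply, hΦ, happ, e.symm_apply_apply] at this
      simpa using this

end Multilagrangian

/-! ### Closed forms on the total space and their component kernels. -/

section MultilagrangianBundles

theorem Fin.val_succAbove_le {k : ℕ} (i : Fin (k + 1)) (j : Fin k) :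
    (i.succAbove j).val ≤ j.val + 1 := by
  rw [Fin.succAbove]
  split_ifs <;> simp

variable {EP : Type*} [NormedAddCommGroup EP] [NormedSpace ℝ EP] [FiniteDimensional ℝ EP]
  {EM : Type*} [NormedAddCommGroup EM] [NormedSpace ℝ EM] [FiniteDimensional ℝ EM]
  {P : Type*} [TopologicalSpace P] [ChartedSpace EP P] [IsManifold 𝓘(ℝ, EP) ∞ P]
  {M : Type*} [TopologicalSpace M] [ChartedSpace EM M] [IsManifold 𝓘(ℝ, EM) ∞ M]

theorem functionDeriv_eq_zero {f : P → ℝ} {p : P} (hf : ∀ᶠ q in 𝓝 p, f q = 0)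
    (v : TangentSpace 𝓘(ℝ, EP) p) : functionDeriv f p v = 0 := by
  have h : f =ᶠ[𝓝 p] fun _ => (0 : ℝ) := hf
  have h2 := (hasMFDerivAt_const (I := 𝓘(ℝ, EP)) (I' := 𝓘(ℝ, ℝ)) (0 : ℝ) p).congr_of_eventuallyEq h
  rw [functionDeriv, h2.mfderiv]
  rfl

/-- The kernels of the components of a closed form of restricted verticality are closed under
brackets. -/
theorem FormField.IsClosedForm.mlieBracket_mem_kernelIn {pr : P → M}
    (hpr : ContMDiff 𝓘(ℝ, EP) 𝓘(ℝ, EM) ∞ pr) {p₀ : P}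
    (hsurj : Function.Surjective (mfderiv 𝓘(ℝ, EP) 𝓘(ℝ, EM) pr p₀)) {r l : ℕ} (hl : 1 ≤ l)
    {Ω : FormField EP P (r + l + 1)} (hΩ : Ω.IsClosedForm) {U : Set P} (hU : IsOpen U)
    (hp₀ : p₀ ∈ U)
    (hhor : ∀ p, Ω p ∈ horizontalForms (verticalSpace EP EM pr p) (r + l + 1) (r + 1))
    {h : Fin l → ∀ p : P, TangentSpace 𝓘(ℝ, EP) p} (hh : ∀ j, SmoothFieldOn (h j) U)
    {a : Fin l → EM}
    (hha : ∀ j, ∀ p ∈ U, p ∈ chartNhd EP EM pr p₀ → projDeriv EM pr p₀ p (h j p) = a j)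
    {X Y : ∀ p : P, TangentSpace 𝓘(ℝ, EP) p} (hX : SmoothFieldOn X U) (hY : SmoothFieldOn Y U)
    (hXK : ∀ p ∈ U, X p ∈ kernelIn (verticalSpace EP EM pr p)
      (appendComponent (verticalSpace EP EM pr p) r (fun j => h j p) ∘ₗ (Ω p).curryLeft ∘ₗ
        (verticalSpace EP EM pr p).subtype))
    (hYK : ∀ p ∈ U, Y p ∈ kernelIn (verticalSpace EP EM pr p)
      (appendComponent (verticalSpace EP EM pr p) r (fun j => h j p) ∘ₗ (Ω p).curryLeft ∘ₗ
        (verticalSpace EP EM pr p).subtype)) :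
    mlieBracket 𝓘(ℝ, EP) X Y p₀ ∈ kernelIn (verticalSpace EP EM pr p₀)
      (appendComponent (verticalSpace EP EM pr p₀) r (fun j => h j p₀) ∘ₗ (Ω p₀).curryLeft ∘ₗ
        (verticalSpace EP EM pr p₀).subtype) := by
  have hXV : ∀ p ∈ U, X p ∈ verticalSpace EP EM pr p := fun p hp => (mem_kernelIn.1 (hXK p hp)).1
  have hYV : ∀ p ∈ U, Y p ∈ verticalSpace EP EM pr p := fun p hp => (mem_kernelIn.1 (hYK p hp)).1
  obtain ⟨U₁, Z, -, hU₁, hp₁, -, hZ, hZ₀, -, -⟩ := exists_adapted_fields (p₀ := p₀) hpr hsurj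
  have hU₂ : IsOpen (U ∩ U₁) := hU.inter hU₁
  have hp₂ : p₀ ∈ U ∩ U₁ := ⟨hp₀, hp₁⟩
  have hbr : mlieBracket 𝓘(ℝ, EP) X Y p₀ ∈ verticalSpace EP EM pr p₀ :=
    mlieBracket_mem_verticalSpace hpr hU hp₀ hX hY
      (fun p hp hpc => (projDeriv_eq_zero_iff hpc _).2 (hXV p hp))
      (fun p hp hpc => (projDeriv_eq_zero_iff hpc _).2 (hYV p hp))
  refine mem_kernelIn.2 ⟨hbr, ?_⟩
  ext z
  -- The fields with index at most `r + 1`, namely `X`, `Y` and the `r` extensions, are vertical;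
  -- the last `l` are the horizontal fields `h`.
  let W : Fin (r + l + 2) → ∀ p : P, TangentSpace 𝓘(ℝ, EP) p :=
    Matrix.vecCons X (Matrix.vecCons Y (Fin.append (fun j => Z (z j)) h))
  have hWZ : ∀ j, W (Fin.castAdd l j).succ.succ = Z (z j) := fun j => by simp [W]
  have hWh : ∀ j, W (Fin.natAdd r j).succ.succ = h j := fun j => by simp [W]
  have hWs : ∀ i, SmoothFieldOn (W i) (U ∩ U₁) := by
    intro i
    refine Fin.cases ?_ (fun i => Fin.cases ?_ (fun i => ?_) i) i
    · exact hX.mono Set.inter_subset_left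
    · exact hY.mono Set.inter_subset_left
    · refine Fin.addCases (fun j => ?_) (fun j => ?_) i
      · rw [hWZ]
        exact (hZ _).1.mono Set.inter_subset_right
      · rw [hWh]
        exact (hh j).mono Set.inter_subset_left
  have hWv : ∀ p ∈ U ∩ U₁, ∀ i, i.val ≤ r + 1 → W i p ∈ verticalSpace EP EM pr p := by
    intro p hp i
    refine Fin.cases ?_ (fun i => Fin.cases ?_ (fun i => ?_) i) i
    · exact fun _ => hXV p hp.1
    · exact fun _ => hYV p hp.1
    · refine Fin.addCases (fun j => ?_) (fun j => ?_) i
      · rw [hWZ]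
        exact fun _ => (hZ _).2 p hp.2
      · intro hj
        simp only [Fin.val_succ, Fin.val_natAdd] at hj
        omega
  -- All fields have constant projection in the chart of the base, so that every bracket in Cartan's
  -- formula is vertical.
  have hWa : ∀ i, ∃ b : EM, ∀ p ∈ U ∩ U₁, p ∈ chartNhd EP EM pr p₀ →
      projDeriv EM pr p₀ p (W i p) = b := by
    intro i
    by_cases hi : i.val ≤ r + 1
    · exact ⟨0, fun p hp hpc => (projDeriv_eq_zero_iff hpc _).2 (hWv p hp i hi)⟩
    · obtain ⟨j, rfl⟩ : ∃ j : Fin l, i = (Fin.natAdd r j).succ.succ :=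
        ⟨⟨i.val - (r + 2), by omega⟩, by
          ext
          simp only [Fin.val_succ, Fin.val_natAdd]
          omega⟩
      rw [hWh]
      exact ⟨a j, fun p hp hpc => hha j p hp.1 hpc⟩
  have hWbr : ∀ i j, mlieBracket 𝓘(ℝ, EP) (W i) (W j) p₀ ∈ verticalSpace EP EM pr p₀ := by
    intro i j
    obtain ⟨b, hb⟩ := hWa i
    obtain ⟨b', hb'⟩ := hWa j
    exact mlieBracket_mem_verticalSpace hpr hU₂ hp₂ (hWs i) (hWs j) hb hb'
  have hW0 : ∀ p ∈ U, ∀ i, i.val ≤ 1 → W i p ∈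
      kernelIn (verticalSpace EP EM pr p)
        (appendComponent (verticalSpace EP EM pr p) r (fun j => h j p) ∘ₗ (Ω p).curryLeft ∘ₗ
          (verticalSpace EP EM pr p).subtype) := by
    intro p hp i hi
    obtain rfl | rfl : i = 0 ∨ i = 1 := by
      rw [Fin.ext_iff, Fin.ext_iff]
      exact Nat.le_one_iff_eq_zero_or_eq_one.1 hi
    · exact hXK p hp
    · exact hYK p hp
  have h2 := eq_zero_of_cartan_sum_eq_zero (hΩ (U ∩ U₁) W hU₂ hWs p₀ hp₂) ?_ ?_
  · refine Eq.trans (congrArg (Ω p₀) (funext fun i => ?_)) h2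
    refine Fin.cases rfl (fun i => ?_) i
    refine Fin.addCases (fun j => ?_) (fun j => ?_) i
    · exact (Fin.append_left (fun i => (z i : TangentSpace 𝓘(ℝ, EP) p₀)) (fun j => h j p₀) j).trans ((congrFun (hWZ j) p₀).trans (hZ₀ _ (z j).2)).symm
    · exact (Fin.append_right (fun i => (z i : TangentSpace 𝓘(ℝ, EP) p₀)) (fun j => h j p₀) j).trans (congrFun (hWh j) p₀).symm
  · intro i
    refine functionDeriv_eq_zero ?_ _
    filter_upwards [hU₂.mem_nhds hp₂] with p hp
    -- If a vertical field is removed, all of `h` and one of `X`, `Y` remain, and the component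
    -- kernel applies. If a member of `h` is removed, `r + 2` vertical arguments remain, one too
    -- many for `Ω`.
    rcases le_or_gt i.val (r + 1) with hi | hi
    · refine AlternatingMap.apply_eq_zero_of_mem_kernelIn (i := 0) (fun j hj => ?_) (fun j => ?_)
        (Nat.zero_le _) (hW0 p hp.1 _ (Fin.val_succAbove_le i 0))
      · exact hWv p hp _ ((Fin.val_succAbove_le i j).trans (by omega))
      · rw [Fin.removeNth, Fin.succAbove_of_le_castSucc _ _ (by
          rw [Fin.le_def]; simp only [Fin.val_castSucc, Fin.val_succ, Fin.val_natAdd]; omega), hWh]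
    · refine apply_eq_zero_of_mem_horizontalForms (hhor p) (by omega) fun j hj => ?_
      rw [Fin.removeNth, Fin.succAbove_of_castSucc_lt _ _ (by
        rw [Fin.lt_def]; simp only [Fin.val_castSucc]; omega)]
      exact hWv p hp _ hj
  · intro i j hij hj
    have hij' := Fin.le_def.1 hij
    have hj0 : 0 < j.val := Nat.pos_of_ne_zero fun h0 => hj (Fin.ext h0)
    -- For `j ≤ r` both removed fields are vertical: all of `h` and, since `j ≠ 0`, one of `X`, `Y`
    -- remain. Otherwise a member of `h` is missing, and the vertical bracket brings the number of
    -- vertical arguments to at least `r + 2`.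
    rcases le_or_gt j.val r with hjr | hjr
    · refine AlternatingMap.apply_eq_zero_of_mem_kernelIn
        (V := verticalSpace EP EM pr p₀) (x := fun j => h j p₀)
        (i := (⟨0, by omega⟩ : Fin (r + l)).succ) (fun m => ?_) (fun m => ?_)
        (show 0 + 1 ≤ r by omega) ?_
      · refine Fin.cases (fun _ => hWbr _ _) (fun m hm => ?_) m
        rw [Fin.val_succ] at hm
        refine hWv p₀ hp₂ _ ((Fin.val_succAbove_le _ _).trans ?_)
        exact (Nat.succ_le_succ (Fin.val_succAbove_le _ _)).trans (Nat.succ_le_succ hm)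
      · rw [Matrix.cons_val_succ, Fin.removeNth, Fin.removeNth,
          Fin.succAbove_of_le_castSucc j _ (by
            rw [Fin.le_def]; simp only [Fin.val_castSucc, Fin.val_natAdd]; omega),
          Fin.succAbove_of_le_castSucc _ _ (by
            rw [Fin.le_def]; simp only [Fin.val_castSucc, Fin.val_succ, Fin.val_natAdd]; omega),
          hWh]
      · refine hW0 p₀ hp₀ _ ((Fin.val_succAbove_le _ _).trans ?_)
        rw [Fin.succAbove_of_castSucc_lt j _ (by
          rw [Fin.lt_def]; simp only [Fin.val_castSucc]; omega)]
        simp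
    · refine apply_eq_zero_of_mem_horizontalForms (hhor p₀) (by omega) fun m => ?_
      refine Fin.cases (fun _ => hWbr _ _) (fun m hm => ?_) m
      rw [Matrix.cons_val_succ]
      refine hWv p₀ hp₂ _ ((Fin.val_succAbove_le _ _).trans ?_)
      rw [Fin.val_succ] at hm
      rw [Fin.succAbove_of_castSucc_lt _ _ (by
        rw [Fin.lt_def]; simp only [Fin.val_castSucc]; omega), Fin.val_castSucc]
      exact hm

end MultilagrangianBundles

/-! ### The multilagrangian case. -/

section MultilagrangianIntegrability

variable {EP : Type*} [NormedAddCommGroup EP] [NormedSpace ℝ EP] [FiniteDimensional ℝ EP]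
  {EM : Type*} [NormedAddCommGroup EM] [NormedSpace ℝ EM] [FiniteDimensional ℝ EM]
  {P : Type*} [TopologicalSpace P] [ChartedSpace EP P] [IsManifold 𝓘(ℝ, EP) ∞ P]
  {M : Type*} [TopologicalSpace M] [ChartedSpace EM M] [IsManifold 𝓘(ℝ, EM) ∞ M]

theorem Fin.append_apply {α : Type*} {β : α → Type*} {r l : ℕ} (u : Fin r → ∀ a, β a)
    (x : Fin l → ∀ a, β a) (j : Fin (r + l)) (a : α) :
    Fin.append u x j a = Fin.append (fun j => u j a) (fun j => x j a) j := by
  refine Fin.addCases (fun j => ?_) (fun j => ?_) j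
  · rw [Fin.append_left, Fin.append_left]
  · rw [Fin.append_right, Fin.append_right]

/-- The components of the derivative of `pr`, read in a chart around `pr p₀`, in a basis. -/
def projComponents {n : ℕ} (w : Basis (Fin n) ℝ EM) (pr : P → M) (p₀ p : P) :
    TangentSpace 𝓘(ℝ, EP) p →ₗ[ℝ] Fin n → ℝ :=
  w.equivFun.toLinearMap ∘ₗ (chartDeriv (EP := EM) (pr p₀) (pr p)).toLinearMap ∘ₗ
    (mfderiv 𝓘(ℝ, EP) 𝓘(ℝ, EM) pr p).toLinearMap

theorem projComponents_apply {n : ℕ} (w : Basis (Fin n) ℝ EM) (pr : P → M) (p₀ p : P)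
    (v : TangentSpace 𝓘(ℝ, EP) p) :
    projComponents w pr p₀ p v = w.equivFun (projDeriv EM pr p₀ p v) := rfl

theorem isHorizontalFrame_projComponents {n : ℕ} (w : Basis (Fin n) ℝ EM) {pr : P → M} {p₀ p : P}
    (hp : p ∈ chartNhd EP EM pr p₀) {h : Fin n → TangentSpace 𝓘(ℝ, EP) p}
    (hh : ∀ μ, projDeriv EM pr p₀ p (h μ) = w μ) :
    IsHorizontalFrame (verticalSpace EP EM pr p) (projComponents w pr p₀ p) h where
  ker_eq := by
    ext v
    rw [LinearMap.mem_ker, projComponents_apply, w.equivFun.map_eq_zero_iff,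
      projDeriv_eq_zero_iff hp]
  apply_eq μ := by
    ext ν
    rw [projComponents_apply, hh, w.equivFun_self, Pi.single_apply]
    simp only [eq_comm]

/-- The integrability theorem for multilagrangian bundles. -/
theorem IsMultilagrangianBundleForm.integrable {pr : P → M}
    (hpr : ContMDiff 𝓘(ℝ, EP) 𝓘(ℝ, EM) ∞ pr)
    (hsurj : ∀ p, Function.Surjective (mfderiv 𝓘(ℝ, EP) 𝓘(ℝ, EM) pr p)) {r l N : ℕ}
    {Ω : FormField EP P (r + l + 1)} {L : ∀ p : P, Submodule ℝ (TangentSpace 𝓘(ℝ, EP) p)}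
    (hrN : r ≤ N) (hr : 1 ≤ r ∨ N = 0) (hΩ : IsMultilagrangianBundleForm pr EM (r + 1) N Ω)
    (hL : ∀ p : P, codimIn (verticalSpace EP EM pr p) (L p) = N ∧
      IsMultilagrangianSubspace (verticalSpace EP EM pr p) (r + 1) (Ω p) (L p))
    (hn : 3 ≤ (finrank ℝ EM).choose l) :
    IsSmoothDistribution L ∧ IsInvolutiveDistribution L ∧ IsIntegrableDistribution L := by
  -- For `l = 0` there would be only one component.
  have hl : 1 ≤ l := by
    by_contra! h0
    obtain rfl : l = 0 := by omega
    rw [Nat.choose_zero_right] at hn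
    omega
  have hfd : ∀ p : P, FiniteDimensional ℝ (TangentSpace 𝓘(ℝ, EP) p) := fun p =>
    inferInstanceAs (FiniteDimensional ℝ EP)
  have hLV : ∀ p, L p ≤ verticalSpace EP EM pr p := fun p => (hL p).2.1
  have hV : ∀ p q : P, finrank ℝ (verticalSpace EP EM pr p) =
      finrank ℝ (verticalSpace EP EM pr q) := fun p q => by
    have h1 := finrank_verticalSpace (hsurj p)
    have h2 := finrank_verticalSpace (hsurj q)
    omega
  have hLdim : ∀ p q, finrank ℝ (L p) = finrank ℝ (L q) := fun p q => by
    have h1 := finrank_add_codimIn (hLV p)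
    have h2 := finrank_add_codimIn (hLV q)
    rw [(hL p).1] at h1
    rw [(hL q).1, hV q p] at h2
    omega
  let w := finBasis ℝ EM
  rcases isEmpty_or_nonempty P with hP | ⟨⟨q⟩⟩
  · exact ⟨fun p => isEmptyElim p, fun _ _ _ _ _ _ _ _ p => isEmptyElim p, fun p => isEmptyElim p⟩
  refine integrable_of_componentSystems (ι := {c : Finset (Fin (finrank ℝ EM)) // c.card = l})
    (by simpa using hn) (V := verticalSpace EP EM pr) (d := finrank ℝ (L q)) (m := r)
    (fun p => hLdim p q) hLV (fun p => TangentSpace 𝓘(ℝ, EP) p [⋀^Fin (r + l)]→ₗ[ℝ] ℝ)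
    (fun p => (Ω p).curryLeft ∘ₗ (verticalSpace EP EM pr p).subtype)
    (fun p => annihilatorForms ℝ (r + l) (L p) ⊓
      horizontalForms (verticalSpace EP EM pr p) (r + l) r) fun p₀ => ?_
  obtain ⟨U₁, Z, H, hU₁, hp₁, hU₁c, hZ, hZ₀, hH, hHw⟩ :=
    exists_adapted_fields (p₀ := p₀) hpr (hsurj p₀)
  obtain ⟨U, hUU₁, hU, hp₀, s, X, hX, hXli, hXspan⟩ :=
    exists_vertical_frame hsurj hU₁ hp₁ hZ hZ₀
  -- Lifts of a basis of the constant fields of the base chart form the horizontal frame; its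
  -- `l`-element subfamilies index the components.
  have hf : ∀ p ∈ U, IsHorizontalFrame (verticalSpace EP EM pr p) (projComponents w pr p₀ p)
      fun μ => H (w μ) p := fun p hp =>
    isHorizontalFrame_projComponents w (hU₁c (hUU₁ hp)) fun μ => hHw (w μ) p (hUU₁ hp)
  have hdim := fun p hp => (hf p hp).exists_equiv_forms (hf p₀ hp₀) (hLV p) (hLV p₀) (hV p p₀)
    (hLdim p p₀) r l
  refine ⟨U, fun c p => appendComponent (verticalSpace EP EM pr p) r
    (frameTuple (fun μ => H (w μ) p) c), s, X, hU, hp₀, ?_, ?_, ?_, fun i => (hX i).1, hXli, hXspan,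
    ?_, ?_⟩
  · intro p hp
    refine isComponentSystem_of_map_curryLeft_eq (hf p hp) (hLV p) (hL p).2.2 ?_ ?_
    · rwa [(hL p).1]
    · rwa [(hL p).1]
  · intro p hp
    obtain ⟨Φ, h1, -⟩ := hdim p hp
    exact finrank_eq_of_mem_iff Φ h1
  · intro a p hp
    obtain ⟨Φ, h1, h2⟩ := hdim p hp
    refine finrank_eq_of_mem_iff Φ fun x => ?_
    rw [Submodule.mem_inf, Submodule.mem_inf (p := annihilatorForms ℝ (r + l) (L p₀) ⊓
      horizontalForms (verticalSpace EP EM pr p₀) (r + l) r), mem_infExcept, mem_infExcept]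
    exact and_congr (h1 x) (forall₂_congr fun c _ => h2 c x)
  · intro c i I
    refine ⟨_, hΩ.smooth U (Matrix.vecCons (X i) (Fin.append (fun j => X (I j))
      fun j => H (w (c.1.orderEmbOfFin c.2 j)))) hU (fun j => ?_), fun p hp hi hI => ?_⟩
    · refine Fin.cases (hX i).1 (fun j => ?_) j
      refine Fin.addCases (fun j => ?_) (fun j => ?_) j
      · simpa using (hX (I j)).1
      · simpa using (hH (w (c.1.orderEmbOfFin c.2 j))).mono hUU₁
    · refine congrArg (Ω p) (funext fun j => ?_)
      refine Fin.cases rfl (fun j => ?_) j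
      exact Fin.append_apply (fun j => X (I j)) (fun j => H (w (c.1.orderEmbOfFin c.2 j))) j p
  · intro c U' X Y hU' hp₀' hU'U hX hY hXK hYK
    exact hΩ.closed.mlieBracket_mem_kernelIn hpr (hsurj p₀) hl hU' hp₀'
      (fun p => (hΩ.multilagrangian p).2.1) (h := fun j => H (w (c.1.orderEmbOfFin c.2 j)))
      (fun j => (hH _).mono (hU'U.trans hUU₁)) (a := fun j => w (c.1.orderEmbOfFin c.2 j))
      (fun j p hp _ => hHw _ p (hUU₁ (hU'U hp))) hX hY hXK hYK

end MultilagrangianIntegrability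

end

theorem mainTheorem3
    {EP : Type*} [NormedAddCommGroup EP] [NormedSpace ℝ EP] [FiniteDimensional ℝ EP]
    {EM : Type*} [NormedAddCommGroup EM] [NormedSpace ℝ EM] [FiniteDimensional ℝ EM]
    {EF : Type*} [NormedAddCommGroup EF] [NormedSpace ℝ EF] [FiniteDimensional ℝ EF]
    {P : Type*} [TopologicalSpace P] [ChartedSpace EP P] [IsManifold 𝓘(ℝ, EP) ∞ P]
    {M : Type*} [TopologicalSpace M] [ChartedSpace EM M] [IsManifold 𝓘(ℝ, EM) ∞ M]
    {F : Type*} [TopologicalSpace F] [ChartedSpace EF F] [IsManifold 𝓘(ℝ, EF) ∞ F]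
    (n : ℕ) (hn : Module.finrank ℝ EM = n)
    (pr : P → M) (hpr : IsSmoothFiberBundle EP EM EF F pr) :
    -- the polylagrangian case
    (∀ (FT : Type*) [NormedAddCommGroup FT] [NormedSpace ℝ FT] [FiniteDimensional ℝ FT]
      (T : M → Type*) [∀ m, AddCommGroup (T m)] [∀ m, Module ℝ (T m)]
      [∀ m, TopologicalSpace (T m)] [TopologicalSpace (Bundle.TotalSpace FT T)]
      [FiberBundle FT T] [VectorBundle ℝ FT T] [ContMDiffVectorBundle ∞ FT T 𝓘(ℝ, EM)]
      (k N : ℕ) (Ω : VerticalForm EP EM pr T (k + 1))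
      (L : ∀ p : P, Submodule ℝ (TangentSpace 𝓘(ℝ, EP) p)),
      (1 ≤ k ∨ N = 0) →
      IsPolylagrangianBundleForm FT N Ω →
      (∀ p : P, L p ≤ verticalSpace EP EM pr p ∧ codimIn (verticalSpace EP EM pr p) (L p) = N ∧
        IsPolylagrangianSubspace (Ω p) ((L p).submoduleOf (verticalSpace EP EM pr p))) →
      3 ≤ Module.finrank ℝ FT →
      IsSmoothDistribution L ∧ IsInvolutiveDistribution L ∧ IsIntegrableDistribution L) ∧
    -- the multilagrangian case
    (∀ (k r N : ℕ) (Ω : FormField EP P (k + 1))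
      (L : ∀ p : P, Submodule ℝ (TangentSpace 𝓘(ℝ, EP) p)),
      1 ≤ r → r ≤ k + 1 → k + 1 - r ≤ n →
      r ≤ N + 1 → (2 ≤ r ∨ N = 0) →
      IsMultilagrangianBundleForm pr EM r N Ω →
      (∀ p : P, codimIn (verticalSpace EP EM pr p) (L p) = N ∧
        IsMultilagrangianSubspace (verticalSpace EP EM pr p) r (Ω p) (L p)) →
      3 ≤ n.choose (k + 1 - r) →
      IsSmoothDistribution L ∧ IsInvolutiveDistribution L ∧ IsIntegrableDistribution L) := by
  have hprs := hpr.contMDiff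
  refine ⟨?_, ?_⟩
  · intro FT _ _ _ T _ _ _ _ _ _ _ k N Ω L hk hΩ hL hFT
    exact hΩ.integrable hprs hpr.surjective_mfderiv hk hL hFT
  · intro k r N Ω L hr hrk _ hrN hN hΩ hL hch
    -- Shifting `r` by one and writing `k = r + l` turns the horizontality degree into `l`.
    obtain ⟨r, rfl⟩ : ∃ r', r = r' + 1 := ⟨r - 1, by omega⟩
    obtain ⟨l, rfl⟩ : ∃ l, k = r + l := ⟨k - r, by omega⟩
    have hl : r + l + 1 - (r + 1) = l := by omega
    rw [hl, ← hn] at hch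
    exact hΩ.integrable hprs hpr.surjective_mfderiv (by omega) (by omega) hL hch
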